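/- Fix a dimension $d\ge 1$ and a sign $\mu=\pm1$, put $F(z)=\mu|z|^{4/d}z$, and let $e^{it\Delta}$ be the free Schrödinger propagator on $L^2(\mathbb R^d)$, the Fourier multiplier with symbol $e^{-it|\xi|^2}$. A (strong $L^2$) solution of $iu_t+\Delta u=F(u)$ on an interval $I\subset\mathbb R$ is a function $u\in C^0_{t,\mathrm{loc}}L^2_x(I\times\mathbb R^d)\cap L^{2(d+2)/d}_{t,\mathrm{loc}}L^{2(d+2)/d}_x(I\times\mathbb R^d)$ with $$u(t_1)=e^{i(t_1-t_0)\Delta}u(t_0)-i\int_{t_0}^{t_1}e^{i(t_1-s)\Delta}F(u(s))\,ds\qquad\text{for all }t_0,t_1\in I,$$ the integral being taken in the sense of tempered distributions. It has maximal lifespan if it does not extend to a solution on a strictly larger interval. Let $G$ be the group of the unitary maps $f\mapsto \lambda^{-d/2}e^{i\theta}e^{ix\cdot\xi_0}f((x-x_0)/\lambda)$ of $L^2(\mathbb R^d)$, with $\theta\in\mathbb R$, $\xi_0,x_0\in\mathbb R^d$ and $\lambda>0$. The solution $u$ is almost periodic modulo $G$ if $\{Gu(t):t\in I\}$ has compact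 closure in $G\backslash L^2(\mathbb R^d)$ with the quotient topology. Let $u$ be a maximal-lifespan solution on $I$ which is almost periodic modulo $G$. Then: 1. $e^{-it\Delta}u(t)$ converges weakly to zero in $L^2(\mathbb R^d)$ as $t\to\sup I$ and as $t\to\inf I$ (each endpoint may be finite or infinite). 2. For every $t\in I$ the improper integrals below converge conditionally in the weak topology of $L^2(\mathbb R^d)$; that is, the integrals over $[t,t_+]$ and $[t_-,t]$, with $t_\pm\in I$, are elements of $L^2(\mathbb R^d)$ that have weak limits as $t_+\to\sup I$ and as $t_-\to\inf I$. They satisfy the backward and the forward Duhamel formula $$u(t)=i\int_t^{\sup I}e^{i(t-s)\Delta}F(u(s))\,ds,\qquad u(t)=-i\int_{\inf I}^te^{i(t-s)\Delta}F(u(s))\,ds,$$ and, for every linear operator $P:L^2(\mathbb R^d)\to L^2(\mathbb R^d)$, the two-way Duhamel formula $$u(t)=iP\int_t^{\sup I}e^{i(t-s)\Delta}F(u(s))\,ds-i(1-P)\int_{\inf I}^te^{i(t-s)\Delta}F(u(s))\,ds.$$ -/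

import Mathlib

open MeasureTheory Filter Topology Set
open scoped FourierTransform SchwartzMap

noncomputable section

namespace NLS

/-- The physical space `ℝ^d`, with its Euclidean norm. -/
abbrev Space (d : ℕ) : Type := EuclideanSpace ℝ (Fin d)

/-- The complex Hilbert space `L²(ℝ^d)`. -/
abbrev L2 (d : ℕ) : Type := Lp (α := Space d) ℂ 2 volume

/-! ### The free propagator -/

lemma memLp_phase_mul {d : ℕ} (t : ℝ) (f : L2 d) :
    MemLp (fun ξ : Space d =>
      Complex.exp (-(4 * Real.pi ^ 2 * t * ‖ξ‖ ^ 2 : ℝ) * Complex.I) * f ξ) 2 volume := by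
  refine (Lp.memLp f).of_le ?_ ?_
  · refine AEStronglyMeasurable.mul ?_ (Lp.aestronglyMeasurable f)
    exact (by fun_prop : Continuous fun ξ : Space d =>
      Complex.exp (-(4 * Real.pi ^ 2 * t * ‖ξ‖ ^ 2 : ℝ) * Complex.I)).aestronglyMeasurable
  · refine Eventually.of_forall fun ξ => ?_
    rw [norm_mul, ← Complex.ofReal_neg, Complex.norm_exp_ofReal_mul_I, one_mul]

/-- The free Schrödinger propagator `e^{itΔ}` on `L²(ℝ^d)`, a Fourier multiplier. The Fourier
transform of Mathlib is `𝓕 f ξ = ∫ e^{-2πi x·ξ} f x`, so that the frequency variable here is the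
usual one divided by `2π`, and the multiplier `e^{-it|ξ|²}` reads `e^{-4π²it|ξ|²}`. -/
def freeProp {d : ℕ} (t : ℝ) (f : L2 d) : L2 d :=
  𝓕⁻ ((memLp_phase_mul t (𝓕 f)).toLp _)

/-! ### Solutions of the equation -/

/-- The nonlinearity `F(z) = μ |z|^{4/d} z`. -/
def nonlin (d : ℕ) (μ : ℝ) (z : ℂ) : ℂ := (μ * ‖z‖ ^ (4 / d : ℝ) : ℝ) * z

/-- The pairing `⟨φ, e^{i(t-s)Δ} F(u(s))⟩ = ⟨e^{i(s-t)Δ} φ, F(u(s))⟩` (conjugate linear in `φ`)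
of the integrand of a Duhamel integral with a Schwartz function `φ`, as an integral over space. -/
def duhamelPairing {d : ℕ} (μ : ℝ) (u : ℝ → L2 d) (t s : ℝ) (φ : 𝓢(Space d, ℂ)) : ℂ :=
  ∫ x, star (freeProp (s - t) (φ.toLp 2 volume) x) * nonlin d μ (u s x)

/-- `HasDuhamelIntegral μ u t a b w` says that the oriented integral
`∫_a^b e^{i(t-s)Δ} F(u(s)) ds` exists, in the sense of tempered distributions, and equals the
element `w` of `L²(ℝ^d)`: all pairings with Schwartz functions are integrable, first in space for
almost every time and then in time, and integrate to the pairing with `w`. -/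
def HasDuhamelIntegral {d : ℕ} (μ : ℝ) (u : ℝ → L2 d) (t a b : ℝ) (w : L2 d) : Prop :=
  ∀ φ : 𝓢(Space d, ℂ),
    (∀ᵐ s ∂(volume.restrict (uIoc a b)), Integrable (fun x =>
      star (freeProp (s - t) (φ.toLp 2 volume) x) * nonlin d μ (u s x)) volume) ∧
    IntervalIntegrable (fun s => duhamelPairing μ u t s φ) volume a b ∧
    inner ℂ (φ.toLp 2 volume) w = ∫ s in a..b, duhamelPairing μ u t s φ

/-- `u` is a strong `L²` solution of `i u_t + Δ u = F(u)` on the time interval `I`. The values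
`u t` with `t ∉ I` play no role. -/
structure IsSolution {d : ℕ} (μ : ℝ) (I : Set ℝ) (u : ℝ → L2 d) : Prop where
  nonempty : I.Nonempty
  ordConnected : I.OrdConnected
  /-- `u` lies in `C⁰_{t,loc} L²_x`. -/
  continuousOn : ContinuousOn u I
  /-- `u` lies in `L^{2(d+2)/d}_{t,loc} L^{2(d+2)/d}_x`. -/
  scattering_lt_top : ∀ a ∈ I, ∀ b ∈ I,
    ∫⁻ t in Icc a b, ∫⁻ x, ‖u t x‖ₑ ^ (2 * (d + 2) / d : ℝ) < ⊤
  /-- The Duhamel formula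
  `u(t₁) = e^{i(t₁-t₀)Δ} u(t₀) - i ∫_{t₀}^{t₁} e^{i(t₁-s)Δ} F(u(s)) ds`. -/
  duhamel : ∀ t₀ ∈ I, ∀ t₁ ∈ I, ∃ w : L2 d, HasDuhamelIntegral μ u t₁ t₀ t₁ w ∧
    u t₁ = freeProp (t₁ - t₀) (u t₀) - Complex.I • w

/-- `u` is a solution on `I` that does not extend to a solution on a strictly larger interval. -/
def IsMaximalSolution {d : ℕ} (μ : ℝ) (I : Set ℝ) (u : ℝ → L2 d) : Prop :=
  IsSolution μ I u ∧ ∀ (J : Set ℝ) (v : ℝ → L2 d), I ⊂ J → IsSolution μ J v → ¬ EqOn u v I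

/-! ### The symmetry group -/

lemma quasi_affine {d : ℕ} (x₀ : Space d) {r : ℝ} (hr : 0 < r) :
    Measure.map (fun x : Space d => r⁻¹ • (x - x₀)) volume
      = ENNReal.ofReal (r ^ d) • (volume : Measure (Space d)) := by
  have h1 : (fun x : Space d => r⁻¹ • (x - x₀)) = (fun x => r⁻¹ • x) ∘ (fun x => x - x₀) := rfl
  rw [h1, ← Measure.map_map (by fun_prop) (by fun_prop),
    (measurePreserving_sub_right volume x₀).map_eq, Measure.map_addHaar_smul _ (by positivity)]
  congr 2
  simp [abs_of_pos hr]

lemma quasiMeasurePreserving_affine {d : ℕ} (x₀ : Space d) {r : ℝ} (hr : 0 < r) :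
    Measure.QuasiMeasurePreserving (fun x : Space d => r⁻¹ • (x - x₀)) volume volume := by
  refine ⟨by fun_prop, ?_⟩
  rw [quasi_affine x₀ hr]
  exact Measure.smul_absolutelyContinuous

/-- The function `r^{-d/2} e^{iθ} e^{ix·ξ₀} f((x - x₀)/r)`. -/
def symFun {d : ℕ} (θ : ℝ) (ξ₀ x₀ : Space d) (r : ℝ) (f : Space d → ℂ) (x : Space d) : ℂ :=
  (r ^ (-(d / 2) : ℝ) : ℝ) * Complex.exp (θ * Complex.I)
    * Complex.exp ((inner ℝ x ξ₀ : ℝ) * Complex.I) * f (r⁻¹ • (x - x₀))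

lemma memLp_symFun {d : ℕ} (θ : ℝ) (ξ₀ x₀ : Space d) {r : ℝ} (hr : 0 < r) (f : L2 d) :
    MemLp (symFun θ ξ₀ x₀ r f) 2 volume := by
  have h1 : MemLp (fun x : Space d => f (r⁻¹ • (x - x₀))) 2 volume := by
    have : MemLp (f : Space d → ℂ) 2 (Measure.map (fun x : Space d => r⁻¹ • (x - x₀)) volume) := by
      rw [quasi_affine x₀ hr]
      exact (Lp.memLp f).smul_measure ENNReal.ofReal_ne_top
    exact this.comp_of_map (by fun_prop)
  refine (h1.const_mul ((r ^ (-(d / 2) : ℝ) : ℝ) : ℂ)).of_le ?_ ?_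
  · refine AEStronglyMeasurable.mul ?_ h1.aestronglyMeasurable
    exact (by fun_prop : Continuous fun x : Space d =>
      ((r ^ (-(d / 2) : ℝ) : ℝ) : ℂ) * Complex.exp (θ * Complex.I)
        * Complex.exp ((inner ℝ x ξ₀ : ℝ) * Complex.I)).aestronglyMeasurable
  · refine Eventually.of_forall fun x => ?_
    simp only [symFun, norm_mul, Complex.norm_exp_ofReal_mul_I, mul_one, le_refl]

/-- The unitary transformation `g_{θ,ξ₀,x₀,r}` of `L²(ℝ^d)`,
`(g f)(x) = r^{-d/2} e^{iθ} e^{ix·ξ₀} f((x - x₀)/r)`. The group `G` consists of these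
transformations, for all `θ`, `ξ₀`, `x₀` and all `r > 0`. -/
def sym {d : ℕ} (θ : ℝ) (ξ₀ x₀ : Space d) (r : ℝ) (hr : 0 < r) (f : L2 d) : L2 d :=
  (memLp_symFun θ ξ₀ x₀ hr f).toLp _

lemma sym_id {d : ℕ} (f : L2 d) : sym 0 0 0 1 one_pos f = f := by
  refine Lp.ext ((MemLp.coeFn_toLp _).trans (Eventually.of_forall fun x => ?_))
  simp [symFun]

lemma sym_sym {d : ℕ} (θ θ' : ℝ) (ξ₀ ξ₁ x₀ x₁ : Space d) (r r' : ℝ) (hr : 0 < r) (hr' : 0 < r')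
    (f : L2 d) :
    sym θ ξ₀ x₀ r hr (sym θ' ξ₁ x₁ r' hr' f) =
      sym (θ + θ' - inner ℝ x₀ ξ₁ / r) (ξ₀ + r⁻¹ • ξ₁) (x₀ + r • x₁) (r * r') (mul_pos hr hr') f := by
  refine Lp.ext ?_
  have h1 : sym θ ξ₀ x₀ r hr (sym θ' ξ₁ x₁ r' hr' f)
      =ᵐ[volume] symFun θ ξ₀ x₀ r (sym θ' ξ₁ x₁ r' hr' f) := MemLp.coeFn_toLp _
  have h2 : sym θ' ξ₁ x₁ r' hr' f =ᵐ[volume] symFun θ' ξ₁ x₁ r' f := MemLp.coeFn_toLp _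
  have h3 := (quasiMeasurePreserving_affine x₀ hr).ae_eq h2
  have h4 : sym (θ + θ' - inner ℝ x₀ ξ₁ / r) (ξ₀ + r⁻¹ • ξ₁) (x₀ + r • x₁) (r * r')
      (mul_pos hr hr') f =ᵐ[volume] symFun _ _ _ _ f := MemLp.coeFn_toLp _
  filter_upwards [h1, h3, h4] with x e1 e3 e4
  simp only [Function.comp] at e3
  rw [e1, e4, symFun, e3]
  have harg : r'⁻¹ • (r⁻¹ • (x - x₀) - x₁) = (r * r')⁻¹ • (x - (x₀ + r • x₁)) := by
    rw [mul_inv, mul_comm, mul_smul, ← sub_sub, smul_sub r⁻¹ (x - x₀), smul_smul r⁻¹ r,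
      inv_mul_cancel₀ hr.ne', one_smul]
  have hexp : Complex.exp (θ * Complex.I) * Complex.exp ((inner ℝ x ξ₀ : ℝ) * Complex.I) *
      (Complex.exp (θ' * Complex.I)
        * Complex.exp ((inner ℝ (r⁻¹ • (x - x₀)) ξ₁ : ℝ) * Complex.I))
      = Complex.exp (((θ + θ' - inner ℝ x₀ ξ₁ / r : ℝ) : ℂ) * Complex.I)
        * Complex.exp ((inner ℝ x (ξ₀ + r⁻¹ • ξ₁) : ℝ) * Complex.I) := by
    simp only [← Complex.exp_add]
    congr 1
    simp only [inner_add_right, inner_smul_left, inner_smul_right, inner_sub_left]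
    push_cast
    simp only [conj_trivial]
    push_cast
    ring
  simp only [symFun]
  rw [harg, Real.mul_rpow hr.le hr'.le, Complex.ofReal_mul]
  linear_combination ((r ^ (-(d / 2) : ℝ) : ℝ) : ℂ) * ((r' ^ (-(d / 2) : ℝ) : ℝ) : ℂ)
    * f ((r * r')⁻¹ • (x - (x₀ + r • x₁))) * hexp

lemma sym_inv {d : ℕ} (θ : ℝ) (ξ₀ x₀ : Space d) (r : ℝ) (hr : 0 < r) (f : L2 d) :
    sym (-θ - inner ℝ x₀ ξ₀) (-(r • ξ₀)) (-(r⁻¹ • x₀)) r⁻¹ (inv_pos.2 hr)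
      (sym θ ξ₀ x₀ r hr f) = f := by
  rw [sym_sym]
  refine Eq.trans ?_ (sym_id f)
  congr 1
  · simp only [inner_neg_left, inner_smul_left, conj_trivial]
    field_simp
    ring
  · simp
  · simp
  · exact inv_mul_cancel₀ hr.ne'

/-- Two elements of `L²(ℝ^d)` are equivalent when they lie in the same orbit of `G`. -/
def orbitSetoid (d : ℕ) : Setoid (L2 d) where
  r f h := ∃ (θ : ℝ) (ξ₀ x₀ : Space d) (r : ℝ) (hr : 0 < r), sym θ ξ₀ x₀ r hr f = h
  iseqv :=
    { refl := fun f => ⟨0, 0, 0, 1, one_pos, sym_id f⟩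
      symm := by
        rintro f _ ⟨θ, ξ₀, x₀, r, hr, rfl⟩
        exact ⟨_, _, _, _, _, sym_inv θ ξ₀ x₀ r hr f⟩
      trans := by
        rintro f _ _ ⟨θ', ξ₁, x₁, r', hr', rfl⟩ ⟨θ, ξ₀, x₀, r, hr, rfl⟩
        exact ⟨_, _, _, _, _, (sym_sym θ θ' ξ₀ ξ₁ x₀ x₁ r r' hr hr' f).symm⟩ }

/-- The moduli space `G \ L²(ℝ^d)` of orbits. It carries the quotient topology. -/
abbrev OrbitSpace (d : ℕ) : Type := Quotient (orbitSetoid d)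

/-- `u` is almost periodic modulo `G`: the quotiented orbit `{G u(t) : t ∈ I}` is a precompact
subset of `G \ L²(ℝ^d)`. -/
def AlmostPeriodicModG {d : ℕ} (I : Set ℝ) (u : ℝ → L2 d) : Prop :=
  IsCompact (closure ((fun t => (Quotient.mk (orbitSetoid d) (u t) : OrbitSpace d)) '' I))

/-! ### Limits at the endpoints -/

/-- The filter of `t → sup I`, `t ∈ I`, where `sup I` is taken in `[-∞, ∞]`. -/
def atSup (I : Set ℝ) : Filter ℝ :=
  comap ((↑) : ℝ → EReal) (𝓝 (sSup (((↑) : ℝ → EReal) '' I))) ⊓ 𝓟 I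

/-- The filter of `t → inf I`, `t ∈ I`, where `inf I` is taken in `[-∞, ∞]`. -/
def atInf (I : Set ℝ) : Filter ℝ :=
  comap ((↑) : ℝ → EReal) (𝓝 (sInf (((↑) : ℝ → EReal) '' I))) ⊓ 𝓟 I

/-- Weak convergence of `v t` to `w` in `L²(ℝ^d)` along the filter `l`. -/
def WeakTendsto {d : ℕ} (v : ℝ → L2 d) (l : Filter ℝ) (w : L2 d) : Prop :=
  ∀ f : L2 d, Tendsto (fun t => inner ℂ f (v t)) l (𝓝 (inner ℂ f w))

/-- The improper integral `∫_t^{sup I} e^{i(t-s)Δ} F(u(s)) ds`, conditionally convergent in the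
weak topology of `L²(ℝ^d)`, exists and equals `w`. -/
def HasAdvancedIntegral {d : ℕ} (μ : ℝ) (I : Set ℝ) (u : ℝ → L2 d) (t : ℝ) (w : L2 d) : Prop :=
  ∃ D : ℝ → L2 d, (∀ b ∈ I, HasDuhamelIntegral μ u t t b (D b)) ∧ WeakTendsto D (atSup I) w

/-- The improper integral `∫_{inf I}^t e^{i(t-s)Δ} F(u(s)) ds`, conditionally convergent in the
weak topology of `L²(ℝ^d)`, exists and equals `w`. -/
def HasRetardedIntegral {d : ℕ} (μ : ℝ) (I : Set ℝ) (u : ℝ → L2 d) (t : ℝ) (w : L2 d) : Prop :=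
  ∃ D : ℝ → L2 d, (∀ a ∈ I, HasDuhamelIntegral μ u t a t (D a)) ∧ WeakTendsto D (atInf I) w

end NLS

end

/-!
In the interaction picture the Duhamel formula reads
`e^{-ibΔ} u(b) = e^{-itΔ} u(t) - i ∫_t^b e^{-isΔ} F(u(s)) ds`, so that both improper integrals
converge weakly, with the stated limits, as soon as `e^{-itΔ} u(t)` tends weakly to zero at both
ends of the lifespan. The two-way formula is then linear algebra. It remains to prove the weak
convergence.

Compactness modulo `G` provides, for every `ε`, finitely many Schwartz functions `f` such that each
`u(t)` is within `ε` of some `g f`, `g ∈ G` (`AlmostPeriodicModG.exists_finset`). So it suffices to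
show that `⟨e^{itΔ} φ, g f⟩` tends to zero for Schwartz functions `φ` and `f`, uniformly over the
`g` that occur (`AlmostPeriodicModG.weakTendsto_zero`). Let `r` be the scale of `g`.

* At an infinite end point, the pairing is bounded by a multiple of `r^{-d/2}`, because `φ` is
  integrable and `e^{-itΔ} g f` has an integrable Fourier transform, and by a multiple of
  `(r/|t|)^{d/2}`, by the dispersive estimate `dispersive` for `φ`. The geometric mean of the two is
  a multiple of `|t|^{-d/4}`, whatever the scale.
* At a finite end point `T`, the pairing is bounded by a multiple of `r^{d/2}`, and the scales that
  occur tend to zero. Otherwise the free evolution of `u(t)` from some time `t` close to `T` would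
  be small in `L^q_{t,x}` up to `T`, with `q = 2(d+2)/d`; the solution would then have finite norm
  up to `T` and continue beyond (`IsMaximalSolution.le_norm_sub_sym`).

The last point rests on the local theory in the critical space. Interpolation turns the dispersive
estimate into the decay of the propagator from `L^p` to `L^q`, `p` dual to `q`; together with the
Hardy–Littlewood–Sobolev inequality in time this gives the Strichartz estimates `strichartz` and
`stNorm_duh_sub_le`. A Picard iteration then solves the equation locally (`exists_solves`),
solutions can be glued (`Solves.exists_union`), a solution of finite norm converges at an end point
(`IsSolution.exists_solves_insert`), and a solution with small free evolution stays small
(`Solves.stNorm_le`).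

The Duhamel integral is defined weakly, by the Riesz representation theorem, from its pairings with
free evolutions. The map `t ↦ ‖u(t)‖_q` is measurable
as a supremum of continuous functions, the truncated powers `energy`; this makes joint measurability
of `u` in space and time unnecessary.
-/

noncomputable section

namespace NLS

/-! ### The Fourier transform on `L¹ ∩ L²` -/

/-- Dominated convergence in `L²`. -/
lemma tendsto_L2_of_dominated {d : ℕ} {ι : Type*} {l : Filter ι} [l.IsCountablyGenerated]
    {F : ι → L2 d} {G : L2 d} {b : Space d → ℝ} (hb : MemLp b 2 volume)
    (hbound : ∀ᶠ i in l, ∀ᵐ x, ‖F i x - G x‖ ≤ b x)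
    (hlim : ∀ᵐ x, Tendsto (fun i => F i x) l (𝓝 (G x))) : Tendsto F l (𝓝 G) := by
  rw [Lp.tendsto_Lp_iff_tendsto_eLpNorm']
  have h2 : (2 : ENNReal).toReal = 2 := by norm_num
  have key : Tendsto (fun i => ∫⁻ x, ‖(F i - G : Space d → ℂ) x‖ₑ ^ (2 : ℝ)) l
      (𝓝 (∫⁻ x : Space d, 0)) := by
    refine tendsto_lintegral_filter_of_dominated_convergence' (fun x => ‖b x‖ₑ ^ (2 : ℝ))
      (Eventually.of_forall fun i => ?_) ?_ ?_ ?_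
    · exact (((Lp.aestronglyMeasurable (F i)).sub (Lp.aestronglyMeasurable G)).enorm).pow_const _
    · filter_upwards [hbound] with i hi
      filter_upwards [hi] with x hx
      gcongr
      rw [Pi.sub_apply, enorm_le_iff_norm_le]
      exact hx.trans (le_abs_self _)
    · have := hb.eLpNorm_lt_top
      rw [eLpNorm_lt_top_iff_lintegral_rpow_enorm_lt_top (by norm_num) (by norm_num), h2] at this
      exact this.ne
    · filter_upwards [hlim] with x hx
      have : Tendsto (fun i => ‖F i x - G x‖ₑ ^ (2 : ℝ)) l (𝓝 (‖G x - G x‖ₑ ^ (2 : ℝ))) :=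
        ((ENNReal.continuous_rpow_const.tendsto _).comp
          ((continuous_enorm.tendsto _).comp (hx.sub_const _)))
      simpa using this
  simp only [lintegral_zero] at key
  have h3 : (fun i => eLpNorm (F i - G : Space d → ℂ) 2 volume)
      = fun i => (∫⁻ x, ‖(F i - G : Space d → ℂ) x‖ₑ ^ (2 : ℝ)) ^ (1 / 2 : ℝ) := by
    funext i
    rw [eLpNorm_eq_lintegral_rpow_enorm_toReal (by norm_num) (by norm_num), h2]
  rw [h3]
  have := (ENNReal.continuous_rpow_const (y := (1 / 2 : ℝ))).tendsto 0 |>.comp key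
  simpa [Function.comp_def] using this

/-- A pointwise bound passes to limits in `L²`. -/
lemma ae_norm_le_of_tendsto_L2 {d : ℕ} {F : ℕ → L2 d} {G : L2 d} {C : ℝ}
    (h : Tendsto F atTop (𝓝 G)) (hF : ∀ n, ∀ᵐ x, ‖F n x‖ ≤ C) : ∀ᵐ x, ‖G x‖ ≤ C := by
  obtain ⟨ns, -, hns⟩ := (tendstoInMeasure_of_tendsto_Lp h).exists_seq_tendsto_ae
  filter_upwards [hns, ae_all_iff.2 hF] with x hx hb
  exact le_of_tendsto hx.norm (Eventually.of_forall fun i => hb (ns i))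

lemma locallyIntegrable_L2 {d : ℕ} (f : L2 d) : LocallyIntegrable f volume :=
  (Lp.memLp f).locallyIntegrable (by norm_num)

/-- On `L¹ ∩ L²` the Fourier transform of `L²` is given by the Fourier integral. -/
lemma fourier_ae_eq {d : ℕ} (f : L2 d) (hf : Integrable f volume) :
    (𝓕 f : L2 d) =ᵐ[volume] 𝓕 (f : Space d → ℂ) := by
  have hcont : Continuous (𝓕 (f : Space d → ℂ)) :=
    VectorFourier.fourierIntegral_continuous Real.continuous_fourierChar continuous_inner hf
  refine ae_eq_of_integral_contDiff_smul_eq (locallyIntegrable_L2 _) hcont.locallyIntegrable ?_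
  intro g hg hgc
  have hgc' : HasCompactSupport (fun x => (g x : ℂ)) := hgc.comp_left Complex.ofReal_zero
  have hg' : ContDiff ℝ ((⊤ : ℕ∞) : WithTop ℕ∞) (fun x => (g x : ℂ)) :=
    Complex.ofRealCLM.contDiff.comp hg
  set φ : 𝓢(Space d, ℂ) := hgc'.toSchwartzMap hg' with hφ
  have hφx : ∀ x, φ x = (g x : ℂ) := fun x => rfl
  have h1 := congrArg (fun T => T φ) (Lp.fourier_toTemperedDistribution_eq f)
  simp only [TemperedDistribution.fourier_apply, Lp.toTemperedDistribution_apply] at h1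
  have h2 : ∫ x, φ x • 𝓕 (f : Space d → ℂ) x = ∫ x, (𝓕 φ) x • f x := by
    have := VectorFourier.integral_fourierIntegral_smul_eq_flip (L := innerₗ (Space d))
      (μ := volume) (ν := volume) Real.continuous_fourierChar continuous_inner
      (φ.integrable (μ := volume)) hf
    rw [flip_innerₗ] at this
    exact this.symm
  simp only [hφx] at h2 h1
  have h3 : ∀ h : Space d → ℂ, ∫ x, g x • h x = ∫ x, (g x : ℂ) • h x := fun h => by
    simp [Complex.real_smul]
  rw [h3, h3, ← h1, h2]

lemma fourierInv_ae_eq {d : ℕ} (f : L2 d) (hf : Integrable f volume) :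
    (𝓕⁻ f : L2 d) =ᵐ[volume] 𝓕⁻ (f : Space d → ℂ) := by
  have hcont : Continuous (𝓕⁻ (f : Space d → ℂ)) := by
    rw [Real.fourierInv_eq_fourier_comp_neg]
    exact VectorFourier.fourierIntegral_continuous Real.continuous_fourierChar continuous_inner
      hf.comp_neg
  refine ae_eq_of_integral_contDiff_smul_eq (locallyIntegrable_L2 _) hcont.locallyIntegrable ?_
  intro g hg hgc
  have hgc' : HasCompactSupport (fun x => (g x : ℂ)) := hgc.comp_left Complex.ofReal_zero
  have hg' : ContDiff ℝ ((⊤ : ℕ∞) : WithTop ℕ∞) (fun x => (g x : ℂ)) :=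
    Complex.ofRealCLM.contDiff.comp hg
  set φ : 𝓢(Space d, ℂ) := hgc'.toSchwartzMap hg' with hφ
  have hφx : ∀ x, φ x = (g x : ℂ) := fun x => rfl
  have h1 := congrArg (fun T => T φ) (Lp.fourierInv_toTemperedDistribution_eq f)
  simp only [TemperedDistribution.fourierInv_apply, Lp.toTemperedDistribution_apply] at h1
  have h2 : ∫ x, φ x • 𝓕⁻ (f : Space d → ℂ) x = ∫ x, (𝓕⁻ φ) x • f x := by
    have := VectorFourier.integral_fourierIntegral_smul_eq_flip (L := -innerₗ (Space d))
      (μ := volume) (ν := volume) Real.continuous_fourierChar continuous_inner.neg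
      (φ.integrable (μ := volume)) hf
    have e : (-innerₗ (Space d)).flip = -innerₗ (Space d) := by
      ext x y; simp [real_inner_comm]
    rw [e] at this
    refine this.symm.trans (integral_congr_ae (Eventually.of_forall fun ξ => ?_))
    simp only [SchwartzMap.fourierInv_coe]
    rfl
  simp only [hφx] at h2 h1
  have h3 : ∀ h : Space d → ℂ, ∫ x, g x • h x = ∫ x, (g x : ℂ) • h x := fun h => by
    simp [Complex.real_smul]
  rw [h3, h3, ← h1, h2]

/-! ### The free propagator as a unitary group -/

/-- The phase `e^{-it|ξ|²}`, in the normalization of the Fourier transform of Mathlib. -/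
def phase {d : ℕ} (t : ℝ) (ξ : Space d) : ℂ :=
  Complex.exp (-(4 * Real.pi ^ 2 * t * ‖ξ‖ ^ 2 : ℝ) * Complex.I)

lemma norm_phase {d : ℕ} (t : ℝ) (ξ : Space d) : ‖phase t ξ‖ = 1 := by
  rw [phase, ← Complex.ofReal_neg, Complex.norm_exp_ofReal_mul_I]

lemma phase_add {d : ℕ} (s t : ℝ) (ξ : Space d) : phase (s + t) ξ = phase s ξ * phase t ξ := by
  simp only [phase, ← Complex.exp_add]
  congr 1; push_cast; ring

lemma phase_zero {d : ℕ} (ξ : Space d) : phase 0 ξ = 1 := by simp [phase]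

lemma fourier_freeProp_ae {d : ℕ} (t : ℝ) (f : L2 d) :
    (𝓕 (freeProp t f) : L2 d) =ᵐ[volume] fun ξ => phase t ξ * (𝓕 f : L2 d) ξ := by
  rw [freeProp, FourierTransform.fourier_fourierInv_eq]
  exact MemLp.coeFn_toLp _

lemma L2_ext_fourier {d : ℕ} {f g : L2 d} (h : (𝓕 f : L2 d) =ᵐ[volume] (𝓕 g : L2 d)) : f = g :=
  (Lp.fourierTransformₗᵢ (Space d) ℂ).injective (Lp.ext h)

lemma freeProp_add {d : ℕ} (t : ℝ) (f g : L2 d) :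
    freeProp t (f + g) = freeProp t f + freeProp t g := by
  apply L2_ext_fourier
  rw [FourierTransform.fourier_add]
  filter_upwards [fourier_freeProp_ae t (f + g), fourier_freeProp_ae t f, fourier_freeProp_ae t g,
    Lp.coeFn_add (𝓕 (freeProp t f)) (𝓕 (freeProp t g)), Lp.coeFn_add (𝓕 f) (𝓕 g)]
    with ξ h1 h2 h3 h4 h5
  rw [h1, h4, Pi.add_apply, h2, h3, FourierTransform.fourier_add, h5, Pi.add_apply, mul_add]

lemma freeProp_smul {d : ℕ} (t : ℝ) (c : ℂ) (f : L2 d) :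
    freeProp t (c • f) = c • freeProp t f := by
  apply L2_ext_fourier
  rw [FourierTransform.fourier_smul]
  filter_upwards [fourier_freeProp_ae t (c • f), fourier_freeProp_ae t f,
    Lp.coeFn_smul c (𝓕 (freeProp t f)), Lp.coeFn_smul c (𝓕 f)] with ξ h1 h2 h4 h5
  rw [h1, h4, Pi.smul_apply, h2, FourierTransform.fourier_smul, h5, Pi.smul_apply, smul_eq_mul,
    smul_eq_mul]
  ring

lemma freeProp_freeProp {d : ℕ} (s t : ℝ) (f : L2 d) :
    freeProp s (freeProp t f) = freeProp (s + t) f := by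
  apply L2_ext_fourier
  filter_upwards [fourier_freeProp_ae s (freeProp t f), fourier_freeProp_ae t f,
    fourier_freeProp_ae (s + t) f] with ξ h1 h2 h3
  rw [h1, h2, h3, phase_add, mul_assoc]

@[simp] lemma freeProp_zero {d : ℕ} (f : L2 d) : freeProp 0 f = f := by
  apply L2_ext_fourier
  filter_upwards [fourier_freeProp_ae 0 f] with ξ h1
  rw [h1, phase_zero, one_mul]

lemma norm_freeProp {d : ℕ} (t : ℝ) (f : L2 d) : ‖freeProp t f‖ = ‖f‖ := by
  rw [← Lp.norm_fourier_eq, ← Lp.norm_fourier_eq f]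
  apply le_antisymm <;> refine Lp.norm_le_norm_of_ae_le ?_ <;>
  · filter_upwards [fourier_freeProp_ae t f] with ξ h1
    rw [h1, norm_mul, norm_phase, one_mul]

/-- The free propagator as a linear isometry. -/
def freePropL {d : ℕ} (t : ℝ) : L2 d →ₗᵢ[ℂ] L2 d where
  toFun := freeProp t
  map_add' := freeProp_add t
  map_smul' := freeProp_smul t
  norm_map' := norm_freeProp t

lemma freeProp_sub {d : ℕ} (t : ℝ) (f g : L2 d) :
    freeProp t (f - g) = freeProp t f - freeProp t g := (freePropL t).map_sub f g

lemma inner_freeProp_freeProp {d : ℕ} (t : ℝ) (f g : L2 d) :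
    inner ℂ (freeProp t f) (freeProp t g) = inner ℂ f g := (freePropL t).inner_map_map f g

lemma inner_freeProp_left {d : ℕ} (t : ℝ) (f g : L2 d) :
    inner ℂ (freeProp t f) g = inner ℂ f (freeProp (-t) g) := by
  rw [← inner_freeProp_freeProp (-t), freeProp_freeProp]
  simp

lemma continuous_freeProp {d : ℕ} (f : L2 d) : Continuous fun t => freeProp t f := by
  rw [continuous_iff_continuousAt]
  intro t
  have h : Tendsto (fun s => (𝓕 (freeProp s f) : L2 d)) (𝓝 t) (𝓝 (𝓕 (freeProp t f))) := by
    have hall : ∀ s, ∀ᵐ ξ, (𝓕 (freeProp s f) : L2 d) ξ = phase s ξ * (𝓕 f : L2 d) ξ :=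
      fun s => fourier_freeProp_ae s f
    rw [tendsto_iff_seq_tendsto]
    intro s hs
    refine tendsto_L2_of_dominated (b := fun ξ => 2 * ‖(𝓕 f : L2 d) ξ‖)
      ((Lp.memLp _).norm.const_mul 2) (Eventually.of_forall fun n => ?_) ?_
    · filter_upwards [hall (s n), hall t] with ξ h1 h2
      simp only [Function.comp]
      rw [h1, h2]
      refine (norm_sub_le _ _).trans ?_
      simp [norm_phase, two_mul]
    · filter_upwards [ae_all_iff.2 fun n => hall (s n), hall t] with ξ h1 h2
      simp only [Function.comp, h1, h2]
      refine Tendsto.mul_const _ ?_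
      have hc : Continuous fun r : ℝ => phase r ξ := by unfold phase; fun_prop
      exact (hc.tendsto t).comp hs
  have h2 := ((Lp.fourierTransformₗᵢ (Space d) ℂ).symm.continuous.tendsto _).comp h
  have h3 : ∀ g : L2 d, (Lp.fourierTransformₗᵢ (Space d) ℂ).symm (𝓕 g) = g :=
    fun g => (Lp.fourierTransformₗᵢ (Space d) ℂ).symm_apply_apply g
  simp only [Function.comp_def, h3] at h2
  exact h2

lemma continuous_freeProp_uncurry {d : ℕ} : Continuous fun p : ℝ × L2 d => freeProp p.1 p.2 := by
  rw [continuous_iff_continuousAt]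
  rintro ⟨t, f⟩
  have h1 : Tendsto (fun p : ℝ × L2 d => freeProp p.1 (p.2 - f)) (𝓝 (t, f)) (𝓝 0) := by
    rw [tendsto_zero_iff_norm_tendsto_zero]
    simp only [norm_freeProp]
    have : Continuous fun p : ℝ × L2 d => ‖p.2 - f‖ := by fun_prop
    simpa using this.tendsto (t, f)
  have h2 : Tendsto (fun p : ℝ × L2 d => freeProp p.1 f) (𝓝 (t, f)) (𝓝 (freeProp t f)) :=
    ((continuous_freeProp f).comp continuous_fst).tendsto (t, f)
  have h3 := h1.add h2
  simp only [← freeProp_add, sub_add_cancel, zero_add] at h3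
  exact h3

/-! ### Pointwise bounds for the free propagator -/

lemma memLp_gaussian_mul {d : ℕ} (b : ℂ) (hb : 0 < b.re) (f : L2 d) :
    MemLp (fun ξ : Space d => Complex.exp (-b * ‖ξ‖ ^ 2) * f ξ) 2 volume := by
  refine (Lp.memLp f).of_le ?_ (Eventually.of_forall fun ξ => ?_)
  · exact (by fun_prop : Continuous fun ξ : Space d =>
      Complex.exp (-b * ‖ξ‖ ^ 2)).aestronglyMeasurable.mul (Lp.aestronglyMeasurable f)
  · rw [norm_mul, Complex.norm_exp]
    refine mul_le_of_le_one_left (norm_nonneg _) (Real.exp_le_one_iff.2 ?_)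
    have : (-b * (‖ξ‖ : ℂ) ^ 2).re = -b.re * ‖ξ‖ ^ 2 := by
      rw [← Complex.ofReal_pow, Complex.re_mul_ofReal, Complex.neg_re]
    rw [this]
    nlinarith [sq_nonneg ‖ξ‖]

lemma integrable_gaussian {d : ℕ} (b : ℂ) (hb : 0 < b.re) (x : Space d) :
    Integrable (fun ξ : Space d => Complex.exp (-b * ‖ξ‖ ^ 2
      + 2 * Real.pi * Complex.I * (inner ℝ x ξ : ℝ))) volume :=
  GaussianFourier.integrable_cexp_neg_mul_sq_norm_add hb _ x

lemma integrable_gaussian_mul {d : ℕ} (b : ℂ) (hb : 0 < b.re) (f : L2 d) :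
    Integrable (fun ξ : Space d => Complex.exp (-b * ‖ξ‖ ^ 2) * f ξ) volume := by
  have hg : MemLp (fun ξ : Space d => Complex.exp (-b * ‖ξ‖ ^ 2)) 2 volume := by
    rw [memLp_two_iff_integrable_sq_norm
      (by fun_prop : Continuous fun ξ : Space d => Complex.exp (-b * ‖ξ‖ ^ 2)).aestronglyMeasurable]
    have := (integrable_gaussian (d := d) (2 * b) (by simpa using hb) 0).norm
    refine this.congr (Eventually.of_forall fun ξ => ?_)
    simp only [inner_zero_left, Complex.ofReal_zero, mul_zero, add_zero]
    rw [← norm_pow, ← Complex.exp_nat_mul]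
    congr 2; push_cast; ring
  exact hg.integrable_mul (Lp.memLp f)

/-- The dispersive estimate with the Gaussian multiplier `e^{-b|ξ|²}`, `Re b > 0`, in the place
of the free propagator; it follows from the explicit kernel. -/
lemma gaussian_dispersive {d : ℕ} (b : ℂ) (hb : 0 < b.re) (f : L2 d) (hf : Integrable f volume) :
    ∀ᵐ x, ‖(𝓕⁻ ((memLp_gaussian_mul b hb (𝓕 f)).toLp _) : L2 d) x‖
      ≤ (Real.pi / ‖b‖) ^ (d / 2 : ℝ) * ∫ y, ‖f y‖ := by
  set h : L2 d := (memLp_gaussian_mul b hb (𝓕 f)).toLp _ with hh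
  have hae : h =ᵐ[volume] fun ξ : Space d => Complex.exp (-b * ‖ξ‖ ^ 2) * (𝓕 f : L2 d) ξ :=
    MemLp.coeFn_toLp _
  have hint : Integrable h volume := (integrable_gaussian_mul b hb (𝓕 f)).congr hae.symm
  filter_upwards [fourierInv_ae_eq h hint] with x hx
  -- the Gaussian kernel, from the multiplication formula for the Fourier transform
  have h2 : 𝓕⁻ (h : Space d → ℂ) x = ∫ y, f y • ((Real.pi / b) ^ (d / 2 : ℂ) *
      Complex.exp (-Real.pi ^ 2 * ‖x - y‖ ^ 2 / b)) := by
    have e1 := VectorFourier.integral_fourierIntegral_smul_eq_flip (L := innerₗ (Space d))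
      (μ := volume) (ν := volume) Real.continuous_fourierChar continuous_inner hf
      (integrable_gaussian b hb x)
    rw [flip_innerₗ] at e1
    have e2 : ∀ y : Space d, VectorFourier.fourierIntegral Real.fourierChar volume
        (innerₗ (Space d)) (fun ξ : Space d => Complex.exp (-b * ‖ξ‖ ^ 2
          + 2 * Real.pi * Complex.I * (inner ℝ x ξ : ℝ))) y
        = (Real.pi / b) ^ (d / 2 : ℂ) * Complex.exp (-Real.pi ^ 2 * ‖x - y‖ ^ 2 / b) := by
      intro y
      have := fourier_gaussian_innerProductSpace' hb x y
      rw [finrank_euclideanSpace_fin] at this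
      exact this
    simp only [e2] at e1
    rw [← e1, Real.fourierInv_eq']
    refine integral_congr_ae ?_
    filter_upwards [hae, fourier_ae_eq f hf] with ξ h3 h4
    rw [h3, h4, Complex.exp_add]
    change _ = 𝓕 (f : Space d → ℂ) ξ • _
    rw [real_inner_comm]
    simp only [smul_eq_mul]
    push_cast
    ring_nf
  rw [hx, h2]
  refine (norm_integral_le_integral_norm _).trans ?_
  rw [← integral_const_mul]
  have hb0 : b ≠ 0 := fun h => by simp [h] at hb
  refine integral_mono_of_nonneg (Eventually.of_forall fun _ => norm_nonneg _)
    (hf.norm.const_mul _) (Eventually.of_forall fun y => ?_)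
  simp only [norm_smul, norm_mul]
  rw [mul_comm]
  refine mul_le_mul_of_nonneg_right ?_ (norm_nonneg _)
  have e3 : (d / 2 : ℂ) = ((d / 2 : ℝ) : ℂ) := by push_cast; rfl
  rw [e3, Complex.norm_cpow_real, norm_div, Complex.norm_real, Real.norm_of_nonneg Real.pi_pos.le]
  refine mul_le_of_le_one_right (by positivity) ?_
  rw [Complex.norm_exp, Real.exp_le_one_iff]
  have e4 : (-(Real.pi : ℂ) ^ 2 * (‖x - y‖ : ℂ) ^ 2 / b)
      = ((-(Real.pi ^ 2 * ‖x - y‖ ^ 2) : ℝ) : ℂ) * b⁻¹ := by push_cast; ring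
  rw [e4, Complex.re_ofReal_mul, Complex.inv_re]
  have : 0 ≤ b.re / Complex.normSq b := div_nonneg hb.le (Complex.normSq_nonneg _)
  nlinarith [mul_nonneg (mul_nonneg (sq_nonneg Real.pi) (sq_nonneg ‖x - y‖)) this]

/-- The dispersive estimate, as the limit of the estimate for Gaussian multipliers. -/
lemma dispersive {d : ℕ} {t : ℝ} (ht : t ≠ 0) (f : L2 d) (hf : Integrable f volume) :
    ∀ᵐ x, ‖freeProp t f x‖ ≤ (4 * Real.pi * |t|) ^ (-(d / 2) : ℝ) * ∫ y, ‖f y‖ := by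
  -- the multiplier `e^{-4π²it|ξ|²}` is approximated by Gaussians
  set b : ℕ → ℂ := fun n =>
    ((1 / ((n : ℝ) + 1) : ℝ) : ℂ) + ((4 * Real.pi ^ 2 * t : ℝ) : ℂ) * Complex.I with hbdef
  have hre : ∀ n, (b n).re = 1 / ((n : ℝ) + 1) := fun n => by
    simp only [hbdef, Complex.add_re, Complex.ofReal_re, Complex.re_ofReal_mul, Complex.I_re,
      mul_zero, add_zero]
  have him : ∀ n, (b n).im = 4 * Real.pi ^ 2 * t := fun n => by
    simp only [hbdef, Complex.add_im, Complex.ofReal_im, Complex.im_ofReal_mul, Complex.I_im,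
      mul_one, zero_add]
  have hb : ∀ n, 0 < (b n).re := fun n => by rw [hre]; positivity
  set F : ℕ → L2 d := fun n => (memLp_gaussian_mul (b n) (hb n) (𝓕 f)).toLp _ with hF
  have hFae : ∀ n, ∀ᵐ ξ, F n ξ = Complex.exp (-(b n) * ‖ξ‖ ^ 2) * (𝓕 f : L2 d) ξ :=
    fun n => MemLp.coeFn_toLp _
  have hblim : Tendsto b atTop (𝓝 (((4 * Real.pi ^ 2 * t : ℝ) : ℂ) * Complex.I)) := by
    have := (Complex.continuous_ofReal.tendsto 0).comp
      (tendsto_one_div_add_atTop_nhds_zero_nat (𝕜 := ℝ))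
    have := this.add_const (((4 * Real.pi ^ 2 * t : ℝ) : ℂ) * Complex.I)
    rw [Complex.ofReal_zero, zero_add] at this
    exact this
  have hlim : Tendsto F atTop (𝓝 (𝓕 (freeProp t f))) := by
    refine tendsto_L2_of_dominated (b := fun ξ => 2 * ‖(𝓕 f : L2 d) ξ‖)
      ((Lp.memLp _).norm.const_mul 2) (Eventually.of_forall fun n => ?_) ?_
    · filter_upwards [hFae n, fourier_freeProp_ae t f] with ξ h1 h2
      rw [h1, h2]
      refine (norm_sub_le _ _).trans ?_
      rw [norm_mul, norm_mul, norm_phase, one_mul, two_mul]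
      refine add_le_add_left (mul_le_of_le_one_left (norm_nonneg _) ?_) _
      rw [Complex.norm_exp, Real.exp_le_one_iff, ← Complex.ofReal_pow, Complex.re_mul_ofReal,
        Complex.neg_re]
      nlinarith [sq_nonneg ‖ξ‖, hb n]
    · filter_upwards [ae_all_iff.2 hFae, fourier_freeProp_ae t f] with ξ h1 h2
      simp only [h1, h2]
      refine Tendsto.mul_const _ ?_
      have hc : Continuous fun z : ℂ => Complex.exp (-z * ‖ξ‖ ^ 2) := by fun_prop
      have := (hc.tendsto _).comp hblim
      have e : phase t ξ
          = Complex.exp (-(((4 * Real.pi ^ 2 * t : ℝ) : ℂ) * Complex.I) * ‖ξ‖ ^ 2) := by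
        rw [phase]; congr 1; push_cast; ring
      rw [e]; exact this
  have hlim2 : Tendsto (fun n => (𝓕⁻ (F n) : L2 d)) atTop (𝓝 (freeProp t f)) := by
    have := ((Lp.fourierTransformₗᵢ (Space d) ℂ).symm.continuous.tendsto _).comp hlim
    have h3 : (Lp.fourierTransformₗᵢ (Space d) ℂ).symm (𝓕 (freeProp t f)) = freeProp t f :=
      (Lp.fourierTransformₗᵢ (Space d) ℂ).symm_apply_apply _
    rw [h3] at this
    exact this
  refine ae_norm_le_of_tendsto_L2 hlim2 fun n => ?_
  filter_upwards [gaussian_dispersive (b n) (hb n) f hf] with x hx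
  refine hx.trans (mul_le_mul_of_nonneg_right ?_ (integral_nonneg fun _ => norm_nonneg _))
  have hpos : 0 < 4 * Real.pi * |t| := by positivity
  rw [Real.rpow_neg hpos.le, ← Real.inv_rpow hpos.le]
  refine Real.rpow_le_rpow (by positivity) ?_ (by positivity)
  have : 4 * Real.pi ^ 2 * |t| ≤ ‖b n‖ := by
    have := Complex.abs_im_le_norm (b n)
    rw [him, abs_mul, abs_of_pos (by positivity)] at this
    exact this
  rw [inv_eq_one_div, div_le_div_iff₀ (lt_of_lt_of_le (by positivity) this) hpos]
  nlinarith [Real.pi_pos]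

/-- `‖e^{itΔ} f‖_∞ ≤ ‖𝓕 f‖₁`. -/
lemma ae_norm_freeProp_le {d : ℕ} (t : ℝ) (f : L2 d) (hf : Integrable (𝓕 f : L2 d) volume) :
    ∀ᵐ x, ‖freeProp t f x‖ ≤ ∫ ξ, ‖(𝓕 f : L2 d) ξ‖ := by
  set h : L2 d := (memLp_phase_mul t (𝓕 f)).toLp _ with hh
  have hae : h =ᵐ[volume] fun ξ : Space d => phase t ξ * (𝓕 f : L2 d) ξ := MemLp.coeFn_toLp _
  have hnorm : ∀ᵐ ξ, ‖(𝓕 f : L2 d) ξ‖ = ‖h ξ‖ := by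
    filter_upwards [hae] with ξ h1
    rw [h1, norm_mul, norm_phase, one_mul]
  have hint : Integrable h volume := hf.congr' (Lp.aestronglyMeasurable h) hnorm
  filter_upwards [fourierInv_ae_eq h hint] with x hx
  rw [freeProp, hx, integral_congr_ae hnorm]
  exact VectorFourier.norm_fourierIntegral_le_integral_norm _ _ _ _ _

/-! ### Interpolation -/

lemma lintegral_rpow_Ioc {r B : ℝ} (hr : -1 < r) (hB : 0 ≤ B) :
    ∫⁻ s in Ioc 0 B, ENNReal.ofReal (s ^ r) = ENNReal.ofReal (B ^ (r + 1) / (r + 1)) := by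
  have hint : IntegrableOn (fun s : ℝ => s ^ r) (Ioc 0 B) volume :=
    (intervalIntegral.intervalIntegrable_rpow' hr).1
  rw [← ofReal_integral_eq_lintegral_ofReal hint, ← intervalIntegral.integral_of_le hB,
    integral_rpow (Or.inl hr), Real.zero_rpow (by linarith), sub_zero]
  filter_upwards [ae_restrict_mem measurableSet_Ioc] with s hs
  exact Real.rpow_nonneg hs.1.le _

lemma lintegral_enorm_sq_L2 {d : ℕ} (f : L2 d) :
    ∫⁻ x, ‖f x‖ₑ ^ (2 : ℝ) = ENNReal.ofReal (‖f‖ ^ 2) := by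
  rw [Lp.norm_def, eLpNorm_eq_lintegral_rpow_enorm_toReal (by norm_num) (by norm_num),
    ← ENNReal.toReal_pow, ENNReal.ofReal_toReal, ← ENNReal.rpow_natCast, ← ENNReal.rpow_mul]
  · norm_num
  · refine ENNReal.pow_ne_top ?_
    have := Lp.eLpNorm_ne_top f
    rwa [eLpNorm_eq_lintegral_rpow_enorm_toReal (by norm_num) (by norm_num)] at this

lemma enorm_rpow_eq_ofReal {E : Type*} [SeminormedAddGroup E] (z : E) {r : ℝ} (hr : 0 ≤ r) :
    ‖z‖ₑ ^ r = ENNReal.ofReal (‖z‖ ^ r) := by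
  rw [← ofReal_norm, ENNReal.ofReal_rpow_of_nonneg (norm_nonneg _) hr]

/-- The weak-type step of the interpolation: `f` is split at the height `lam`, the large part being
mapped into `L^∞` and the small part into `L²`. -/
lemma meas_lt_le_of_split {d : ℕ} (T : L2 d →ₗᵢ[ℂ] L2 d) {A p lam s m : ℝ} (hp : 1 < p)
    (hA : 0 < A)
    (hT : ∀ g : L2 d, Integrable g volume → ∀ᵐ x, ‖T g x‖ ≤ A * ∫ y, ‖g y‖)
    (f : L2 d) (hm : ∫⁻ x, ‖f x‖ₑ ^ p = ENNReal.ofReal m) (hm0 : 0 ≤ m)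
    (hlam : 0 < lam) (hs : 0 < s)
    (hsplit : A * (lam ^ (1 - p) * m) ≤ s / 2) :
    volume {x | s < ‖T f x‖} ≤ ENNReal.ofReal (4 / s ^ 2) *
      ∫⁻ x, {x | ‖f x‖ ≤ lam}.indicator (fun x => ‖f x‖ₑ ^ (2 : ℝ)) x := by
  have hfm : Measurable fun x => ‖f x‖ := (Lp.stronglyMeasurable f).norm.measurable
  have hE : MeasurableSet {x | ‖f x‖ ≤ lam} := measurableSet_le hfm measurable_const
  set E := {x | ‖f x‖ ≤ lam} with hEdef
  set fs : L2 d := ((Lp.memLp f).indicator hE).toLp _ with hfs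
  set fl : L2 d := ((Lp.memLp f).indicator hE.compl).toLp _ with hfl
  have hfsx : fs =ᵐ[volume] E.indicator f := MemLp.coeFn_toLp _
  have hflx : fl =ᵐ[volume] Eᶜ.indicator f := MemLp.coeFn_toLp _
  have hsum : f = fl + fs := by
    apply Lp.ext
    filter_upwards [Lp.coeFn_add fl fs, hfsx, hflx] with x h1 h2 h3
    rw [h1, Pi.add_apply, h2, h3]
    by_cases hx : x ∈ E <;> simp [hx]
  have hpt : ∀ x, ‖Eᶜ.indicator f x‖ₑ ≤ ENNReal.ofReal (lam ^ (1 - p)) * ‖f x‖ₑ ^ p := by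
    intro x
    by_cases hx : x ∈ E
    · simp [hx]
    · have hx' : lam < ‖f x‖ := not_le.1 hx
      rw [indicator_of_mem (by simpa using hx), enorm_rpow_eq_ofReal _ (by linarith),
        ← ENNReal.ofReal_mul (by positivity), ← ofReal_norm]
      apply ENNReal.ofReal_le_ofReal
      have h0 : 0 < ‖f x‖ := hlam.trans hx'
      have h1 : ‖f x‖ ^ (1 - p) ≤ lam ^ (1 - p) :=
        Real.rpow_le_rpow_of_nonpos hlam hx'.le (by linarith)
      calc ‖f x‖ = ‖f x‖ ^ (1 - p) * ‖f x‖ ^ p := by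
            rw [← Real.rpow_add h0]; simp
        _ ≤ _ := by gcongr
  have hL1 : ∫⁻ x, ‖fl x‖ₑ ≤ ENNReal.ofReal (lam ^ (1 - p) * m) := by
    rw [ENNReal.ofReal_mul (by positivity), ← hm, ← lintegral_const_mul' _ _ ENNReal.ofReal_ne_top]
    refine lintegral_mono_ae ?_
    filter_upwards [hflx] with x hx
    rw [hx]; exact hpt x
  have hint : Integrable fl volume :=
    ⟨Lp.aestronglyMeasurable fl, hL1.trans_lt ENNReal.ofReal_lt_top⟩
  have hL1' : ∫ y, ‖fl y‖ ≤ lam ^ (1 - p) * m := by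
    rw [integral_norm_eq_lintegral_enorm (Lp.aestronglyMeasurable fl)]
    exact ENNReal.toReal_le_of_le_ofReal (by positivity) hL1
  have hTl : ∀ᵐ x, ‖T fl x‖ ≤ s / 2 := by
    filter_upwards [hT fl hint] with x hx
    exact hx.trans ((mul_le_mul_of_nonneg_left hL1' hA.le).trans hsplit)
  have hTsum : ∀ᵐ x, T f x = T fl x + T fs x := by
    have : T f = T fl + T fs := by rw [← map_add, ← hsum]
    rw [this]; exact Lp.coeFn_add _ _
  -- where `‖T f‖` exceeds `s`, the small part contributes at least `s / 2`
  have hset : volume {x | s < ‖T f x‖} ≤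
      volume {x | ENNReal.ofReal (s ^ 2 / 4) ≤ ‖T fs x‖ₑ ^ (2 : ℝ)} := by
    refine measure_mono_ae ?_
    filter_upwards [hTl, hTsum] with x h1 h2
    change s < ‖T f x‖ → _
    intro h3
    rw [h2] at h3
    have h4 : s / 2 ≤ ‖T fs x‖ := by have := norm_add_le (T fl x) (T fs x); linarith
    change ENNReal.ofReal (s ^ 2 / 4) ≤ ‖T fs x‖ₑ ^ (2 : ℝ)
    rw [enorm_rpow_eq_ofReal _ (by norm_num)]
    apply ENNReal.ofReal_le_ofReal
    rw [Real.rpow_two]; nlinarith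
  have hcheb := mul_meas_ge_le_lintegral₀ (μ := (volume : Measure (Space d)))
    (f := fun x => ‖T fs x‖ₑ ^ (2 : ℝ))
    ((Lp.aestronglyMeasurable (T fs)).enorm.pow_const _) (ENNReal.ofReal (s ^ 2 / 4))
  rw [lintegral_enorm_sq_L2, T.norm_map, ← lintegral_enorm_sq_L2] at hcheb
  have hfin : ∫⁻ x, ‖fs x‖ₑ ^ (2 : ℝ) = ∫⁻ x, E.indicator (fun x => ‖f x‖ₑ ^ (2 : ℝ)) x := by
    refine lintegral_congr_ae ?_
    filter_upwards [hfsx] with x hx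
    rw [hx]
    by_cases h : x ∈ E <;> simp [h]
  rw [← hfin]
  refine hset.trans ?_
  refine le_trans (le_of_eq ?_) (mul_le_mul_right hcheb (ENNReal.ofReal (4 / s ^ 2)))
  rw [← mul_assoc, ← ENNReal.ofReal_mul (by positivity)]
  rw [show 4 / s ^ 2 * (s ^ 2 / 4) = 1 by field_simp]
  simp

/-- Real interpolation between `L¹ → L^∞` and the isometry of `L²`: a linear isometry of `L²`
which maps `L¹` to `L^∞` with norm `A` maps `L^p` to `L^{q}`, with the power of `A` dictated by
homogeneity. -/
lemma interpolation {d : ℕ} (T : L2 d →ₗᵢ[ℂ] L2 d) {A p q : ℝ} (hpq : p.HolderConjugate q)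
    (hq : 2 < q) (hA : 0 < A)
    (hT : ∀ g : L2 d, Integrable g volume → ∀ᵐ x, ‖T g x‖ ≤ A * ∫ y, ‖g y‖)
    (f : L2 d) :
    ∫⁻ x, ‖T f x‖ₑ ^ q ≤ ENNReal.ofReal (q * (4 * ((2 * A) ^ (q - 2) / (q - 2)))) *
      (∫⁻ x, ‖f x‖ₑ ^ p) ^ (q - 1) := by
  have hp : 1 < p := hpq.lt
  have hrel : p * q = p + q := hpq.mul_eq_add
  have hC : 0 < q * (4 * ((2 * A) ^ (q - 2) / (q - 2))) := by
    have : 0 < q - 2 := by linarith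
    positivity
  rcases eq_or_ne (∫⁻ x, ‖f x‖ₑ ^ p) ⊤ with htop | htop
  · rw [htop, ENNReal.top_rpow_of_pos (by linarith), ENNReal.mul_top (by simpa using hC)]
    exact le_top
  rcases eq_or_ne (∫⁻ x, ‖f x‖ₑ ^ p) 0 with h0 | h0
  · rw [lintegral_eq_zero_iff' ((Lp.aestronglyMeasurable f).enorm.pow_const _)] at h0
    have hf0 : f = 0 := by
      apply Lp.ext
      filter_upwards [h0, Lp.coeFn_zero ℂ 2 (volume : Measure (Space d))] with x hx h0'
      rw [h0']
      simpa [ENNReal.rpow_eq_zero_iff, show ¬ p < 0 by linarith, show 0 < p by linarith] using hx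
    have : ∫⁻ x, ‖T f x‖ₑ ^ q = 0 := by
      rw [lintegral_eq_zero_iff' ((Lp.aestronglyMeasurable _).enorm.pow_const _), hf0, map_zero]
      filter_upwards [Lp.coeFn_zero ℂ 2 (volume : Measure (Space d))] with x hx
      rw [hx]; simp [show 0 < q by linarith]
    rw [this]; exact zero_le
  set m := (∫⁻ x, ‖f x‖ₑ ^ p).toReal with hmdef
  have hm : ∫⁻ x, ‖f x‖ₑ ^ p = ENNReal.ofReal m := (ENNReal.ofReal_toReal htop).symm
  have hm0 : 0 < m := ENNReal.toReal_pos h0 htop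
  have hfm : Measurable fun x => ‖f x‖ := (Lp.stronglyMeasurable f).norm.measurable
  -- the pointwise threshold: `‖f x‖` is at most the splitting height at `s` iff `s ≤ B x`
  set B : Space d → ℝ := fun x => 2 * A * m * ‖f x‖ ^ (1 - p) with hB
  have hBm : Measurable B := by fun_prop
  have hB0 : ∀ x, 0 ≤ B x := fun x => by positivity
  have hlayer : ∀ s ∈ Ioi (0 : ℝ), volume {x | s < ‖T f x‖} * ENNReal.ofReal (s ^ (q - 1)) ≤
      ∫⁻ x, (Ioc 0 (B x)).indicator (fun s => ENNReal.ofReal (4 * s ^ (q - 3))) s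
        * ‖f x‖ₑ ^ (2 : ℝ) := by
    intro s hs
    have hs : 0 < s := hs
    -- the height at which the image of the large part is bounded by `s / 2`
    set lam := (2 * A * m / s) ^ (1 / (p - 1)) with hlamdef
    have hbase : 0 < 2 * A * m / s := by positivity
    have hlam : 0 < lam := Real.rpow_pos_of_pos hbase _
    have hlp : lam ^ (1 - p) = s / (2 * A * m) := by
      rw [hlamdef, ← Real.rpow_mul hbase.le,
        show 1 / (p - 1) * (1 - p) = -1 by
          have : p - 1 ≠ 0 := by linarith
          field_simp; ring, Real.rpow_neg_one, inv_div]
    have h1 := meas_lt_le_of_split T hp hA hT f hm hm0.le hlam hs (by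
      rw [hlp]; apply le_of_eq; field_simp)
    refine (mul_le_mul_left h1 _).trans ?_
    rw [mul_comm, ← mul_assoc, ← ENNReal.ofReal_mul (by positivity),
      ← lintegral_const_mul' _ _ ENNReal.ofReal_ne_top]
    refine lintegral_mono fun x => ?_
    by_cases hx : ‖f x‖ ≤ lam
    · rcases eq_or_lt_of_le (norm_nonneg (f x)) with hz | hz
      · have : ‖f x‖ₑ = 0 := by simpa using hz.symm
        simp [this, indicator]
      · have hsB : s ≤ B x := by
          have h2 : lam ^ (1 - p) ≤ ‖f x‖ ^ (1 - p) :=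
            Real.rpow_le_rpow_of_nonpos hz hx (by linarith)
          rw [hlp, div_le_iff₀ (by positivity)] at h2
          simp only [hB]; linarith
        rw [indicator_of_mem (show x ∈ {x | ‖f x‖ ≤ lam} from hx),
          indicator_of_mem (show s ∈ Ioc 0 (B x) from ⟨hs, hsB⟩)]
        refine le_of_eq ?_
        congr 2
        rw [show q - 1 = (q - 3) + (2 : ℕ) by push_cast; ring, Real.rpow_add_natCast hs.ne']
        field_simp
    · rw [indicator_of_notMem (show x ∉ {x | ‖f x‖ ≤ lam} from hx), mul_zero]
      exact zero_le
  have hslice : ∀ x, (∫⁻ s in Ioi (0 : ℝ), (Ioc 0 (B x)).indicator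
      (fun s => ENNReal.ofReal (4 * s ^ (q - 3))) s) * ‖f x‖ₑ ^ (2 : ℝ) ≤
      ENNReal.ofReal (4 * ((2 * A) ^ (q - 2) / (q - 2)) * m ^ (q - 2)) * ‖f x‖ₑ ^ p := by
    intro x
    rcases eq_or_lt_of_le (norm_nonneg (f x)) with hz | hz
    · have : ‖f x‖ₑ = 0 := by simpa using hz.symm
      simp [this]
    have e1 : ∫⁻ s in Ioi (0 : ℝ), (Ioc 0 (B x)).indicator
        (fun s => ENNReal.ofReal (4 * s ^ (q - 3))) s
        = ENNReal.ofReal (4 * (B x ^ (q - 2) / (q - 2))) := by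
      rw [setLIntegral_indicator measurableSet_Ioc,
        inter_eq_left.2 (Ioc_subset_Ioi_self), ENNReal.ofReal_mul (by norm_num),
        show q - 2 = (q - 3) + 1 by ring, ← lintegral_rpow_Ioc (by linarith) (hB0 x),
        ← lintegral_const_mul' _ _ ENNReal.ofReal_ne_top]
      exact lintegral_congr fun s => ENNReal.ofReal_mul (by norm_num)
    have hq2 : 0 < q - 2 := by linarith
    rw [e1, enorm_rpow_eq_ofReal _ (by norm_num), enorm_rpow_eq_ofReal _ (by linarith),
      ← ENNReal.ofReal_mul (by have := hB0 x; positivity), ← ENNReal.ofReal_mul (by positivity)]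
    refine le_of_eq (congrArg _ ?_)
    simp only [hB]
    rw [Real.mul_rpow (by positivity) (by positivity), Real.mul_rpow (by positivity) hm0.le,
      ← Real.rpow_mul hz.le]
    have : ‖f x‖ ^ ((1 - p) * (q - 2)) * ‖f x‖ ^ (2 : ℝ) = ‖f x‖ ^ p := by
      rw [← Real.rpow_add hz]; congr 1; linarith
    rw [← this]; ring
  have hmeas : Measurable (fun z : ℝ × Space d =>
      (Ioc 0 (B z.2)).indicator (fun s => ENNReal.ofReal (4 * s ^ (q - 3))) z.1
        * ‖f z.2‖ₑ ^ (2 : ℝ)) := by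
    refine Measurable.mul ?_ (((Lp.stronglyMeasurable f).comp_measurable
      measurable_snd).enorm.pow_const _)
    have hS : MeasurableSet {z : ℝ × Space d | z.1 ∈ Ioc 0 (B z.2)} :=
      (measurableSet_lt measurable_const measurable_fst).inter
        (measurableSet_le measurable_fst (hBm.comp measurable_snd))
    have : Measurable fun z : ℝ × Space d => ENNReal.ofReal (4 * z.1 ^ (q - 3)) := by fun_prop
    exact this.indicator hS
  have hl : ∫⁻ x, ‖T f x‖ₑ ^ q = ENNReal.ofReal q *
      ∫⁻ s in Ioi (0 : ℝ), volume {x | s < ‖T f x‖} * ENNReal.ofReal (s ^ (q - 1)) := by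
    rw [← lintegral_rpow_eq_lintegral_meas_lt_mul volume
      (Eventually.of_forall fun _ => norm_nonneg _)
      (Lp.aestronglyMeasurable _).norm.aemeasurable (by linarith)]
    exact lintegral_congr fun x => enorm_rpow_eq_ofReal _ (by linarith)
  rw [hl]
  calc _ ≤ ENNReal.ofReal q * ∫⁻ s in Ioi (0 : ℝ), ∫⁻ x,
        (Ioc 0 (B x)).indicator (fun s => ENNReal.ofReal (4 * s ^ (q - 3))) s
        * ‖f x‖ₑ ^ (2 : ℝ) := by
        exact mul_le_mul_right (setLIntegral_mono' measurableSet_Ioi hlayer) _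
    _ = ENNReal.ofReal q * ∫⁻ x, (∫⁻ s in Ioi (0 : ℝ),
        (Ioc 0 (B x)).indicator (fun s => ENNReal.ofReal (4 * s ^ (q - 3))) s)
        * ‖f x‖ₑ ^ (2 : ℝ) := by
        rw [lintegral_lintegral_swap hmeas.aemeasurable]
        congr 1
        refine lintegral_congr fun x => lintegral_mul_const' _ _ ?_
        exact ENNReal.rpow_ne_top_of_nonneg (by norm_num) enorm_ne_top
    _ ≤ ENNReal.ofReal q * ∫⁻ x,
        ENNReal.ofReal (4 * ((2 * A) ^ (q - 2) / (q - 2)) * m ^ (q - 2)) * ‖f x‖ₑ ^ p := by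
        exact mul_le_mul_right (lintegral_mono hslice) _
    _ = _ := by
        have hq2 : 0 < q - 2 := by linarith
        rw [lintegral_const_mul' _ _ ENNReal.ofReal_ne_top, hm,
          ENNReal.ofReal_rpow_of_pos hm0, ← ENNReal.ofReal_mul (by positivity),
          ← ENNReal.ofReal_mul (by positivity), ← ENNReal.ofReal_mul (by positivity)]
        congr 1
        rw [show q - 1 = (q - 2) + 1 by ring, Real.rpow_add_one hm0.ne']
        ring

/-! ### The Hardy–Littlewood–Sobolev inequality on the line -/

/-- If `A ≤ M A^{1/p}` with `A` finite, then `A^{1/q} ≤ M`: the last step of duality arguments. -/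
lemma rpow_inv_le_of_le_mul_rpow_inv {p q : ℝ} (hpq : p.HolderConjugate q) {A M : ENNReal}
    (hA : A ≠ ⊤) (h : A ≤ M * A ^ (1 / p)) : A ^ (1 / q) ≤ M := by
  rcases eq_or_ne A 0 with h0 | h0
  · rw [h0, ENNReal.zero_rpow_of_pos (by have := hpq.symm.pos; positivity)]
    exact zero_le
  have h1 : A = A ^ (1 / q) * A ^ (1 / p) := by
    rw [← ENNReal.rpow_add _ _ h0 hA, one_div, one_div, hpq.symm.inv_add_inv_eq_one,
      ENNReal.rpow_one]
  have hp0 : A ^ (1 / p) ≠ 0 := by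
    simp [ENNReal.rpow_eq_zero_iff, h0, hA]
  have hpt : A ^ (1 / p) ≠ ⊤ :=
    ENNReal.rpow_ne_top_of_nonneg (by have := hpq.pos; positivity) hA
  have h2 : A ^ (1 / q) * A ^ (1 / p) ≤ M * A ^ (1 / p) := by rw [← h1]; exact h
  exact (ENNReal.mul_le_mul_iff_left hp0 hpt).1 h2

lemma lintegral_comp_abs (φ : ℝ → ENNReal) :
    ∫⁻ r, φ |r| = 2 * ∫⁻ r in Ioi 0, φ r := by
  have h1 : ∫⁻ r in Ioi (0 : ℝ), φ |r| = ∫⁻ r in Ioi (0 : ℝ), φ r :=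
    setLIntegral_congr_fun measurableSet_Ioi fun r hr => by
      rw [abs_of_pos (show (0 : ℝ) < r from hr)]
  have h2 : ∫⁻ r in (Ioi (0 : ℝ))ᶜ, φ |r| = ∫⁻ r in Ioi (0 : ℝ), φ |r| := by
    rw [compl_Ioi, ← setLIntegral_congr Iio_ae_eq_Iic, ← lintegral_indicator measurableSet_Iio,
      ← lintegral_indicator measurableSet_Ioi, ← lintegral_neg_eq_self]
    refine lintegral_congr fun r => ?_
    by_cases h : 0 < r <;> simp [indicator, h]
  rw [← lintegral_add_compl (fun r => φ |r|) (measurableSet_Ioi (a := (0 : ℝ))), h2, h1, two_mul]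

/-- The kernel `|r|^{-γ}` of fractional integration. -/
def rieszKernel (γ r : ℝ) : ENNReal := ENNReal.ofReal (|r| ^ (-γ))

lemma measurable_rieszKernel (γ : ℝ) : Measurable (rieszKernel γ) := by
  unfold rieszKernel; fun_prop

lemma lintegral_rieszKernel_near {γ R : ℝ} (hγ : γ < 1) (hR : 0 ≤ R) :
    ∫⁻ r, {r | |r| ≤ R}.indicator (rieszKernel γ) r
      = 2 * ENNReal.ofReal (R ^ (1 - γ) / (1 - γ)) := by
  have h := lintegral_comp_abs ((Iic R).indicator fun r => ENNReal.ofReal (r ^ (-γ)))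
  rw [show (1 - γ) = -γ + 1 by ring, ← lintegral_rpow_Ioc (by linarith) hR]
  rw [setLIntegral_indicator measurableSet_Iic, inter_comm, Ioi_inter_Iic] at h
  exact h

lemma lintegral_rieszKernel_far {γ q R : ℝ} (hγ : γ * q = 2) (hR : 0 < R) :
    ∫⁻ r, {r | |r| ≤ R}ᶜ.indicator (fun r => rieszKernel γ r ^ q) r
      = 2 * ENNReal.ofReal R⁻¹ := by
  have h := lintegral_comp_abs ((Ioi R).indicator fun r => ENNReal.ofReal (r ^ (-2 : ℝ)))
  rw [setLIntegral_indicator measurableSet_Ioi, inter_eq_left.2 (Ioi_subset_Ioi hR.le),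
    ← ofReal_integral_eq_lintegral_ofReal (integrableOn_Ioi_rpow_of_lt (by norm_num) hR),
    integral_Ioi_rpow_of_lt (by norm_num) hR] at h
  · convert h using 2
    · ext r
      by_cases hr : |r| ≤ R
      · simp [indicator, hr]
      · have : 0 < |r| := hR.trans (not_le.1 hr)
        simp only [rieszKernel, indicator, mem_compl_iff, mem_ofPred_eq, hr, not_false_eq_true,
          if_true, mem_Ioi, not_le.1 hr]
        rw [ENNReal.ofReal_rpow_of_pos (by positivity), ← Real.rpow_mul this.le, neg_mul, hγ]
    · norm_num [Real.rpow_neg_one]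
  · filter_upwards [ae_restrict_mem measurableSet_Ioi] with r hr
    exact Real.rpow_nonneg (hR.le.trans (le_of_lt hr)) _

/-- The constant of the one-sided bound below. -/
def hlsConst (q : ℝ) : ENNReal :=
  2 * ENNReal.ofReal (1 / (1 - 2 / q)) + (2 : ENNReal) ^ (1 / q)

lemma hlsConst_ne_top {q : ℝ} (hq : 0 < q) : hlsConst q ≠ ⊤ := by
  refine ENNReal.add_ne_top.2 ⟨ENNReal.mul_ne_top (by norm_num) ENNReal.ofReal_ne_top, ?_⟩
  exact ENNReal.rpow_ne_top_of_nonneg (by positivity) (by norm_num)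

lemma hlsConst_ne_zero {q : ℝ} : hlsConst q ≠ 0 := by
  refine (lt_of_lt_of_le ?_ le_add_self).ne'
  exact ENNReal.rpow_pos (by norm_num) (by norm_num)

/-- The fractional integral of a function truncated at the height `a`: the truncation controls
the part of the kernel near the diagonal, the `L^p` norm the part away from it. -/
lemma lintegral_min_mul_rieszKernel_le {p q : ℝ} (hpq : p.HolderConjugate q) (hq : 2 < q)
    {g : ℝ → ENNReal} (hg : Measurable g) (hg1 : ∫⁻ t, g t ^ p ≤ 1) (a : ENNReal) (s : ℝ) :
    ∫⁻ t, min (g t) a * rieszKernel (2 / q) (t - s) ≤ hlsConst q * a ^ (p - 1) := by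
  have hp : 1 < p := hpq.lt
  rcases eq_or_ne a ⊤ with hat | hat
  · rw [hat, ENNReal.top_rpow_of_pos (by linarith), ENNReal.mul_top hlsConst_ne_zero]
    exact le_top
  rcases eq_or_ne a 0 with ha0 | ha0
  · simp [ha0]
  set α := a.toReal with hα
  have haα : a = ENNReal.ofReal α := (ENNReal.ofReal_toReal hat).symm
  have hα0 : 0 < α := ENNReal.toReal_pos ha0 hat
  -- the radius at which the two parts of the integral balance
  set R := α ^ (-p) with hRdef
  have hR : 0 < R := Real.rpow_pos_of_pos hα0 _
  have hγ1 : 2 / q < 1 := by rw [div_lt_one] <;> linarith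
  have hγq : 2 / q * q = 2 := by field_simp
  have hrel : p * q = p + q := hpq.mul_eq_add
  set S : Set ℝ := {r | |r| ≤ R} with hS
  have hSm : MeasurableSet S := measurableSet_le (by fun_prop) measurable_const
  have hshift : ∫⁻ t, min (g t) a * rieszKernel (2 / q) (t - s)
      = ∫⁻ r, min (g (r + s)) a * rieszKernel (2 / q) r := by
    rw [← lintegral_add_right_eq_self _ s]
    simp
  have hg2 : ∫⁻ r, g (r + s) ^ p ≤ 1 := by
    rw [lintegral_add_right_eq_self (fun r => g r ^ p) s]; exact hg1
  rw [hshift]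
  have hpt : ∀ r, min (g (r + s)) a * rieszKernel (2 / q) r ≤
      a * S.indicator (rieszKernel (2 / q)) r
        + g (r + s) * Sᶜ.indicator (rieszKernel (2 / q)) r := by
    intro r
    by_cases hr : r ∈ S
    · simp only [indicator_of_mem hr, indicator_of_notMem (notMem_compl_iff.2 hr), mul_zero,
        add_zero]
      gcongr; exact min_le_right _ _
    · simp only [indicator_of_notMem hr, indicator_of_mem (mem_compl hr), mul_zero, zero_add]
      gcongr; exact min_le_left _ _
  have hK : Measurable (rieszKernel (2 / q)) := measurable_rieszKernel _
  refine (lintegral_mono hpt).trans ?_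
  rw [lintegral_add_left ((hK.indicator hSm).const_mul _), lintegral_const_mul _ (hK.indicator hSm),
    lintegral_rieszKernel_near hγ1 hR.le, hlsConst, add_mul]
  refine add_le_add (le_of_eq ?_) ?_
  · rw [haα, mul_left_comm, mul_assoc, ENNReal.ofReal_rpow_of_pos hα0,
      ← ENNReal.ofReal_mul hα0.le, ← ENNReal.ofReal_mul (by
        have : 0 < 1 - 2 / q := by linarith
        positivity)]
    congr 2
    have e : α * R ^ (1 - 2 / q) = α ^ (p - 1) := by
      rw [hRdef, ← Real.rpow_mul hα0.le]
      nth_rw 1 [← Real.rpow_one α]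
      rw [← Real.rpow_add hα0]
      congr 1
      field_simp
      linarith
    rw [← e]; ring
  · have hh := ENNReal.lintegral_mul_le_Lp_mul_Lq (volume : Measure ℝ) hpq
      (f := fun r => g (r + s)) (g := Sᶜ.indicator (rieszKernel (2 / q)))
      (hg.comp (measurable_id.add_const s)).aemeasurable (hK.indicator hSm.compl).aemeasurable
    refine hh.trans ?_
    have e1 : ∀ r, Sᶜ.indicator (rieszKernel (2 / q)) r ^ q
        = Sᶜ.indicator (fun r => rieszKernel (2 / q) r ^ q) r := by
      intro r
      by_cases hr : r ∈ S
      · simp [hr, show 0 < q by linarith]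
      · simp [hr]
    simp only [e1]
    rw [lintegral_rieszKernel_far hγq hR]
    have e2 : (∫⁻ r, g (r + s) ^ p) ^ (1 / p) ≤ 1 :=
      (ENNReal.rpow_le_rpow hg2 (by positivity)).trans (by simp)
    refine (mul_le_mul_left e2 _).trans ?_
    rw [one_mul, ENNReal.mul_rpow_of_nonneg _ _ (by positivity), haα,
      ENNReal.ofReal_rpow_of_pos (inv_pos.2 hR), ENNReal.ofReal_rpow_of_pos hα0]
    refine le_of_eq ?_
    congr 2
    rw [hRdef, Real.rpow_neg hα0.le, inv_inv, ← Real.rpow_mul hα0.le]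
    congr 1
    field_simp
    linarith

/-- The Hardy–Littlewood–Sobolev inequality in bilinear form. The product `f(s) g(t)` is bounded by
`f(s) min(g(t), f(s)) + g(t) min(f(s), g(t))`, so that the truncated bound applies. -/
lemma hls_bilinear {p q : ℝ} (hpq : p.HolderConjugate q) (hq : 2 < q)
    {f g : ℝ → ENNReal} (hf : Measurable f) (hg : Measurable g) :
    ∫⁻ s, ∫⁻ t, f s * g t * rieszKernel (2 / q) (t - s) ≤
      2 * hlsConst q * ((∫⁻ s, f s ^ p) ^ (1 / p) * (∫⁻ t, g t ^ p) ^ (1 / p)) := by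
  have hp : 1 < p := hpq.lt
  have hK : Measurable fun z : ℝ × ℝ => rieszKernel (2 / q) (z.2 - z.1) :=
    (measurable_rieszKernel _).comp (by fun_prop)
  have hsymm : ∀ s t : ℝ, rieszKernel (2 / q) (t - s) = rieszKernel (2 / q) (s - t) := by
    intro s t; rw [rieszKernel, rieszKernel, abs_sub_comm]
  have hnormalized : ∀ f g : ℝ → ENNReal, Measurable f → Measurable g → ∫⁻ s, f s ^ p ≤ 1 →
      ∫⁻ s, g s ^ p ≤ 1 → ∫⁻ s, ∫⁻ t, f s * g t * rieszKernel (2 / q) (t - s)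
        ≤ 2 * hlsConst q := by
    intro f g hf hg hf1 hg1
    have hpow : ∀ a : ENNReal, a * a ^ (p - 1) = a ^ p := fun a => by
      nth_rw 1 [← ENNReal.rpow_one a]
      rw [← ENNReal.rpow_add_of_nonneg _ _ (by norm_num) (by linarith)]; congr 1; ring
    have half : ∀ f g : ℝ → ENNReal, Measurable f → Measurable g → ∫⁻ s, f s ^ p ≤ 1 →
        ∫⁻ s, g s ^ p ≤ 1 → ∫⁻ s, ∫⁻ t, f s * min (g t) (f s) * rieszKernel (2 / q) (t - s)
          ≤ hlsConst q := by
      intro f g hf hg hf1 hg1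
      calc _ ≤ ∫⁻ s, hlsConst q * f s ^ p := by
            refine lintegral_mono fun s => ?_
            simp only [mul_assoc]
            have hm : Measurable fun t => min (g t) (f s) * rieszKernel (2 / q) (t - s) :=
              (hg.min measurable_const).mul ((measurable_rieszKernel _).comp (by fun_prop))
            rw [lintegral_const_mul _ hm, ← hpow, mul_left_comm]
            exact mul_le_mul_right (lintegral_min_mul_rieszKernel_le hpq hq hg hg1 (f s) s) _
        _ = hlsConst q * ∫⁻ s, f s ^ p := lintegral_const_mul _ (hf.pow_const _)
        _ ≤ hlsConst q * 1 := by gcongr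
        _ = _ := mul_one _
    have hF : Measurable fun z : ℝ × ℝ =>
        f z.1 * min (g z.2) (f z.1) * rieszKernel (2 / q) (z.2 - z.1) := by fun_prop
    have hG : Measurable fun z : ℝ × ℝ =>
        g z.2 * min (f z.1) (g z.2) * rieszKernel (2 / q) (z.1 - z.2) := by
      have : Measurable fun z : ℝ × ℝ => rieszKernel (2 / q) (z.1 - z.2) :=
        (measurable_rieszKernel _).comp (by fun_prop)
      fun_prop
    calc _ ≤ ∫⁻ s, ∫⁻ t, (f s * min (g t) (f s) * rieszKernel (2 / q) (t - s)
          + g t * min (f s) (g t) * rieszKernel (2 / q) (s - t)) := by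
          refine lintegral_mono fun s => lintegral_mono fun t => ?_
          rw [← hsymm s t, ← add_mul]
          gcongr
          rcases le_total (g t) (f s) with h | h
          · rw [min_eq_left h]; exact le_self_add
          · rw [min_eq_left (a := f s) h, mul_comm (f s)]; exact le_add_self
      _ = (∫⁻ s, ∫⁻ t, f s * min (g t) (f s) * rieszKernel (2 / q) (t - s))
          + ∫⁻ s, ∫⁻ t, g t * min (f s) (g t) * rieszKernel (2 / q) (s - t) := by
          rw [← lintegral_add_left hF.lintegral_prod_right']
          refine lintegral_congr fun s => lintegral_add_left ?_ _
          exact hF.comp (measurable_const.prodMk measurable_id)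
      _ ≤ hlsConst q + hlsConst q := by
          refine add_le_add (half f g hf hg hf1 hg1) ?_
          rw [lintegral_lintegral_swap hG.aemeasurable]
          exact half g f hg hf hg1 hf1
      _ = _ := (two_mul _).symm
  -- the general case, by homogeneity
  set N := fun h : ℝ → ENNReal => (∫⁻ s, h s ^ p) ^ (1 / p) with hN
  have hzero : ∀ h : ℝ → ENNReal, Measurable h → N h = 0 → h =ᵐ[volume] 0 := by
    intro h hh h0
    rw [hN] at h0
    simp only [ENNReal.rpow_eq_zero_iff, one_div, inv_pos, inv_neg''] at h0
    have h1 : ∫⁻ s, h s ^ p = 0 := by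
      rcases h0 with h0 | h0
      · exact h0.1
      · linarith [h0.2]
    rw [lintegral_eq_zero_iff (hh.pow_const _)] at h1
    filter_upwards [h1] with s hs
    simpa [ENNReal.rpow_eq_zero_iff, show ¬ p < 0 by linarith, show 0 < p by linarith] using hs
  change _ ≤ 2 * hlsConst q * (N f * N g)
  rcases eq_or_ne (N f) 0 with hf0 | hf0
  · have := hzero f hf hf0
    rw [lintegral_congr_ae (g := fun _ => 0)]
    · simp
    · filter_upwards [this] with s hs
      simp [hs]
  rcases eq_or_ne (N g) 0 with hg0 | hg0
  · have := hzero g hg hg0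
    have e : ∀ s, ∫⁻ t, f s * g t * rieszKernel (2 / q) (t - s) = 0 := fun s => by
      rw [lintegral_congr_ae (g := fun _ => 0)]
      · simp
      · filter_upwards [this] with t ht
        simp [ht]
    simp [e]
  have hc0 : 2 * hlsConst q ≠ 0 := mul_ne_zero (by norm_num) hlsConst_ne_zero
  rcases eq_or_ne (N f) ⊤ with hft | hft
  · rw [hft, ENNReal.top_mul hg0, ENNReal.mul_top hc0]; exact le_top
  rcases eq_or_ne (N g) ⊤ with hgt | hgt
  · rw [hgt, ENNReal.mul_top hf0, ENNReal.mul_top hc0]; exact le_top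
  have hone : ∀ h : ℝ → ENNReal, Measurable h → N h ≠ 0 → N h ≠ ⊤ →
      ∫⁻ s, ((N h)⁻¹ * h s) ^ p ≤ 1 := by
    intro h hh h0 ht
    have e : ∀ s, ((N h)⁻¹ * h s) ^ p = (N h)⁻¹ ^ p * h s ^ p := fun s =>
      ENNReal.mul_rpow_of_nonneg _ _ (by linarith)
    simp only [e]
    rw [lintegral_const_mul _ (hh.pow_const _), ENNReal.inv_rpow]
    have e2 : N h ^ p = ∫⁻ s, h s ^ p := by
      rw [hN]; simp only
      rw [← ENNReal.rpow_mul, one_div, inv_mul_cancel₀ (by linarith), ENNReal.rpow_one]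
    rw [e2]
    exact ENNReal.inv_mul_le_one _
  have key := hnormalized (fun s => (N f)⁻¹ * f s) (fun s => (N g)⁻¹ * g s) (hf.const_mul _)
    (hg.const_mul _) (hone f hf hf0 hft) (hone g hg hg0 hgt)
  have e : ∀ s t, f s * g t * rieszKernel (2 / q) (t - s) = (N f * N g) *
      ((N f)⁻¹ * f s * ((N g)⁻¹ * g t) * rieszKernel (2 / q) (t - s)) := by
    intro s t
    have h1 := ENNReal.mul_inv_cancel hf0 hft
    have h2 := ENNReal.mul_inv_cancel hg0 hgt
    calc _ = (N f * (N f)⁻¹) * (N g * (N g)⁻¹) * (f s * g t * rieszKernel (2 / q) (t - s)) := by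
          rw [h1, h2, one_mul, one_mul]
      _ = _ := by ring
  have hne : N f * N g ≠ ⊤ := ENNReal.mul_ne_top hft hgt
  calc _ = (N f * N g) * ∫⁻ s, ∫⁻ t,
        (N f)⁻¹ * f s * ((N g)⁻¹ * g t) * rieszKernel (2 / q) (t - s) := by
        rw [← lintegral_const_mul' _ _ hne]
        refine lintegral_congr fun s => ?_
        rw [← lintegral_const_mul' _ _ hne]
        exact lintegral_congr fun t => e s t
    _ ≤ (N f * N g) * (2 * hlsConst q) := by gcongr
    _ = _ := mul_comm _ _

/-- The Hardy–Littlewood–Sobolev inequality: fractional integration maps `L^p(ℝ)` to `L^q(ℝ)`. -/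
lemma hls {p q : ℝ} (hpq : p.HolderConjugate q) (hq : 2 < q)
    {f : ℝ → ENNReal} (hf : Measurable f) :
    (∫⁻ t, (∫⁻ s, f s * rieszKernel (2 / q) (t - s)) ^ q) ^ (1 / q) ≤
      2 * hlsConst q * (∫⁻ s, f s ^ p) ^ (1 / p) := by
  have hp : 1 < p := hpq.lt
  have hrel : p * q = p + q := hpq.mul_eq_add
  have hK : Measurable fun z : ℝ × ℝ => rieszKernel (2 / q) (z.2 - z.1) :=
    (measurable_rieszKernel _).comp (by fun_prop)
  have hK' : Measurable fun z : ℝ × ℝ => rieszKernel (2 / q) (z.1 - z.2) :=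
    (measurable_rieszKernel _).comp (by fun_prop)
  set k : ℝ → ENNReal := fun t => ∫⁻ s, f s * rieszKernel (2 / q) (t - s) with hk
  have hkm : Measurable k := by
    have : Measurable fun z : ℝ × ℝ => f z.2 * rieszKernel (2 / q) (z.1 - z.2) := by fun_prop
    exact this.lintegral_prod_right'
  -- the truncations of `k` have finite `L^q` norm
  set kn : ℕ → ℝ → ENNReal := fun n => (Icc (-(n : ℝ)) n).indicator (fun t => min (k t) n) with hkn
  have hknm : ∀ n, Measurable (kn n) := fun n =>
    (hkm.min measurable_const).indicator measurableSet_Icc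
  have hknk : ∀ n t, kn n t ≤ k t := fun n t => by
    simp only [hkn, indicator]; split_ifs
    · exact min_le_left _ _
    · exact zero_le
  have hbd : ∀ n, (∫⁻ t, kn n t ^ q) ^ (1 / q) ≤ 2 * hlsConst q * (∫⁻ s, f s ^ p) ^ (1 / p) := by
    intro n
    refine rpow_inv_le_of_le_mul_rpow_inv hpq ?_ ?_
    · refine ne_top_of_le_ne_top
        (b := ∫⁻ t, (Icc (-(n : ℝ)) n).indicator (fun _ => (n : ENNReal) ^ q) t) ?_ ?_
      · rw [lintegral_indicator measurableSet_Icc, setLIntegral_const]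
        exact ENNReal.mul_ne_top (ENNReal.rpow_ne_top_of_nonneg (by linarith) (by simp)) (by simp)
      · refine lintegral_mono fun t => ?_
        simp only [hkn, indicator]
        split_ifs
        · exact ENNReal.rpow_le_rpow (min_le_right _ _) (by linarith)
        · simp [show 0 < q by linarith]
    · have e1 : ∀ t, kn n t ^ q = (kn n t ^ (q - 1)) ^ p := fun t => by
        rw [← ENNReal.rpow_mul]; congr 1; linarith
      have h := hls_bilinear hpq hq hf ((hknm n).pow_const (q - 1))
      simp only [← e1] at h
      refine le_trans ?_ (h.trans_eq (by ring))
      have hF : Measurable fun z : ℝ × ℝ =>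
        f z.1 * kn n z.2 ^ (q - 1) * rieszKernel (2 / q) (z.2 - z.1) := by
          have := hknm n; fun_prop
      rw [lintegral_lintegral_swap hF.aemeasurable]
      refine lintegral_mono fun t => ?_
      have e2 : ∫⁻ s, f s * kn n t ^ (q - 1) * rieszKernel (2 / q) (t - s)
          = kn n t ^ (q - 1) * k t := by
        rw [hk]; simp only
        rw [← lintegral_const_mul]
        · exact lintegral_congr fun s => by ring
        · exact hf.mul ((measurable_rieszKernel _).comp (by fun_prop))
      rw [e2]
      calc kn n t ^ q = kn n t ^ (q - 1) * kn n t := by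
            nth_rw 3 [← ENNReal.rpow_one (kn n t)]
            rw [← ENNReal.rpow_add_of_nonneg _ _ (by linarith) (by norm_num)]; congr 1; ring
        _ ≤ _ := by gcongr; exact hknk n t
  have hmono : ∀ t, Monotone fun n => kn n t := by
    intro t m n hmn
    have hmn' : (m : ℝ) ≤ n := by exact_mod_cast hmn
    have hmn'' : (m : ENNReal) ≤ n := by exact_mod_cast hmn
    simp only [hkn, indicator]
    split_ifs with h1 h2
    · exact min_le_min_left _ hmn''
    · exact absurd ⟨by linarith [h1.1], by linarith [h1.2]⟩ h2
    · exact zero_le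
    · exact le_rfl
  have hlim : ∀ t, Tendsto (fun n => kn n t ^ q) atTop (𝓝 (k t ^ q)) := by
    intro t
    refine (ENNReal.continuous_rpow_const.tendsto _).comp ?_
    have h1 : Tendsto (fun n : ℕ => min (k t) (n : ENNReal)) atTop (𝓝 (min (k t) ⊤)) :=
      tendsto_const_nhds.min ENNReal.tendsto_nat_nhds_top
    rw [min_top_right] at h1
    refine h1.congr' ?_
    obtain ⟨n0, hn0⟩ := exists_nat_ge |t|
    filter_upwards [eventually_ge_atTop n0] with n hn
    have : |t| ≤ n := hn0.trans (by exact_mod_cast hn)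
    simp only [hkn]
    rw [indicator_of_mem (show t ∈ Icc (-(n : ℝ)) n from abs_le.1 this)]
  have hmct := lintegral_tendsto_of_tendsto_of_monotone (μ := (volume : Measure ℝ))
    (fun n => ((hknm n).pow_const q).aemeasurable)
    (Eventually.of_forall fun t m n hmn => ENNReal.rpow_le_rpow (hmono t hmn) (by linarith))
    (Eventually.of_forall hlim)
  exact le_of_tendsto ((ENNReal.continuous_rpow_const.tendsto _).comp hmct)
    (Eventually.of_forall hbd)

/-! ### The Strichartz exponents and truncated powers -/

/-- The symmetric Strichartz exponent `q = 2(d+2)/d`. -/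
def qE (d : ℕ) : ℝ := 2 * (d + 2) / d

/-- The exponent `p = 2(d+2)/(d+4)` dual to `q`. -/
def pE (d : ℕ) : ℝ := 2 * (d + 2) / (d + 4)

variable {d : ℕ}

lemma cast_pos_of_one_le (hd : 1 ≤ d) : (0 : ℝ) < d := by exact_mod_cast hd

lemma qE_eq (hd : 1 ≤ d) : qE d = 4 / d + 2 := by
  have := cast_pos_of_one_le hd
  rw [qE]; field_simp; ring

lemma two_lt_qE (hd : 1 ≤ d) : 2 < qE d := by
  have := cast_pos_of_one_le hd
  rw [qE_eq hd]; have : (0 : ℝ) < 4 / d := by positivity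
  linarith

lemma holder_pE_qE (hd : 1 ≤ d) : (pE d).HolderConjugate (qE d) := by
  have := cast_pos_of_one_le hd
  rw [Real.holderConjugate_iff]
  constructor
  · rw [pE, lt_div_iff₀ (by positivity)]; linarith
  · rw [pE, qE]; field_simp; ring

/-- The power `|z|^a z` with the factor `|z|^a` truncated at height `R`. -/
def truncPow (a R : ℝ) (z : ℂ) : ℂ := ((min ‖z‖ R) ^ a : ℝ) * z

lemma norm_truncPow {a R : ℝ} (hR : 0 ≤ R) (z : ℂ) :
    ‖truncPow a R z‖ = (min ‖z‖ R) ^ a * ‖z‖ := by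
  rw [truncPow, norm_mul, Complex.norm_real, Real.norm_of_nonneg]
  exact Real.rpow_nonneg (le_min (norm_nonneg _) hR) _

lemma rpow_sub_rpow_le {x y b : ℝ} (hb : 1 ≤ b) (hy : 0 ≤ y) (hx : 0 < x) :
    x ^ b - y ^ b ≤ b * x ^ (b - 1) * (x - y) := by
  have h := one_add_mul_self_le_rpow_one_add (s := y / x - 1) (p := b)
    (by have : 0 ≤ y / x := by positivity
        linarith) hb
  rw [add_sub_cancel, Real.div_rpow hy hx.le, le_div_iff₀ (Real.rpow_pos_of_pos hx _)] at h
  have e : x ^ b = x ^ (b - 1) * x := by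
    rw [← Real.rpow_add_one hx.ne']; ring_nf
  have e2 : (1 + b * (y / x - 1)) * x ^ b = x ^ b + b * x ^ (b - 1) * (y - x) := by
    have : (y / x - 1) * x = y - x := by field_simp
    rw [add_mul, one_mul]
    nth_rw 2 [e]
    rw [← this]; ring
  rw [e2] at h
  linarith

/-- The truncated power is locally Lipschitz, with a constant independent of the truncation. For
`|w| ≤ |z|` the difference is `x^a (z - w) + (x^a - y^a) w`, with `x`, `y` the truncated moduli, and
the last term is controlled by Bernoulli's inequality. -/
lemma truncPow_sub_le {a R : ℝ} (ha : 0 ≤ a) (hR : 0 ≤ R) (z w : ℂ) :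
    ‖truncPow a R z - truncPow a R w‖
      ≤ (a + 2) * (max (min ‖z‖ R) (min ‖w‖ R)) ^ a * ‖z - w‖ := by
  wlog h : ‖w‖ ≤ ‖z‖ generalizing z w
  · have := this w z (le_of_not_ge h)
    rwa [norm_sub_rev, norm_sub_rev w, max_comm] at this
  set x := min ‖z‖ R with hx
  set y := min ‖w‖ R with hy
  have hyx : y ≤ x := min_le_min_right _ h
  have hx0 : 0 ≤ x := le_min (norm_nonneg _) hR
  have hy0 : 0 ≤ y := le_min (norm_nonneg _) hR
  rw [max_eq_left hyx]
  have e : truncPow a R z - truncPow a R w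
      = ((x ^ a : ℝ) : ℂ) * (z - w) + ((x ^ a - y ^ a : ℝ) : ℂ) * w := by
    simp only [truncPow]; push_cast; ring
  have hpow : y ^ a ≤ x ^ a := Real.rpow_le_rpow hy0 hyx ha
  have hmain : (x ^ a - y ^ a) * ‖w‖ ≤ (a + 1) * x ^ a * ‖z - w‖ := by
    have hn : ‖z‖ - ‖w‖ ≤ ‖z - w‖ := norm_sub_norm_le z w
    rcases le_total R ‖w‖ with hRw | hRw
    · have : x = y := by rw [hx, hy, min_eq_right hRw, min_eq_right (hRw.trans h)]
      rw [this, sub_self, zero_mul]; positivity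
    · have hyw : y = ‖w‖ := by rw [hy, min_eq_left hRw]
      rcases eq_or_lt_of_le hx0 with h0 | h0
      · have : y = x := le_antisymm hyx (h0 ▸ hy0)
        rw [this, sub_self, zero_mul]; positivity
      have h1 := rpow_sub_rpow_le (x := x) (y := y) (b := a + 1) (by linarith) hy0 h0
      have h2 : x ^ (a + 1) = x ^ a * x := Real.rpow_add_one h0.ne' a
      have h3 : y ^ (a + 1) = y ^ a * y := by
        rcases eq_or_lt_of_le hy0 with h0' | h0'
        · rw [← h0', Real.zero_rpow (by linarith), mul_zero]
        · exact Real.rpow_add_one h0'.ne' a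
      rw [add_sub_cancel_right, h2, h3] at h1
      have hxa : 0 ≤ x ^ a := by positivity
      have hxz : x ≤ ‖z‖ := min_le_left _ _
      rw [← hyw]
      have h4 : (a + 1) * x ^ a * (x - y) ≤ (a + 1) * x ^ a * ‖z - w‖ := by
        apply mul_le_mul_of_nonneg_left _ (by positivity); linarith
      have h5 : x ^ a * y ≤ x ^ a * x := mul_le_mul_of_nonneg_left hyx hxa
      linarith
  rw [e]
  refine (norm_add_le _ _).trans ?_
  rw [norm_mul, norm_mul, Complex.norm_real, Complex.norm_real,
    Real.norm_of_nonneg (by positivity), Real.norm_of_nonneg (sub_nonneg.2 hpow)]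
  linarith

lemma lipschitzWith_truncPow {a R : ℝ} (ha : 0 ≤ a) (hR : 0 ≤ R) :
    LipschitzWith (Real.toNNReal ((a + 2) * R ^ a)) (truncPow a R) := by
  refine LipschitzWith.of_dist_le_mul fun z w => ?_
  rw [dist_eq_norm, dist_eq_norm, Real.coe_toNNReal _ (by positivity)]
  refine (truncPow_sub_le ha hR z w).trans ?_
  have : max (min ‖z‖ R) (min ‖w‖ R) ≤ R := max_le (min_le_right _ _) (min_le_right _ _)
  gcongr

lemma truncPow_zero (a R : ℝ) : truncPow a R 0 = 0 := by simp [truncPow]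

lemma four_div_nonneg (d : ℕ) : (0 : ℝ) ≤ 4 / d := by positivity

/-- The truncated power `min(|f|, n)^{4/d} f`, a continuous map of `L²` into itself. -/
def truncL2 (n : ℕ) (f : L2 d) : L2 d :=
  (lipschitzWith_truncPow (four_div_nonneg d) (Nat.cast_nonneg n)).compLp (truncPow_zero _ _) f

lemma truncL2_ae (n : ℕ) (f : L2 d) :
    truncL2 n f =ᵐ[volume] fun x => truncPow (4 / d) n (f x) :=
  LipschitzWith.coeFn_compLp _ _ _

lemma continuous_truncL2 (n : ℕ) : Continuous (truncL2 n : L2 d → L2 d) :=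
  LipschitzWith.continuous_compLp
    (lipschitzWith_truncPow (four_div_nonneg d) (Nat.cast_nonneg n)) (truncPow_zero _ _)

/-- The truncation `∫ min(|f|, n)^{4/d} |f|²` of `∫ |f|^q`. It is continuous on `L²`. -/
def energy (n : ℕ) (f : L2 d) : ℝ := (inner ℂ (truncL2 n f) f).re

lemma continuous_energy (n : ℕ) : Continuous (energy n : L2 d → ℝ) :=
  Complex.continuous_re.comp ((continuous_truncL2 n).inner continuous_id)

/-- The norm of `L^q(ℝ^d)`, `q = 2(d+2)/d`, on `L²(ℝ^d)`. -/
def normQ (f : L2 d) : ENNReal := (∫⁻ x, ‖f x‖ₑ ^ qE d) ^ (1 / qE d)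

/-- The norm of `L^p(ℝ^d)`, `p = 2(d+2)/(d+4)`, on `L²(ℝ^d)`. -/
def normP (f : L2 d) : ENNReal := (∫⁻ x, ‖f x‖ₑ ^ pE d) ^ (1 / pE d)

lemma qE_pos (hd : 1 ≤ d) : 0 < qE d := by linarith [two_lt_qE hd]

lemma normQ_rpow (hd : 1 ≤ d) (f : L2 d) : normQ f ^ qE d = ∫⁻ x, ‖f x‖ₑ ^ qE d := by
  rw [normQ, ← ENNReal.rpow_mul, one_div, inv_mul_cancel₀ (qE_pos hd).ne', ENNReal.rpow_one]

lemma inner_truncL2_self (n : ℕ) (f : L2 d) :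
    inner ℂ (truncL2 n f) f = ((∫ x, (min ‖f x‖ n) ^ (4 / d : ℝ) * ‖f x‖ ^ 2 : ℝ) : ℂ) := by
  rw [L2.inner_def, ← integral_complex_ofReal]
  refine integral_congr_ae ?_
  filter_upwards [truncL2_ae n f] with x hx
  rw [hx, truncPow, RCLike.inner_apply, map_mul, Complex.conj_ofReal, mul_left_comm,
    Complex.mul_conj, Complex.normSq_eq_norm_sq]
  push_cast; ring

lemma integrable_energy (n : ℕ) (f : L2 d) :
    Integrable (fun x => (min ‖f x‖ n) ^ (4 / d : ℝ) * ‖f x‖ ^ 2) volume := by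
  have h := (Lp.memLp f).norm.integrable_sq
  refine (h.const_mul ((n : ℝ) ^ (4 / d : ℝ))).mono' ?_ (Eventually.of_forall fun x => ?_)
  · have hf := (Lp.stronglyMeasurable f).norm.measurable
    exact (by fun_prop : Measurable fun x =>
      (min ‖f x‖ n) ^ (4 / d : ℝ) * ‖f x‖ ^ 2).aestronglyMeasurable
  · rw [Real.norm_of_nonneg (by positivity)]
    gcongr
    exact min_le_right _ _

lemma ofReal_energy (n : ℕ) (f : L2 d) : ENNReal.ofReal (energy n f)
    = ∫⁻ x, ENNReal.ofReal ((min ‖f x‖ n) ^ (4 / d : ℝ) * ‖f x‖ ^ 2) := by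
  rw [energy, inner_truncL2_self, Complex.ofReal_re,
    ofReal_integral_eq_lintegral_ofReal (integrable_energy n f)
      (Eventually.of_forall fun x => by positivity)]

lemma ofReal_energy_eq_enorm (n : ℕ) (f : L2 d) :
    ENNReal.ofReal (energy n f) = ‖(inner ℂ (truncL2 n f) f : ℂ)‖ₑ := by
  rw [energy, inner_truncL2_self, Complex.ofReal_re, ← ofReal_norm, Complex.norm_real,
    Real.norm_of_nonneg (integral_nonneg fun x => by positivity)]

/-- The truncated power of `f` lies in `L^p`, with norm controlled by the truncated `L^q` norm of
`f`: the analogue of `|f|^{q-1} ∈ L^p` for `f ∈ L^q`. -/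
lemma lintegral_truncL2_rpow_le (hd : 1 ≤ d) (n : ℕ) (f : L2 d) :
    ∫⁻ x, ‖truncL2 n f x‖ₑ ^ pE d ≤ ENNReal.ofReal (energy n f) := by
  have hpq := holder_pE_qE hd
  have ha := four_div_nonneg d
  have hq := qE_eq hd
  have hp0 := hpq.pos
  have hrel : pE d * qE d = pE d + qE d := hpq.mul_eq_add
  rw [ofReal_energy]
  refine lintegral_mono_ae ?_
  filter_upwards [truncL2_ae n f] with x hx
  rw [hx, enorm_rpow_eq_ofReal _ hp0.le, norm_truncPow (Nat.cast_nonneg n)]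
  apply ENNReal.ofReal_le_ofReal
  rcases eq_or_lt_of_le (norm_nonneg (f x)) with h0 | h0
  · rw [← h0]; simp [hp0.ne']
  set m := min ‖f x‖ (n : ℝ)
  have hm : 0 ≤ m := by positivity
  have hmx : m ≤ ‖f x‖ := min_le_left _ _
  rcases eq_or_lt_of_le hm with hm0 | hm0
  · have hd0 := cast_pos_of_one_le hd
    rw [← hm0, Real.zero_rpow (by positivity)]; simp [hp0.ne']
  rw [Real.mul_rpow (by positivity) h0.le, ← Real.rpow_mul hm]
  have e1 : m ^ ((4 / d : ℝ) * pE d) = m ^ (4 / d : ℝ) * m ^ (2 - pE d) := by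
    rw [← Real.rpow_add hm0]; congr 1; nlinarith
  have e2 : ‖f x‖ ^ 2 = ‖f x‖ ^ (2 - pE d) * ‖f x‖ ^ pE d := by
    rw [← Real.rpow_add h0]; simp
  rw [e1, e2, mul_assoc]
  have hp2 : pE d ≤ 2 := by
    have := cast_pos_of_one_le hd
    rw [pE, div_le_iff₀ (by positivity)]; linarith
  gcongr

lemma normP_truncL2_le (hd : 1 ≤ d) (n : ℕ) (f : L2 d) :
    normP (truncL2 n f) ≤ ENNReal.ofReal (energy n f) ^ (1 / pE d) :=
  ENNReal.rpow_le_rpow (lintegral_truncL2_rpow_le hd n f)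
    (by have := (holder_pE_qE hd).pos; positivity)

lemma energy_pointwise_mono (f : L2 d) (x : Space d) : Monotone fun n : ℕ =>
    ENNReal.ofReal ((min ‖f x‖ n) ^ (4 / d : ℝ) * ‖f x‖ ^ 2) := by
  intro m n hmn
  have : (m : ℝ) ≤ n := by exact_mod_cast hmn
  dsimp only
  gcongr

lemma tendsto_energy (hd : 1 ≤ d) (f : L2 d) :
    Tendsto (fun n => ENNReal.ofReal (energy n f)) atTop (𝓝 (∫⁻ x, ‖f x‖ₑ ^ qE d)) := by
  simp only [ofReal_energy]
  have hf := (Lp.stronglyMeasurable f).norm.measurable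
  refine lintegral_tendsto_of_tendsto_of_monotone (fun n => ?_) (Eventually.of_forall
    fun x => energy_pointwise_mono f x) (Eventually.of_forall fun x => ?_)
  · exact (by fun_prop : Measurable fun x => ENNReal.ofReal
      ((min ‖f x‖ n) ^ (4 / d : ℝ) * ‖f x‖ ^ 2)).aemeasurable
  · refine tendsto_const_nhds.congr' ?_
    obtain ⟨n0, hn0⟩ := exists_nat_ge ‖f x‖
    filter_upwards [eventually_ge_atTop n0] with n hn
    rw [min_eq_left (hn0.trans (by exact_mod_cast hn)), enorm_rpow_eq_ofReal _ (qE_pos hd).le,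
      qE_eq hd]
    congr 1
    rcases eq_or_lt_of_le (norm_nonneg (f x)) with h0 | h0
    · have := four_div_nonneg d
      rw [← h0, Real.zero_rpow (by linarith)]; simp
    · rw [Real.rpow_add h0]; simp

lemma energy_mono (f : L2 d) : Monotone fun n => ENNReal.ofReal (energy n f) := by
  intro m n hmn
  simp only [ofReal_energy]
  exact lintegral_mono fun x => energy_pointwise_mono f x hmn

lemma iSup_energy (hd : 1 ≤ d) (f : L2 d) :
    ⨆ n, ENNReal.ofReal (energy n f) = ∫⁻ x, ‖f x‖ₑ ^ qE d :=
  tendsto_nhds_unique (tendsto_atTop_iSup (energy_mono f)) (tendsto_energy hd f)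

lemma lowerSemicontinuous_lintegral_rpow (hd : 1 ≤ d) :
    LowerSemicontinuous fun f : L2 d => ∫⁻ x, ‖f x‖ₑ ^ qE d := by
  simp only [← iSup_energy hd]
  exact lowerSemicontinuous_iSup fun n =>
    (ENNReal.continuous_ofReal.comp (continuous_energy n)).lowerSemicontinuous

lemma aemeasurable_lintegral_rpow (hd : 1 ≤ d) {J : Set ℝ} (hJ : MeasurableSet J) {u : ℝ → L2 d}
    (hu : ContinuousOn u J) :
    AEMeasurable (fun t => ∫⁻ x, ‖u t x‖ₑ ^ qE d) (volume.restrict J) := by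
  simp only [← iSup_energy hd]
  exact AEMeasurable.iSup fun n =>
    ((ENNReal.continuous_ofReal.comp (continuous_energy n)).comp_continuousOn hu).aemeasurable hJ

lemma aemeasurable_normQ (hd : 1 ≤ d) {J : Set ℝ} (hJ : MeasurableSet J) {u : ℝ → L2 d}
    (hu : ContinuousOn u J) : AEMeasurable (fun t => normQ (u t)) (volume.restrict J) :=
  (aemeasurable_lintegral_rpow hd hJ hu).pow_const _

/-- Hölder's inequality for the pairing of `L²`. -/
lemma enorm_inner_le (hd : 1 ≤ d) (f g : L2 d) :
    ‖(inner ℂ f g : ℂ)‖ₑ ≤ normP f * normQ g := by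
  rw [L2.inner_def]
  refine (enorm_integral_le_lintegral_enorm _).trans ?_
  refine le_trans (lintegral_mono fun x => ?_) (ENNReal.lintegral_mul_le_Lp_mul_Lq volume
    (holder_pE_qE hd) (Lp.aestronglyMeasurable f).enorm (Lp.aestronglyMeasurable g).enorm)
  rw [RCLike.inner_apply, enorm_mul, RCLike.enorm_conj, mul_comm]
  rfl

lemma normQ_le_of_energy (hd : 1 ≤ d) {f : L2 d} {M : ENNReal}
    (h : ∀ n, ENNReal.ofReal (energy n f) ^ (1 / qE d) ≤ M) : normQ f ≤ M :=
  le_of_tendsto ((ENNReal.continuous_rpow_const.tendsto _).comp (tendsto_energy hd f))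
    (Eventually.of_forall h)

/-- The `L^q` norm of an element of `L²` by duality. -/
lemma normQ_le_of_inner (hd : 1 ≤ d) {f : L2 d} {M : ENNReal}
    (h : ∀ φ : L2 d, ‖(inner ℂ φ f : ℂ)‖ₑ ≤ M * normP φ) : normQ f ≤ M := by
  refine normQ_le_of_energy hd fun n => ?_
  refine rpow_inv_le_of_le_mul_rpow_inv (holder_pE_qE hd) ENNReal.ofReal_ne_top ?_
  nth_rw 1 [ofReal_energy_eq_enorm]
  exact (h _).trans (mul_le_mul_right (normP_truncL2_le hd n f) _)

/-! ### Strichartz estimates -/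

/-- The constant of the decay estimate from `L^p` to `L^q`. -/
def decayConst (d : ℕ) : ENNReal :=
  ENNReal.ofReal ((qE d * (4 * (2 ^ (qE d - 2) / (qE d - 2)))) ^ (1 / qE d)
    * (4 * Real.pi) ^ (-(2 / qE d)))

/-- The decay of the free propagator from `L^p` to `L^q`. -/
lemma normQ_freeProp_le (hd : 1 ≤ d) {t : ℝ} (ht : t ≠ 0) (f : L2 d) :
    normQ (freeProp t f) ≤ decayConst d * rieszKernel (2 / qE d) t * normP f := by
  have hpq := holder_pE_qE hd
  have hq := two_lt_qE hd
  have hq2 : 0 < qE d - 2 := by linarith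
  have ht0 : 0 < |t| := abs_pos.2 ht
  have hA : 0 < (4 * Real.pi * |t|) ^ (-(d / 2) : ℝ) := by positivity
  have h := interpolation (freePropL t) hpq hq hA (fun g hg => dispersive ht g hg) f
  have h2 := ENNReal.rpow_le_rpow h (z := 1 / qE d) (by positivity)
  refine h2.trans (le_of_eq ?_)
  rw [ENNReal.mul_rpow_of_nonneg _ _ (by positivity), ← ENNReal.rpow_mul, normP]
  congr 1
  · rw [decayConst, rieszKernel, ← ENNReal.ofReal_mul (by positivity),
      ENNReal.ofReal_rpow_of_nonneg (by positivity) (by positivity)]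
    congr 1
    rw [Real.mul_rpow (by norm_num : (0 : ℝ) ≤ 2) hA.le]
    have e1 : qE d * (4 * (2 ^ (qE d - 2) * ((4 * Real.pi * |t|) ^ (-(d / 2) : ℝ)) ^ (qE d - 2)
        / (qE d - 2))) = (qE d * (4 * (2 ^ (qE d - 2) / (qE d - 2))))
          * ((4 * Real.pi * |t|) ^ (-(d / 2) : ℝ)) ^ (qE d - 2) := by ring
    have e2 : (((4 * Real.pi * |t|) ^ (-(d / 2) : ℝ)) ^ (qE d - 2)) ^ (1 / qE d)
        = (4 * Real.pi) ^ (-(2 / qE d)) * |t| ^ (-(2 / qE d)) := by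
      rw [← Real.mul_rpow (by positivity) (by positivity), ← Real.rpow_mul (by positivity),
        ← Real.rpow_mul (by positivity)]
      congr 1
      have hd0 := cast_pos_of_one_le hd
      rw [qE]; field_simp; ring
    rw [e1, Real.mul_rpow (by positivity) (by positivity), e2, ← mul_assoc]
  · congr 1
    have := hpq.symm.inv_add_inv_eq_one
    rw [sub_mul, mul_one_div_cancel (by linarith)]
    rw [one_div, one_div]; linarith

/-- The constant of the Strichartz estimate. -/
def strConst (d : ℕ) : ENNReal := (decayConst d * (2 * hlsConst (qE d))) ^ (1 / 2 : ℝ)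

lemma decayConst_ne_top (d : ℕ) : decayConst d ≠ ⊤ := ENNReal.ofReal_ne_top

lemma strConst_ne_top (hd : 1 ≤ d) : strConst d ≠ ⊤ :=
  ENNReal.rpow_ne_top_of_nonneg (by norm_num) (ENNReal.mul_ne_top (decayConst_ne_top d)
    (ENNReal.mul_ne_top (by norm_num) (hlsConst_ne_top (qE_pos hd))))

lemma enorm_integral_mul_self_le {X H : Type*} [MeasurableSpace X] {ν : Measure X}
    [NormedAddCommGroup H] [InnerProductSpace ℂ H] [CompleteSpace H] {g : X → H}
    (hg : Integrable g ν) : ‖∫ t, g t ∂ν‖ₑ * ‖∫ t, g t ∂ν‖ₑ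
      ≤ ∫⁻ t, ∫⁻ s, ‖(inner ℂ (g t) (g s) : ℂ)‖ₑ ∂ν ∂ν := by
  set w := ∫ t, g t ∂ν with hw
  have e0 : ‖w‖ₑ * ‖w‖ₑ = ‖(inner ℂ w w : ℂ)‖ₑ := by
    rw [inner_self_eq_norm_sq_to_K, enorm_pow, pow_two]
    simp [← ofReal_norm]
  have e1 : (inner ℂ w w : ℂ) = ∫ t, inner ℂ w (g t) ∂ν := (integral_inner hg w).symm
  rw [e0, e1]
  refine (enorm_integral_le_lintegral_enorm _).trans (lintegral_mono fun t => ?_)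
  rw [← inner_conj_symm, RCLike.enorm_conj, hw, ← integral_inner hg]
  exact enorm_integral_le_lintegral_enorm _

lemma continuous_freeProp_comp {X : Type*} [TopologicalSpace X] {τ : X → ℝ} {v : X → L2 d}
    (hτ : Continuous τ) (hv : Continuous v) : Continuous fun x => freeProp (τ x) (v x) := by
  have h : Continuous fun x => (τ x, v x) := hτ.prodMk hv
  have := Continuous.comp (continuous_freeProp_uncurry (d := d)) h
  exact this

/-- The Strichartz estimate, truncated in size and time. The truncated field `N` is dual to the free
evolution, and the norm of `∫ e^{-itΔ} N(t) dt` is bounded by expanding the square. -/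
lemma strichartz_energy (hd : 1 ≤ d) (f : L2 d) (n : ℕ) {J : Set ℝ} (hJ : IsCompact J) :
    (∫⁻ t in J, ENNReal.ofReal (energy n (freeProp t f))) ^ (1 / qE d)
      ≤ strConst d * ‖f‖ₑ := by
  have hpq := holder_pE_qE hd
  have hJm := hJ.measurableSet
  set U : ℝ → L2 d := fun t => freeProp t f with hU
  have hUc : Continuous U := continuous_freeProp f
  set g : ℝ → L2 d := fun t => freeProp (-t) (truncL2 n (U t)) with hg
  have hgc : Continuous g := by
    have h1 : Continuous fun t => truncL2 n (U t) := (continuous_truncL2 n).comp hUc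
    exact continuous_freeProp_comp continuous_neg h1
  have hgi : IntegrableOn g J volume := hgc.continuousOn.integrableOn_compact hJ
  have hec : Continuous fun t => energy n (U t) := (continuous_energy n).comp hUc
  set w : L2 d := ∫ t in J, g t with hw
  set h : ℝ → ENNReal := J.indicator fun t => ENNReal.ofReal (energy n (U t)) ^ (1 / pE d) with hh
  have hhm : Measurable h := by
    refine Measurable.indicator ?_ hJm
    exact (ENNReal.measurable_ofReal.comp hec.measurable).pow_const _
  set E := ∫⁻ t in J, ENNReal.ofReal (energy n (U t)) with hE
  have hEh : ∫⁻ t, h t ^ pE d = E := by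
    rw [hE, ← lintegral_indicator hJm]
    refine lintegral_congr fun t => ?_
    by_cases ht : t ∈ J
    · simp only [hh, indicator_of_mem ht]
      rw [← ENNReal.rpow_mul, one_div, inv_mul_cancel₀ hpq.pos.ne', ENNReal.rpow_one]
    · simp [hh, ht, hpq.pos]
  have hEfin : E ≠ ⊤ := by
    have := (hec.continuousOn (s := J)).integrableOn_compact hJ (μ := volume)
    exact (Integrable.lintegral_lt_top this).ne
  have hpair : ∀ s t, t ∈ J → s ∈ J → s ≠ t → ‖(inner ℂ (g t) (g s) : ℂ)‖ₑ ≤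
      decayConst d * (h s * h t * rieszKernel (2 / qE d) (t - s)) := by
    intro s t ht hs hst
    have e : (inner ℂ (g t) (g s) : ℂ)
        = inner ℂ (truncL2 n (U t)) (freeProp (t - s) (truncL2 n (U s))) := by
      simp only [hg]
      rw [inner_freeProp_left, freeProp_freeProp, neg_neg, sub_eq_add_neg]
    rw [e]
    refine (enorm_inner_le hd _ _).trans ?_
    refine (mul_le_mul' (normP_truncL2_le hd n _)
      (normQ_freeProp_le hd (sub_ne_zero.2 hst.symm) _)).trans ?_
    refine (mul_le_mul_right (mul_le_mul_right (normP_truncL2_le hd n _) _) _).trans ?_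
    simp only [hh, indicator_of_mem ht, indicator_of_mem hs]
    exact le_of_eq (by ring)
  have hsq : ‖w‖ₑ * ‖w‖ₑ ≤
      decayConst d * (2 * hlsConst (qE d) * (E ^ (1 / pE d) * E ^ (1 / pE d))) := by
    calc _ ≤ ∫⁻ t in J, ∫⁻ s in J, ‖(inner ℂ (g t) (g s) : ℂ)‖ₑ := enorm_integral_mul_self_le hgi
      _ ≤ ∫⁻ t in J, ∫⁻ s in J, decayConst d * (h s * h t * rieszKernel (2 / qE d) (t - s)) := by
          refine setLIntegral_mono' hJm fun t ht => lintegral_mono_ae ?_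
          have : ∀ᵐ s ∂(volume.restrict J), s ≠ t :=
            ae_restrict_of_ae (by simp [ae_iff])
          filter_upwards [this, ae_restrict_mem hJm] with s hst hs
          exact hpair s t ht hs hst
      _ ≤ ∫⁻ t, ∫⁻ s, decayConst d * (h s * h t * rieszKernel (2 / qE d) (t - s)) :=
          (setLIntegral_le_lintegral _ _).trans
            (lintegral_mono fun t => setLIntegral_le_lintegral _ _)
      _ = decayConst d * ∫⁻ s, ∫⁻ t, h s * h t * rieszKernel (2 / qE d) (t - s) := by
          rw [lintegral_lintegral_swap, ← lintegral_const_mul' _ _ (decayConst_ne_top d)]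
          · exact lintegral_congr fun s => lintegral_const_mul' _ _ (decayConst_ne_top d)
          · have : Measurable fun z : ℝ × ℝ => rieszKernel (2 / qE d) (z.1 - z.2) :=
              (measurable_rieszKernel _).comp (by fun_prop)
            refine Measurable.aemeasurable ?_
            simp only [Function.uncurry_def]
            fun_prop
      _ ≤ _ := by
          have := hls_bilinear hpq (two_lt_qE hd) hhm hhm
          rw [hEh] at this
          exact mul_le_mul_right this _
  have hwle : ‖w‖ₑ ≤ strConst d * E ^ (1 / pE d) := by
    have h2 := ENNReal.rpow_le_rpow hsq (z := (1 / 2 : ℝ)) (by norm_num)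
    have e : ∀ a : ENNReal, (a * a) ^ (1 / 2 : ℝ) = a := fun a => by
      rw [← pow_two, ← ENNReal.rpow_natCast, ← ENNReal.rpow_mul]; norm_num
    rw [e, ← mul_assoc, ENNReal.mul_rpow_of_nonneg _ _ (by norm_num), e] at h2
    exact h2
  refine rpow_inv_le_of_le_mul_rpow_inv hpq hEfin ?_
  -- duality: `E = ⟨f, w⟩`
  have e1 : E ≤ ‖f‖ₑ * ‖w‖ₑ := by
    have e2 : (inner ℂ f w : ℂ) = ((∫ t in J, energy n (U t) : ℝ) : ℂ) := by
      rw [hw, ← integral_inner hgi, ← integral_complex_ofReal]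
      refine integral_congr_ae (Eventually.of_forall fun t => ?_)
      simp only [hg]
      rw [← inner_conj_symm, inner_freeProp_left, neg_neg]
      change (starRingEnd ℂ) (inner ℂ (truncL2 n (U t)) (U t)) = _
      rw [energy, inner_truncL2_self, Complex.conj_ofReal, Complex.ofReal_re]
    have e3 : E = ‖(inner ℂ f w : ℂ)‖ₑ := by
      have h0 : 0 ≤ᵐ[volume.restrict J] fun t => energy n (U t) :=
        Eventually.of_forall fun t => by
          simp only [energy, inner_truncL2_self, Complex.ofReal_re]
          exact integral_nonneg fun x => by positivity
      rw [e2, ← ofReal_norm, Complex.norm_real,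
        Real.norm_of_nonneg (integral_nonneg_of_ae h0), hE,
        ofReal_integral_eq_lintegral_ofReal
          ((hec.continuousOn (s := J)).integrableOn_compact hJ) h0]
    rw [e3, ← ofReal_norm, ← ofReal_norm, ← ofReal_norm, ← ENNReal.ofReal_mul (norm_nonneg _)]
    exact ENNReal.ofReal_le_ofReal (norm_inner_le_norm _ _)
  refine e1.trans ((mul_le_mul_right hwle _).trans (le_of_eq (by ring)))

/-- The homogeneous Strichartz estimate. -/
lemma strichartz (hd : 1 ≤ d) (f : L2 d) :
    (∫⁻ t, normQ (freeProp t f) ^ qE d) ^ (1 / qE d) ≤ strConst d * ‖f‖ₑ := by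
  set G : ℕ → ℝ → ENNReal := fun n => (Icc (-(n : ℝ)) n).indicator
    fun t => ENNReal.ofReal (energy n (freeProp t f)) with hG
  have hec : ∀ n, Continuous fun t => energy n (freeProp t f) := fun n =>
    (continuous_energy n).comp (continuous_freeProp f)
  have hmct : Tendsto (fun n => ∫⁻ t, G n t) atTop (𝓝 (∫⁻ t, normQ (freeProp t f) ^ qE d)) := by
    refine lintegral_tendsto_of_tendsto_of_monotone (fun n => ?_) (Eventually.of_forall
      fun t m n hmn => ?_) (Eventually.of_forall fun t => ?_)
    · exact ((ENNReal.measurable_ofReal.comp (hec n).measurable).indicator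
        measurableSet_Icc).aemeasurable
    · have hmn' : (m : ℝ) ≤ n := by exact_mod_cast hmn
      simp only [hG, indicator]
      split_ifs with h1 h2
      · exact energy_mono _ hmn
      · exact absurd ⟨by linarith [h1.1], by linarith [h1.2]⟩ h2
      · exact zero_le
      · exact le_rfl
    · rw [normQ_rpow hd]
      refine (tendsto_energy hd _).congr' ?_
      obtain ⟨n0, hn0⟩ := exists_nat_ge |t|
      filter_upwards [eventually_ge_atTop n0] with n hn
      have : |t| ≤ n := hn0.trans (by exact_mod_cast hn)
      simp only [hG]
      rw [indicator_of_mem (show t ∈ Icc (-(n : ℝ)) n from abs_le.1 this)]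
  refine le_of_tendsto ((ENNReal.continuous_rpow_const.tendsto _).comp hmct)
    (Eventually.of_forall fun n => ?_)
  simp only [Function.comp, hG]
  rw [lintegral_indicator measurableSet_Icc]
  exact strichartz_energy hd f n isCompact_Icc

/-! ### The nonlinearity -/

lemma nonlin_eq_truncPow (μ : ℝ) {R : ℝ} {z : ℂ} (h : ‖z‖ ≤ R) :
    nonlin d μ z = μ * truncPow (4 / d) R z := by
  rw [nonlin, truncPow, min_eq_left h]; push_cast; ring

lemma continuous_nonlin (hd : 1 ≤ d) (μ : ℝ) : Continuous (nonlin d μ) := by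
  have := cast_pos_of_one_le hd
  have h : Continuous fun z : ℂ => ‖z‖ ^ (4 / d : ℝ) :=
    continuous_norm.rpow_const fun _ => Or.inr (by positivity)
  unfold nonlin
  fun_prop

lemma norm_nonlin {μ : ℝ} (hμ : |μ| = 1) (z : ℂ) :
    ‖nonlin d μ z‖ = ‖z‖ ^ (4 / d : ℝ) * ‖z‖ := by
  rw [nonlin, norm_mul, Complex.norm_real, norm_mul, Real.norm_eq_abs, hμ, one_mul,
    Real.norm_of_nonneg (by positivity)]

/-- The constant in the difference estimate of the nonlinearity. -/
def nlConst (d : ℕ) : ENNReal := ENNReal.ofReal (4 / d + 2)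

lemma enorm_nonlin_sub_le {μ : ℝ} (hμ : |μ| = 1) (z w : ℂ) :
    ‖nonlin d μ z - nonlin d μ w‖ₑ ≤
      nlConst d * (‖z‖ₑ ^ (4 / d : ℝ) * ‖z - w‖ₑ + ‖w‖ₑ ^ (4 / d : ℝ) * ‖z - w‖ₑ) := by
  have ha := four_div_nonneg d
  have h1 : ‖nonlin d μ z - nonlin d μ w‖
      ≤ (4 / d + 2) * ((‖z‖ ^ (4 / d : ℝ) + ‖w‖ ^ (4 / d : ℝ)) * ‖z - w‖) := by
    rw [nonlin_eq_truncPow μ (le_max_left ‖z‖ ‖w‖), nonlin_eq_truncPow μ (le_max_right ‖z‖ ‖w‖),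
      ← mul_sub, norm_mul, Complex.norm_real, Real.norm_eq_abs, hμ, one_mul]
    refine (truncPow_sub_le ha (by positivity) z w).trans ?_
    rw [min_eq_left (le_max_left _ _), min_eq_left (le_max_right _ _), mul_assoc]
    gcongr
    rcases le_total ‖z‖ ‖w‖ with h | h
    · rw [max_eq_right h]; linarith [Real.rpow_nonneg (norm_nonneg z) (4 / d : ℝ)]
    · rw [max_eq_left h]; linarith [Real.rpow_nonneg (norm_nonneg w) (4 / d : ℝ)]
  rw [← add_mul, enorm_rpow_eq_ofReal _ ha, enorm_rpow_eq_ofReal _ ha, nlConst,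
    ← ENNReal.ofReal_add (by positivity) (by positivity), ← ofReal_norm, ← ofReal_norm (z - w),
    ← ENNReal.ofReal_mul (by positivity), ← ENNReal.ofReal_mul (by positivity)]
  exact ENNReal.ofReal_le_ofReal h1

lemma lintegral_rpow_inv_rpow {X : Type*} [MeasurableSpace X] {ν : Measure X} (f : X → ENNReal)
    (q r : ℝ) : (∫⁻ x, f x ^ q ∂ν) ^ (r / q) = ((∫⁻ x, f x ^ q ∂ν) ^ (1 / q)) ^ r := by
  rw [← ENNReal.rpow_mul]; congr 1; ring

/-- Hölder's inequality for the exponents `1/q + (4/d)/q + 1/q = 1`. -/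
lemma lintegral_triple_le {X : Type*} [MeasurableSpace X] {ν : Measure X} (hd : 1 ≤ d)
    {f g h : X → ENNReal} (hf : AEMeasurable f ν) (hg : AEMeasurable g ν) (hh : AEMeasurable h ν) :
    ∫⁻ x, f x * (g x ^ (4 / d : ℝ) * h x) ∂ν ≤ (∫⁻ x, f x ^ qE d ∂ν) ^ (1 / qE d) *
      (((∫⁻ x, g x ^ qE d ∂ν) ^ (1 / qE d)) ^ (4 / d : ℝ) *
        (∫⁻ x, h x ^ qE d ∂ν) ^ (1 / qE d)) := by
  have hq0 := qE_pos hd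
  have ha := four_div_nonneg d
  have hq := qE_eq hd
  have key := ENNReal.lintegral_prod_norm_pow_le (μ := ν) (Finset.univ : Finset (Fin 3))
    (f := ![fun x => f x ^ qE d, fun x => g x ^ qE d, fun x => h x ^ qE d])
    (p := ![1 / qE d, (4 / d) / qE d, 1 / qE d])
    (by intro i _; fin_cases i <;> simp <;> fun_prop)
    (by simp [Fin.sum_univ_three]; rw [hq]; field_simp; ring)
    (by intro i _; fin_cases i <;> simp <;> positivity)
  simp only [Fin.prod_univ_three, Matrix.cons_val_zero, Matrix.cons_val_one, Matrix.cons_val] at key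
  rw [lintegral_rpow_inv_rpow g] at key
  have e : ∀ (c : ENNReal) (r : ℝ), (c ^ qE d) ^ (r / qE d) = c ^ r := fun c r => by
    rw [← ENNReal.rpow_mul]; congr 1; field_simp
  simp only [e, ENNReal.rpow_one] at key
  simp only [← mul_assoc]
  exact key

/-- The bound for the `L^p` norm of `F(f) - F(g)` provided by Hölder's inequality. -/
def diffBound (f g : L2 d) : ENNReal :=
  nlConst d * (normQ f ^ (4 / d : ℝ) * normQ (f - g) + normQ g ^ (4 / d : ℝ) * normQ (f - g))

lemma lintegral_mul_nonlin_sub_le (hd : 1 ≤ d) {μ : ℝ} (hμ : |μ| = 1) (φ f g : L2 d) :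
    ∫⁻ x, ‖φ x‖ₑ * ‖nonlin d μ (f x) - nonlin d μ (g x)‖ₑ ≤ normQ φ * diffBound f g := by
  have hm := fun f : L2 d => (Lp.aestronglyMeasurable f).enorm
  have e : ∀ k : L2 d, ∫⁻ x, ‖φ x‖ₑ * (‖k x‖ₑ ^ (4 / d : ℝ) * ‖(f - g : L2 d) x‖ₑ)
      ≤ normQ φ * (normQ k ^ (4 / d : ℝ) * normQ (f - g)) := fun k =>
    lintegral_triple_le hd (hm φ) (hm k) (hm (f - g))
  calc _ ≤ ∫⁻ x, nlConst d * (‖φ x‖ₑ * (‖f x‖ₑ ^ (4 / d : ℝ) * ‖(f - g : L2 d) x‖ₑ)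
        + ‖φ x‖ₑ * (‖g x‖ₑ ^ (4 / d : ℝ) * ‖(f - g : L2 d) x‖ₑ)) := by
        refine lintegral_mono_ae ?_
        filter_upwards [Lp.coeFn_sub f g] with x hx
        rw [hx, Pi.sub_apply, ← mul_add, mul_left_comm]
        exact mul_le_mul_right (enorm_nonlin_sub_le hμ _ _) _
    _ = nlConst d * ((∫⁻ x, ‖φ x‖ₑ * (‖f x‖ₑ ^ (4 / d : ℝ) * ‖(f - g : L2 d) x‖ₑ))
        + ∫⁻ x, ‖φ x‖ₑ * (‖g x‖ₑ ^ (4 / d : ℝ) * ‖(f - g : L2 d) x‖ₑ)) := by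
        rw [lintegral_const_mul' _ _ (by exact ENNReal.ofReal_ne_top), lintegral_add_left']
        exact (hm φ).mul (((hm f).pow_const _).mul (hm _))
    _ ≤ nlConst d * (normQ φ * (normQ f ^ (4 / d : ℝ) * normQ (f - g))
        + normQ φ * (normQ g ^ (4 / d : ℝ) * normQ (f - g))) := by
        gcongr
        · exact e f
        · exact e g
    _ = _ := by rw [diffBound]; ring

lemma normQ_zero (hd : 1 ≤ d) : normQ (0 : L2 d) = 0 := by
  have hq := qE_pos hd
  have : ∫⁻ x, ‖(0 : L2 d) x‖ₑ ^ qE d = 0 := by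
    rw [lintegral_eq_zero_iff' ((Lp.aestronglyMeasurable _).enorm.pow_const _)]
    filter_upwards [Lp.coeFn_zero ℂ 2 (volume : Measure (Space d))] with x hx
    rw [hx]; simp [hq]
  rw [normQ, this, ENNReal.zero_rpow_of_pos (by positivity)]

lemma normQ_add_le (hd : 1 ≤ d) (f g : L2 d) : normQ (f + g) ≤ normQ f + normQ g := by
  have hq := two_lt_qE hd
  have e : normQ (f + g) = (∫⁻ x, ‖f x + g x‖ₑ ^ qE d) ^ (1 / qE d) := by
    rw [normQ]; congr 1
    refine lintegral_congr_ae ?_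
    filter_upwards [Lp.coeFn_add f g] with x hx
    rw [hx, Pi.add_apply]
  rw [e]
  refine le_trans (ENNReal.rpow_le_rpow (lintegral_mono fun x =>
    ENNReal.rpow_le_rpow (enorm_add_le _ _) (by linarith)) (by positivity)) ?_
  exact ENNReal.lintegral_Lp_add_le (Lp.aestronglyMeasurable f).enorm
    (Lp.aestronglyMeasurable g).enorm (by linarith)

lemma normQ_smul (c : ℂ) (f : L2 d) (hd : 1 ≤ d) : normQ (c • f) = ‖c‖ₑ * normQ f := by
  have hq := qE_pos hd
  have e : ∫⁻ x, ‖(c • f : L2 d) x‖ₑ ^ qE d = ‖c‖ₑ ^ qE d * ∫⁻ x, ‖f x‖ₑ ^ qE d := by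
    rw [← lintegral_const_mul' _ _ (ENNReal.rpow_ne_top_of_nonneg hq.le enorm_ne_top)]
    refine lintegral_congr_ae ?_
    filter_upwards [Lp.coeFn_smul c f] with x hx
    rw [hx, Pi.smul_apply, enorm_smul, ENNReal.mul_rpow_of_nonneg _ _ hq.le]
  rw [normQ, e, ENNReal.mul_rpow_of_nonneg _ _ (by positivity), ← ENNReal.rpow_mul,
    mul_one_div_cancel hq.ne', ENNReal.rpow_one, normQ]

lemma normQ_sub_le (hd : 1 ≤ d) (f g : L2 d) : normQ (f - g) ≤ normQ f + normQ g := by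
  have h := normQ_add_le hd f ((-1 : ℂ) • g)
  rw [normQ_smul _ _ hd] at h
  simpa [sub_eq_add_neg] using h

/-! ### Pairings with the nonlinearity -/

/-- The pairing `⟨ψ, F(f)⟩` of two elements of `L²`, as an integral over space. -/
def nlPairing (μ : ℝ) (ψ f : L2 d) : ℂ := ∫ x, star (ψ x) * nonlin d μ (f x)

lemma aestronglyMeasurable_nonlin (hd : 1 ≤ d) (μ : ℝ) (f : L2 d) :
    AEStronglyMeasurable (fun x => nonlin d μ (f x)) volume :=
  (continuous_nonlin hd μ).comp_aestronglyMeasurable (Lp.aestronglyMeasurable f)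

lemma lintegral_mul_nonlin_le (hd : 1 ≤ d) {μ : ℝ} (hμ : |μ| = 1) (ψ f : L2 d) :
    ∫⁻ x, ‖ψ x‖ₑ * ‖nonlin d μ (f x)‖ₑ ≤ normQ ψ * diffBound f 0 := by
  refine le_trans (le_of_eq ?_) (lintegral_mul_nonlin_sub_le hd hμ ψ f 0)
  refine lintegral_congr_ae ?_
  filter_upwards [Lp.coeFn_zero ℂ 2 (volume : Measure (Space d))] with x hx
  rw [hx]; simp [nonlin]

lemma diffBound_ne_top (hd : 1 ≤ d) {f g : L2 d} (hf : normQ f ≠ ⊤) (hg : normQ g ≠ ⊤) :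
    diffBound f g ≠ ⊤ := by
  have ha := four_div_nonneg d
  have h : normQ (f - g) ≠ ⊤ :=
    ne_top_of_le_ne_top (ENNReal.add_ne_top.2 ⟨hf, hg⟩) (normQ_sub_le hd f g)
  exact ENNReal.mul_ne_top ENNReal.ofReal_ne_top (ENNReal.add_ne_top.2
    ⟨ENNReal.mul_ne_top (ENNReal.rpow_ne_top_of_nonneg ha hf) h,
      ENNReal.mul_ne_top (ENNReal.rpow_ne_top_of_nonneg ha hg) h⟩)

lemma integrable_nlPairing (hd : 1 ≤ d) {μ : ℝ} (hμ : |μ| = 1) {ψ f : L2 d} (hψ : normQ ψ ≠ ⊤)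
    (hf : normQ f ≠ ⊤) : Integrable (fun x => star (ψ x) * nonlin d μ (f x)) volume := by
  refine ⟨((Lp.aestronglyMeasurable ψ).star).mul (aestronglyMeasurable_nonlin hd μ f), ?_⟩
  have h := lintegral_mul_nonlin_le hd hμ ψ f
  have h0 : normQ (0 : L2 d) ≠ ⊤ := by rw [normQ_zero hd]; simp
  refine lt_of_le_of_lt (le_trans (le_of_eq ?_) h)
    (ENNReal.mul_ne_top hψ (diffBound_ne_top hd hf h0)).lt_top
  refine lintegral_congr fun x => ?_
  rw [enorm_mul]; congr 1
  exact RCLike.enorm_conj (ψ x)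

lemma enorm_nlPairing_sub_le (hd : 1 ≤ d) {μ : ℝ} (hμ : |μ| = 1) {ψ f g : L2 d}
    (hψ : normQ ψ ≠ ⊤) (hf : normQ f ≠ ⊤) (hg : normQ g ≠ ⊤) :
    ‖nlPairing μ ψ f - nlPairing μ ψ g‖ₑ ≤ normQ ψ * diffBound f g := by
  rw [nlPairing, nlPairing, ← integral_sub (integrable_nlPairing hd hμ hψ hf)
    (integrable_nlPairing hd hμ hψ hg)]
  refine (enorm_integral_le_lintegral_enorm _).trans
    (le_trans (le_of_eq ?_) (lintegral_mul_nonlin_sub_le hd hμ ψ f g))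
  refine lintegral_congr fun x => ?_
  rw [← mul_sub, enorm_mul]; congr 1
  exact RCLike.enorm_conj (ψ x)

lemma nlPairing_zero_right (μ : ℝ) (ψ : L2 d) : nlPairing μ ψ 0 = 0 := by
  rw [nlPairing, integral_eq_zero_of_ae]
  filter_upwards [Lp.coeFn_zero ℂ 2 (volume : Measure (Space d))] with x hx
  rw [hx]; simp [nonlin]

lemma nlPairing_add (hd : 1 ≤ d) {μ : ℝ} (hμ : |μ| = 1) {ψ χ f : L2 d} (hψ : normQ ψ ≠ ⊤)
    (hχ : normQ χ ≠ ⊤) (hf : normQ f ≠ ⊤) :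
    nlPairing μ (ψ + χ) f = nlPairing μ ψ f + nlPairing μ χ f := by
  rw [nlPairing, nlPairing, nlPairing, ← integral_add (integrable_nlPairing hd hμ hψ hf)
    (integrable_nlPairing hd hμ hχ hf)]
  refine integral_congr_ae ?_
  filter_upwards [Lp.coeFn_add ψ χ] with x hx
  rw [hx, Pi.add_apply, star_add, add_mul]

lemma nlPairing_smul (μ : ℝ) (c : ℂ) (ψ f : L2 d) :
    nlPairing μ (c • ψ) f = star c * nlPairing μ ψ f := by
  rw [nlPairing, nlPairing, ← integral_const_mul]
  refine integral_congr_ae ?_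
  filter_upwards [Lp.coeFn_smul c ψ] with x hx
  rw [hx, Pi.smul_apply, smul_eq_mul, star_mul, mul_assoc, mul_left_comm]

/-- The pairing with the nonlinearity is the limit of the pairings with its truncations. -/
lemma tendsto_inner_truncL2 (hd : 1 ≤ d) {μ : ℝ} (hμ : |μ| = 1) {ψ f : L2 d} (hψ : normQ ψ ≠ ⊤)
    (hf : normQ f ≠ ⊤) :
    Tendsto (fun n => μ * (inner ℂ ψ (truncL2 n f) : ℂ)) atTop (𝓝 (nlPairing μ ψ f)) := by
  have e : ∀ n, (μ : ℂ) * (inner ℂ ψ (truncL2 n f) : ℂ)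
      = ∫ x, star (ψ x) * (μ * truncPow (4 / d) n (f x)) := fun n => by
    rw [L2.inner_def, ← integral_const_mul]
    refine integral_congr_ae ?_
    filter_upwards [truncL2_ae n f] with x hx
    rw [hx, RCLike.inner_apply]
    change _ = (starRingEnd ℂ) (ψ x) * _
    ring
  simp only [e]
  refine tendsto_integral_of_dominated_convergence
    (fun x => ‖star (ψ x) * nonlin d μ (f x)‖) (fun n => ?_)
    (integrable_nlPairing hd hμ hψ hf).norm (fun n => Eventually.of_forall fun x => ?_)
    (Eventually.of_forall fun x => ?_)
  · exact (Lp.aestronglyMeasurable ψ).star.mul (((lipschitzWith_truncPow (four_div_nonneg d)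
      (Nat.cast_nonneg n)).continuous.comp_aestronglyMeasurable
        (Lp.aestronglyMeasurable f)).const_mul _)
  · rw [norm_mul, norm_mul, norm_mul, norm_nonlin hμ, norm_truncPow (Nat.cast_nonneg n),
      Complex.norm_real, Real.norm_eq_abs, hμ, one_mul]
    gcongr
    exact min_le_left _ _
  · refine tendsto_const_nhds.congr' ?_
    obtain ⟨n0, hn0⟩ := exists_nat_ge ‖f x‖
    filter_upwards [eventually_ge_atTop n0] with n hn
    rw [nonlin_eq_truncPow μ (hn0.trans (by exact_mod_cast hn : (n0 : ℝ) ≤ n))]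

/-! ### The Duhamel integral -/

/-- The norm of `L^q_{t,x}(J × ℝ^d)`. -/
def stNorm (J : Set ℝ) (u : ℝ → L2 d) : ENNReal :=
  (∫⁻ t in J, normQ (u t) ^ qE d) ^ (1 / qE d)

lemma stNorm_rpow (hd : 1 ≤ d) (J : Set ℝ) (u : ℝ → L2 d) :
    stNorm J u ^ qE d = ∫⁻ t in J, normQ (u t) ^ qE d := by
  rw [stNorm, ← ENNReal.rpow_mul, one_div, inv_mul_cancel₀ (qE_pos hd).ne', ENNReal.rpow_one]

lemma stNorm_mono (hd : 1 ≤ d) {J K : Set ℝ} (h : J ⊆ K) (u : ℝ → L2 d) :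
    stNorm J u ≤ stNorm K u :=
  ENNReal.rpow_le_rpow (lintegral_mono_set h) (by have := qE_pos hd; positivity)

lemma stNorm_congr {J : Set ℝ} (hJ : MeasurableSet J) {u v : ℝ → L2 d} (h : EqOn u v J) :
    stNorm J u = stNorm J v := by
  rw [stNorm, stNorm, setLIntegral_congr_fun hJ fun t ht => by rw [h ht]]

lemma stNorm_add_le (hd : 1 ≤ d) {J : Set ℝ} (hJ : MeasurableSet J) {u v : ℝ → L2 d}
    (hu : ContinuousOn u J) (hv : ContinuousOn v J) :
    stNorm J (fun t => u t + v t) ≤ stNorm J u + stNorm J v := by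
  have hq := two_lt_qE hd
  refine le_trans (ENNReal.rpow_le_rpow (lintegral_mono fun t =>
    ENNReal.rpow_le_rpow (normQ_add_le hd _ _) (by linarith)) (by positivity)) ?_
  exact ENNReal.lintegral_Lp_add_le (aemeasurable_normQ hd hJ hu) (aemeasurable_normQ hd hJ hv)
    (by linarith)

lemma stNorm_smul (hd : 1 ≤ d) {c : ℂ} (hc : ‖c‖ = 1) (J : Set ℝ) (u : ℝ → L2 d) :
    stNorm J (fun t => c • u t) = stNorm J u := by
  have : ‖c‖ₑ = 1 := by rw [← ofReal_norm, hc]; simp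
  simp only [stNorm, normQ_smul c _ hd, this, one_mul]

lemma stNorm_freeProp_le (hd : 1 ≤ d) (J : Set ℝ) (f : L2 d) :
    stNorm J (fun t => freeProp t f) ≤ strConst d * ‖f‖ₑ :=
  (ENNReal.rpow_le_rpow (setLIntegral_le_lintegral _ _) (by have := qE_pos hd; positivity)).trans
    (strichartz hd f)

lemma stNorm_ae_ne_top (hd : 1 ≤ d) {J : Set ℝ} (hJ : MeasurableSet J) {u : ℝ → L2 d}
    (hu : ContinuousOn u J) (h : stNorm J u ≠ ⊤) :
    ∀ᵐ t ∂(volume.restrict J), normQ (u t) ≠ ⊤ := by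
  have hq := qE_pos hd
  have h1 : ∫⁻ t in J, normQ (u t) ^ qE d ≠ ⊤ := by
    rw [← stNorm_rpow hd]; exact ENNReal.rpow_ne_top_of_nonneg hq.le h
  filter_upwards [ae_lt_top' ((aemeasurable_normQ hd hJ hu).pow_const _) h1] with t ht
  intro h2
  rw [h2, ENNReal.top_rpow_of_pos hq] at ht
  exact lt_irrefl _ ht

lemma ae_normQ_freeProp_ne_top (hd : 1 ≤ d) (J : Set ℝ) (f : L2 d) :
    ∀ᵐ t ∂(volume.restrict J), normQ (freeProp t f) ≠ ⊤ := by
  have h := stNorm_ae_ne_top hd MeasurableSet.univ (continuous_freeProp f).continuousOn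
    (ne_top_of_le_ne_top (ENNReal.mul_ne_top (strConst_ne_top hd) enorm_ne_top)
      (stNorm_freeProp_le hd univ f))
  rw [Measure.restrict_univ] at h
  exact ae_restrict_of_ae h

/-- The `L^p` norm in time of the bound for `F(u) - F(v)`. -/
def stDiff (J : Set ℝ) (u v : ℝ → L2 d) : ENNReal :=
  (∫⁻ t in J, diffBound (u t) (v t) ^ pE d) ^ (1 / pE d)

lemma aemeasurable_diffBound (hd : 1 ≤ d) {J : Set ℝ} (hJ : MeasurableSet J) {u v : ℝ → L2 d}
    (hu : ContinuousOn u J) (hv : ContinuousOn v J) :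
    AEMeasurable (fun t => diffBound (u t) (v t)) (volume.restrict J) := by
  have h1 := aemeasurable_normQ hd hJ hu
  have h2 := aemeasurable_normQ hd hJ hv
  have h3 := aemeasurable_normQ hd hJ (hu.sub hv)
  exact (((h1.pow_const _).mul h3).add ((h2.pow_const _).mul h3)).const_mul _

/-- Hölder's inequality for the exponents `(4/d)/q + 1/q = 1/p`. -/
lemma rpow_lintegral_mul_le (hd : 1 ≤ d) {X : Type*} [MeasurableSpace X] {ν : Measure X}
    {f g : X → ENNReal} (hf : AEMeasurable f ν) (hg : AEMeasurable g ν) :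
    (∫⁻ x, (f x ^ (4 / d : ℝ) * g x) ^ pE d ∂ν) ^ (1 / pE d) ≤
      ((∫⁻ x, f x ^ qE d ∂ν) ^ (1 / qE d)) ^ (4 / d : ℝ) * (∫⁻ x, g x ^ qE d ∂ν) ^ (1 / qE d) := by
  have hpq := holder_pE_qE hd
  have hp0 := hpq.pos
  have hq0 := qE_pos hd
  have ha := four_div_nonneg d
  have hq := qE_eq hd
  have hrel : pE d * qE d = pE d + qE d := hpq.mul_eq_add
  have hsum : (4 / d : ℝ) * pE d / qE d + pE d / qE d = 1 := by
    rw [← add_div, div_eq_one_iff_eq hq0.ne']; nlinarith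
  have h := ENNReal.lintegral_mul_norm_pow_le (hf.pow_const (qE d)) (hg.pow_const (qE d))
    (p := (4 / d : ℝ) * pE d / qE d) (q := pE d / qE d) (by positivity) (by positivity) hsum
  have e : ∀ (c : ENNReal) (r : ℝ), (c ^ qE d) ^ (r / qE d) = c ^ r := fun c r => by
    rw [← ENNReal.rpow_mul]; congr 1; field_simp
  simp only [e] at h
  have e2 : ∀ x, (f x ^ (4 / d : ℝ) * g x) ^ pE d = f x ^ ((4 / d : ℝ) * pE d) * g x ^ pE d :=
    fun x => by rw [ENNReal.mul_rpow_of_nonneg _ _ hp0.le, ← ENNReal.rpow_mul]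
  simp only [e2]
  refine (ENNReal.rpow_le_rpow h (by positivity)).trans (le_of_eq ?_)
  rw [ENNReal.mul_rpow_of_nonneg _ _ (by positivity), ← ENNReal.rpow_mul, ← ENNReal.rpow_mul,
    ← ENNReal.rpow_mul]
  congr 2 <;> field_simp

lemma stDiff_le (hd : 1 ≤ d) {J : Set ℝ} (hJ : MeasurableSet J) {u v : ℝ → L2 d}
    (hu : ContinuousOn u J) (hv : ContinuousOn v J) :
    stDiff J u v ≤ nlConst d * (stNorm J u ^ (4 / d : ℝ) + stNorm J v ^ (4 / d : ℝ))
      * stNorm J (fun t => u t - v t) := by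
  have hpq := holder_pE_qE hd
  have hp0 := hpq.pos
  have h1 := aemeasurable_normQ hd hJ hu
  have h2 := aemeasurable_normQ hd hJ hv
  have h3 := aemeasurable_normQ hd hJ (hu.sub hv)
  have hc : nlConst d ≠ ⊤ := ENNReal.ofReal_ne_top
  have e : stDiff J u v = nlConst d * (∫⁻ t in J, ((fun t => normQ (u t) ^ (4 / d : ℝ)
      * normQ (u t - v t)) + fun t => normQ (v t) ^ (4 / d : ℝ) * normQ (u t - v t)) t ^ pE d)
        ^ (1 / pE d) := by
    simp only [stDiff, diffBound, Pi.add_apply, ENNReal.mul_rpow_of_nonneg (nlConst d) _ hp0.le]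
    rw [lintegral_const_mul' _ _ (ENNReal.rpow_ne_top_of_nonneg hp0.le hc),
      ENNReal.mul_rpow_of_nonneg _ _ (by positivity), ← ENNReal.rpow_mul,
      mul_one_div_cancel hp0.ne', ENNReal.rpow_one]
  rw [e, mul_assoc, add_mul]
  refine mul_le_mul_right ((ENNReal.lintegral_Lp_add_le ((h1.pow_const _).mul h3)
    ((h2.pow_const _).mul h3) hpq.lt.le).trans (add_le_add ?_ ?_)) _
  · exact rpow_lintegral_mul_le hd h1 h3
  · exact rpow_lintegral_mul_le hd h2 h3

lemma stNorm_zero (hd : 1 ≤ d) (J : Set ℝ) : stNorm J (fun _ => (0 : L2 d)) = 0 := by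
  have hq := qE_pos hd
  simp [stNorm, normQ_zero hd, hq]

lemma stDiff_zero_le (hd : 1 ≤ d) {J : Set ℝ} (hJ : MeasurableSet J) {u : ℝ → L2 d}
    (hu : ContinuousOn u J) :
    stDiff J u (fun _ => 0) ≤ nlConst d * stNorm J u ^ (4 / d : ℝ) * stNorm J u := by
  have h := stDiff_le hd hJ hu (continuousOn_const (c := (0 : L2 d)))
  have := cast_pos_of_one_le hd
  rw [stNorm_zero hd, ENNReal.zero_rpow_of_pos (by positivity), add_zero] at h
  simpa using h

lemma stDiff_zero_ne_top (hd : 1 ≤ d) {J : Set ℝ} (hJ : MeasurableSet J) {u : ℝ → L2 d}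
    (hu : ContinuousOn u J) (h : stNorm J u ≠ ⊤) : stDiff J u (fun _ => 0) ≠ ⊤ :=
  ne_top_of_le_ne_top (ENNReal.mul_ne_top (ENNReal.mul_ne_top ENNReal.ofReal_ne_top
    (ENNReal.rpow_ne_top_of_nonneg (four_div_nonneg d) h)) h) (stDiff_zero_le hd hJ hu)

lemma aestronglyMeasurable_nlPairing (hd : 1 ≤ d) {μ : ℝ} (hμ : |μ| = 1) {J : Set ℝ}
    (hJ : MeasurableSet J) {u : ℝ → L2 d} (hu : ContinuousOn u J) (h : stNorm J u ≠ ⊤) (φ : L2 d) :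
    AEStronglyMeasurable (fun s => nlPairing μ (freeProp s φ) (u s)) (volume.restrict J) := by
  refine aestronglyMeasurable_of_tendsto_ae atTop
    (f := fun (n : ℕ) s => (μ : ℂ) * inner ℂ (freeProp s φ) (truncL2 n (u s))) (fun n => ?_) ?_
  · refine ContinuousOn.aestronglyMeasurable ?_ hJ
    refine continuousOn_const.mul ?_
    exact (continuous_freeProp φ).continuousOn.inner ((continuous_truncL2 n).comp_continuousOn hu)
  · filter_upwards [stNorm_ae_ne_top hd hJ hu h, ae_normQ_freeProp_ne_top hd J φ] with s h1 h2
    exact tendsto_inner_truncL2 hd hμ h2 h1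

lemma lintegral_normQ_mul_diffBound_le (hd : 1 ≤ d) {J : Set ℝ} (hJ : MeasurableSet J)
    {u v : ℝ → L2 d} (hu : ContinuousOn u J) (hv : ContinuousOn v J) (φ : L2 d) :
    ∫⁻ s in J, normQ (freeProp s φ) * diffBound (u s) (v s)
      ≤ strConst d * ‖φ‖ₑ * stDiff J u v := by
  refine (ENNReal.lintegral_mul_le_Lp_mul_Lq _ (holder_pE_qE hd).symm
    (aemeasurable_normQ hd hJ (continuous_freeProp φ).continuousOn)
    (aemeasurable_diffBound hd hJ hu hv)).trans ?_
  exact mul_le_mul_left (stNorm_freeProp_le hd J φ) _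

lemma integrableOn_nlPairing (hd : 1 ≤ d) {μ : ℝ} (hμ : |μ| = 1) {J : Set ℝ}
    (hJ : MeasurableSet J) {u : ℝ → L2 d} (hu : ContinuousOn u J) (h : stNorm J u ≠ ⊤) (φ : L2 d) :
    IntegrableOn (fun s => nlPairing μ (freeProp s φ) (u s)) J volume := by
  refine ⟨aestronglyMeasurable_nlPairing hd hμ hJ hu h φ, ?_⟩
  refine lt_of_le_of_lt (b := ∫⁻ s in J, normQ (freeProp s φ) * diffBound (u s) 0)
    (lintegral_mono_ae ?_) ?_
  · filter_upwards [stNorm_ae_ne_top hd hJ hu h, ae_normQ_freeProp_ne_top hd J φ] with s h1 h2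
    have := enorm_nlPairing_sub_le hd hμ h2 h1 (g := 0) (by rw [normQ_zero hd]; simp)
    rwa [nlPairing_zero_right, sub_zero] at this
  · refine (lintegral_normQ_mul_diffBound_le hd hJ hu continuousOn_const φ).trans_lt ?_
    exact (ENNReal.mul_ne_top (ENNReal.mul_ne_top (strConst_ne_top hd) enorm_ne_top)
      (stDiff_zero_ne_top hd hJ hu h)).lt_top

/-- Bound for the difference of two Duhamel pairings. -/
lemma lintegral_nlPairing_sub_le (hd : 1 ≤ d) {μ : ℝ} (hμ : |μ| = 1) {J : Set ℝ}
    (hJ : MeasurableSet J) {u v : ℝ → L2 d} (hu : ContinuousOn u J) (hv : ContinuousOn v J)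
    (hus : stNorm J u ≠ ⊤) (hvs : stNorm J v ≠ ⊤) (φ : L2 d) :
    ‖(∫ s in J, nlPairing μ (freeProp s φ) (u s)) - ∫ s in J, nlPairing μ (freeProp s φ) (v s)‖ₑ
      ≤ ∫⁻ s in J, normQ (freeProp s φ) * diffBound (u s) (v s) := by
  rw [← integral_sub (integrableOn_nlPairing hd hμ hJ hu hus φ)
    (integrableOn_nlPairing hd hμ hJ hv hvs φ)]
  refine (enorm_integral_le_lintegral_enorm _).trans (lintegral_mono_ae ?_)
  filter_upwards [stNorm_ae_ne_top hd hJ hu hus, stNorm_ae_ne_top hd hJ hv hvs,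
    ae_normQ_freeProp_ne_top hd J φ] with s h1 h2 h3
  exact enorm_nlPairing_sub_le hd hμ h3 h1 h2

/-- `W = ∫_a^b e^{-isΔ} F(u(s)) ds`, in the weak sense. -/
def IsDuhamel (μ : ℝ) (u : ℝ → L2 d) (a b : ℝ) (W : L2 d) : Prop :=
  ∀ φ : L2 d, inner ℂ φ W = ∫ s in a..b, nlPairing μ (freeProp s φ) (u s)

lemma IsDuhamel.unique {μ : ℝ} {u : ℝ → L2 d} {a b : ℝ} {W W' : L2 d} (h : IsDuhamel μ u a b W)
    (h' : IsDuhamel μ u a b W') : W = W' :=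
  ext_inner_left ℂ fun φ => by rw [h φ, h' φ]

lemma measurableSet_uIoc' {a b : ℝ} : MeasurableSet (uIoc a b) := measurableSet_Ioc

lemma intervalIntegrable_nlPairing (hd : 1 ≤ d) {μ : ℝ} (hμ : |μ| = 1) {a b : ℝ}
    {u : ℝ → L2 d} (hu : ContinuousOn u (uIoc a b)) (h : stNorm (uIoc a b) u ≠ ⊤) (φ : L2 d) :
    IntervalIntegrable (fun s => nlPairing μ (freeProp s φ) (u s)) volume a b :=
  intervalIntegrable_iff.2 (integrableOn_nlPairing hd hμ measurableSet_uIoc' hu h φ)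

/-- The Duhamel integral exists in `L²`, by the Riesz representation theorem and the Strichartz
estimate for the test functions. -/
lemma exists_isDuhamel (hd : 1 ≤ d) {μ : ℝ} (hμ : |μ| = 1) {a b : ℝ} {u : ℝ → L2 d}
    (hu : ContinuousOn u (uIoc a b)) (h : stNorm (uIoc a b) u ≠ ⊤) :
    ∃ W, IsDuhamel μ u a b W := by
  set J := uIoc a b with hJdef
  have hJ : MeasurableSet J := measurableSet_uIoc'
  have hint := intervalIntegrable_nlPairing hd hμ hu h
  set Λ : L2 d → ℂ := fun φ => ∫ s in a..b, nlPairing μ (freeProp s φ) (u s) with hΛ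
  have hadd : ∀ φ ψ, Λ (φ + ψ) = Λ φ + Λ ψ := by
    intro φ ψ
    simp only [hΛ]
    rw [← intervalIntegral.integral_add (hint φ) (hint ψ)]
    refine intervalIntegral.integral_congr_ae ((ae_restrict_iff' hJ).1 ?_)
    filter_upwards [stNorm_ae_ne_top hd hJ hu h, ae_normQ_freeProp_ne_top hd J φ,
      ae_normQ_freeProp_ne_top hd J ψ] with s h1 h2 h3
    rw [freeProp_add, nlPairing_add hd hμ h2 h3 h1]
  have hsmul : ∀ (c : ℂ) φ, Λ (c • φ) = star c * Λ φ := by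
    intro c φ
    simp only [hΛ, freeProp_smul, nlPairing_smul, intervalIntegral.integral_const_mul]
  set C := strConst d * stDiff J u (fun _ => 0) with hC
  have hCt : C ≠ ⊤ := ENNReal.mul_ne_top (strConst_ne_top hd) (stDiff_zero_ne_top hd hJ hu h)
  have hbd : ∀ φ, ‖Λ φ‖ ≤ C.toReal * ‖φ‖ := by
    intro φ
    have h1 : ‖Λ φ‖ₑ ≤ C * ‖φ‖ₑ := by
      have h2 := lintegral_nlPairing_sub_le hd hμ hJ hu (continuousOn_const (c := (0 : L2 d))) h
        (by rw [stNorm_zero hd]; simp) φ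
      simp only [nlPairing_zero_right, integral_zero, sub_zero] at h2
      have h3 : ‖Λ φ‖ₑ = ‖∫ s in J, nlPairing μ (freeProp s φ) (u s)‖ₑ := by
        rw [← ofReal_norm, ← ofReal_norm, hΛ, intervalIntegral.norm_intervalIntegral_eq]
      rw [h3]
      refine h2.trans ((lintegral_normQ_mul_diffBound_le hd hJ hu continuousOn_const φ).trans ?_)
      exact le_of_eq (by rw [hC]; ring)
    have h4 := ENNReal.toReal_mono (ENNReal.mul_ne_top hCt enorm_ne_top) h1
    rwa [ENNReal.toReal_mul, toReal_enorm, toReal_enorm] at h4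
  let ℓ : L2 d →ₗ[ℂ] ℂ :=
    { toFun := fun φ => star (Λ φ)
      map_add' := fun φ ψ => by rw [hadd, star_add]
      map_smul' := fun c φ => by rw [hsmul, star_mul, star_star, mul_comm]; rfl }
  let L : L2 d →L[ℂ] ℂ := ℓ.mkContinuous C.toReal fun φ => by
    change ‖star (Λ φ)‖ ≤ _
    rw [norm_star]; exact hbd φ
  refine ⟨(InnerProductSpace.toDual ℂ (L2 d)).symm L, fun φ => ?_⟩
  rw [← inner_conj_symm, InnerProductSpace.toDual_symm_apply]
  change (starRingEnd ℂ) (star (Λ φ)) = Λ φ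
  exact star_star (Λ φ)

/-- The element `∫_a^b e^{-isΔ} F(u(s)) ds` of `L²`, arbitrary if there is none. -/
def duh (μ : ℝ) (u : ℝ → L2 d) (a b : ℝ) : L2 d := Classical.epsilon (IsDuhamel μ u a b)

lemma isDuhamel_duh (hd : 1 ≤ d) {μ : ℝ} (hμ : |μ| = 1) {a b : ℝ} {u : ℝ → L2 d}
    (hu : ContinuousOn u (uIoc a b)) (h : stNorm (uIoc a b) u ≠ ⊤) :
    IsDuhamel μ u a b (duh μ u a b) :=
  Classical.epsilon_spec (exists_isDuhamel hd hμ hu h)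

lemma isDuhamel_self (μ : ℝ) (u : ℝ → L2 d) (a : ℝ) : IsDuhamel μ u a a 0 := fun φ => by simp

lemma duh_self (μ : ℝ) (u : ℝ → L2 d) (a : ℝ) : duh μ u a a = 0 := by
  have hex : ∃ W, IsDuhamel μ u a a W := ⟨0, isDuhamel_self μ u a⟩
  exact (Classical.epsilon_spec hex).unique (isDuhamel_self μ u a)

lemma duh_congr {μ : ℝ} {u v : ℝ → L2 d} {a b : ℝ} (h : EqOn u v (uIoc a b)) :
    duh μ u a b = duh μ v a b := by
  have : IsDuhamel μ u a b = IsDuhamel μ v a b := by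
    funext W
    refine forall_congr fun φ => ?_
    rw [intervalIntegral.integral_congr_ae (g := fun s => nlPairing μ (freeProp s φ) (v s))]
    exact Eventually.of_forall fun s hs => by rw [h hs]
  rw [duh, duh, this]

/-- Two Duhamel integrals over consecutive intervals add up, in any order of the end points. -/
lemma duh_add (hd : 1 ≤ d) {μ : ℝ} (hμ : |μ| = 1) {I : Set ℝ} (hI : I.OrdConnected) {u : ℝ → L2 d}
    (hu : ContinuousOn u I) (hs : ∀ a ∈ I, ∀ b ∈ I, stNorm (uIcc a b) u ≠ ⊤) {a b c : ℝ}
    (ha : a ∈ I) (hb : b ∈ I) (hc : c ∈ I) : duh μ u a b + duh μ u b c = duh μ u a c := by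
  have hsub : ∀ a ∈ I, ∀ b ∈ I, uIoc a b ⊆ I := fun a ha b hb =>
    uIoc_subset_uIcc.trans (hI.uIcc_subset ha hb)
  have hs' : ∀ a ∈ I, ∀ b ∈ I, stNorm (uIoc a b) u ≠ ⊤ := fun a ha b hb =>
    ne_top_of_le_ne_top (hs a ha b hb) (stNorm_mono hd uIoc_subset_uIcc u)
  have hD := fun a ha b hb => isDuhamel_duh hd hμ (hu.mono (hsub a ha b hb)) (hs' a ha b hb)
  have hi := fun a ha b hb => intervalIntegrable_nlPairing hd hμ (hu.mono (hsub a ha b hb))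
    (hs' a ha b hb)
  refine ext_inner_left ℂ fun φ => ?_
  rw [inner_add_right, hD a ha b hb φ, hD b hb c hc φ, hD a ha c hc φ,
    intervalIntegral.integral_add_adjacent_intervals (hi a ha b hb φ) (hi b hb c hc φ)]

lemma enorm_inner_duh_sub_le (hd : 1 ≤ d) {μ : ℝ} (hμ : |μ| = 1) {a b : ℝ} {u v : ℝ → L2 d}
    (hu : ContinuousOn u (uIoc a b)) (hv : ContinuousOn v (uIoc a b))
    (hus : stNorm (uIoc a b) u ≠ ⊤) (hvs : stNorm (uIoc a b) v ≠ ⊤) (φ : L2 d) :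
    ‖(inner ℂ φ (duh μ u a b - duh μ v a b) : ℂ)‖ₑ ≤
      ∫⁻ s in uIoc a b, normQ (freeProp s φ) * diffBound (u s) (v s) := by
  refine le_trans (le_of_eq ?_)
    (lintegral_nlPairing_sub_le hd hμ measurableSet_uIoc' hu hv hus hvs φ)
  have hi := intervalIntegrable_nlPairing hd hμ hu hus φ
  have hj := intervalIntegrable_nlPairing hd hμ hv hvs φ
  rw [inner_sub_right, isDuhamel_duh hd hμ hu hus φ, isDuhamel_duh hd hμ hv hvs φ,
    ← intervalIntegral.integral_sub hi hj, ← ofReal_norm,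
    intervalIntegral.norm_intervalIntegral_eq, ofReal_norm,
    integral_sub (intervalIntegrable_iff.1 hi) (intervalIntegrable_iff.1 hj)]

/-- The inhomogeneous Strichartz estimate in `L²`. -/
lemma enorm_duh_sub_le (hd : 1 ≤ d) {μ : ℝ} (hμ : |μ| = 1) {a b : ℝ} {u v : ℝ → L2 d}
    (hu : ContinuousOn u (uIoc a b)) (hv : ContinuousOn v (uIoc a b))
    (hus : stNorm (uIoc a b) u ≠ ⊤) (hvs : stNorm (uIoc a b) v ≠ ⊤) :
    ‖duh μ u a b - duh μ v a b‖ₑ ≤ strConst d * stDiff (uIoc a b) u v := by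
  set W := duh μ u a b - duh μ v a b
  have h := (enorm_inner_duh_sub_le hd hμ hu hv hus hvs W).trans
    (lintegral_normQ_mul_diffBound_le hd measurableSet_uIoc' hu hv W)
  rcases eq_or_ne W 0 with h0 | h0
  · rw [h0]; simp
  have e : ‖(inner ℂ W W : ℂ)‖ₑ = ‖W‖ₑ * ‖W‖ₑ := by
    rw [inner_self_eq_norm_sq_to_K, enorm_pow, pow_two]
    simp [← ofReal_norm]
  rw [e, mul_right_comm] at h
  exact (ENNReal.mul_le_mul_iff_left (by simpa using h0) enorm_ne_top).1 h

/-- Pointwise in time bound for the Duhamel integral, by decay of the propagator and duality. -/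
lemma normQ_freeProp_duh_sub_le (hd : 1 ≤ d) {μ : ℝ} (hμ : |μ| = 1) {a b : ℝ} {u v : ℝ → L2 d}
    (hu : ContinuousOn u (uIoc a b)) (hv : ContinuousOn v (uIoc a b))
    (hus : stNorm (uIoc a b) u ≠ ⊤) (hvs : stNorm (uIoc a b) v ≠ ⊤) (t : ℝ) :
    normQ (freeProp t (duh μ u a b - duh μ v a b)) ≤
      decayConst d * ∫⁻ s in uIoc a b, diffBound (u s) (v s) * rieszKernel (2 / qE d) (t - s) := by
  refine normQ_le_of_inner hd fun φ => ?_
  have e : (inner ℂ φ (freeProp t (duh μ u a b - duh μ v a b)) : ℂ)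
      = inner ℂ (freeProp (-t) φ) (duh μ u a b - duh μ v a b) := by
    rw [inner_freeProp_left, neg_neg]
  have hJ : MeasurableSet (uIoc a b) := measurableSet_uIoc'
  have hK : Measurable fun s => rieszKernel (2 / qE d) (t - s) :=
    (measurable_rieszKernel _).comp (by fun_prop)
  have hm := (aemeasurable_diffBound hd hJ hu hv).mul hK.aemeasurable
  rw [e]
  refine (enorm_inner_duh_sub_le hd hμ hu hv hus hvs _).trans ?_
  calc _ ≤ ∫⁻ s in uIoc a b, (decayConst d * normP φ) *
        (diffBound (u s) (v s) * rieszKernel (2 / qE d) (t - s)) := by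
        refine lintegral_mono_ae ?_
        have : ∀ᵐ s ∂(volume.restrict (uIoc a b)), s ≠ t :=
          ae_restrict_of_ae (by simp [ae_iff])
        filter_upwards [this] with s hs
        rw [freeProp_freeProp]
        refine (mul_le_mul_left (normQ_freeProp_le hd (t := s + -t)
          (by rw [← sub_eq_add_neg]; exact sub_ne_zero.2 hs) φ) _).trans (le_of_eq ?_)
        have : rieszKernel (2 / qE d) (s + -t) = rieszKernel (2 / qE d) (t - s) := by
          rw [rieszKernel, rieszKernel, ← sub_eq_add_neg, abs_sub_comm]
        rw [this]; ring
    _ = (decayConst d * normP φ) * ∫⁻ s in uIoc a b,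
        diffBound (u s) (v s) * rieszKernel (2 / qE d) (t - s) := lintegral_const_mul'' _ hm
    _ = _ := by ring

/-- The constant of the inhomogeneous Strichartz estimate. -/
def inhConst (d : ℕ) : ENNReal := decayConst d * (2 * hlsConst (qE d))

lemma inhConst_ne_top (hd : 1 ≤ d) : inhConst d ≠ ⊤ :=
  ENNReal.mul_ne_top (decayConst_ne_top d)
    (ENNReal.mul_ne_top (by norm_num) (hlsConst_ne_top (qE_pos hd)))

/-- The inhomogeneous Strichartz estimate in space-time. -/
lemma stNorm_duh_sub_le (hd : 1 ≤ d) {μ : ℝ} (hμ : |μ| = 1) {J : Set ℝ} (hJ : J.OrdConnected)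
    {u v : ℝ → L2 d} (hu : ContinuousOn u J) (hv : ContinuousOn v J) (hus : stNorm J u ≠ ⊤)
    (hvs : stNorm J v ≠ ⊤) {t₀ : ℝ} (ht₀ : t₀ ∈ J) :
    stNorm J (fun t => freeProp t (duh μ u t₀ t - duh μ v t₀ t)) ≤ inhConst d * stDiff J u v := by
  have hJm := hJ.measurableSet
  have hpq := holder_pE_qE hd
  have hq := two_lt_qE hd
  obtain ⟨h, hhm, hhe⟩ := aemeasurable_diffBound hd hJm hu hv
  set h' := J.indicator h with hh'
  have hpt : ∀ t ∈ J, normQ (freeProp t (duh μ u t₀ t - duh μ v t₀ t)) ≤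
      decayConst d * ∫⁻ s, h' s * rieszKernel (2 / qE d) (t - s) := by
    intro t ht
    have hsub : uIoc t₀ t ⊆ J := uIoc_subset_uIcc.trans (hJ.uIcc_subset ht₀ ht)
    refine (normQ_freeProp_duh_sub_le hd hμ (hu.mono hsub) (hv.mono hsub)
      (ne_top_of_le_ne_top hus (stNorm_mono hd hsub u))
      (ne_top_of_le_ne_top hvs (stNorm_mono hd hsub v)) t).trans ?_
    refine mul_le_mul_right ?_ _
    refine (lintegral_mono_set hsub).trans (le_of_eq ?_)
    rw [← lintegral_indicator hJm]
    refine lintegral_congr_ae ?_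
    filter_upwards [(ae_restrict_iff' hJm).1 hhe] with s hs
    by_cases hsJ : s ∈ J
    · rw [indicator_of_mem hsJ, hh', indicator_of_mem hsJ, hs hsJ]
    · simp [hh', hsJ]
  have e : ∫⁻ s, h' s ^ pE d = ∫⁻ s in J, diffBound (u s) (v s) ^ pE d := by
    rw [← lintegral_indicator hJm]
    refine lintegral_congr_ae ?_
    filter_upwards [(ae_restrict_iff' hJm).1 hhe] with s hs
    by_cases hsJ : s ∈ J
    · rw [indicator_of_mem hsJ, hh', indicator_of_mem hsJ, hs hsJ]
    · simp [hh', hsJ, hpq.pos]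
  have hmain := hls hpq hq (hhm.indicator hJm)
  change (∫⁻ t, (∫⁻ s, h' s * _) ^ _) ^ _ ≤ 2 * hlsConst (qE d) * (∫⁻ s, h' s ^ pE d) ^ _ at hmain
  rw [e] at hmain
  calc stNorm J _ ≤ (∫⁻ t, (decayConst d * ∫⁻ s, h' s * rieszKernel (2 / qE d) (t - s)) ^ qE d)
        ^ (1 / qE d) := by
        refine ENNReal.rpow_le_rpow ?_ (by positivity)
        refine (setLIntegral_mono' hJm fun t ht =>
          ENNReal.rpow_le_rpow (hpt t ht) (by linarith)).trans (setLIntegral_le_lintegral _ _)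
    _ = decayConst d * (∫⁻ t, (∫⁻ s, h' s * rieszKernel (2 / qE d) (t - s)) ^ qE d)
        ^ (1 / qE d) := by
        simp only [ENNReal.mul_rpow_of_nonneg (decayConst d) _ (qE_pos hd).le]
        rw [lintegral_const_mul' _ _ (ENNReal.rpow_ne_top_of_nonneg (qE_pos hd).le
          (decayConst_ne_top d)), ENNReal.mul_rpow_of_nonneg _ _ (by positivity),
          ← ENNReal.rpow_mul, mul_one_div_cancel (qE_pos hd).ne', ENNReal.rpow_one]
    _ ≤ decayConst d * (2 * hlsConst (qE d) * stDiff J u v) := by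
        exact mul_le_mul_right hmain _
    _ = _ := by rw [inhConst]; ring

/-! ### The equation in the interaction picture -/

lemma schwartz_dense : DenseRange fun φ : 𝓢(Space d, ℂ) => (φ.toLp 2 volume : L2 d) :=
  SchwartzMap.denseRange_toLpCLM (E := Space d) (F := ℂ) (p := 2) (μ := volume) (by norm_num)

lemma eq_of_inner_schwartz {w w' : L2 d}
    (h : ∀ φ : 𝓢(Space d, ℂ), (inner ℂ (φ.toLp 2 volume : L2 d) w : ℂ)
      = inner ℂ (φ.toLp 2 volume : L2 d) w') : w = w' := by
  refine ext_inner_left ℂ fun ψ => ?_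
  have h1 : Continuous fun ψ : L2 d => (inner ℂ ψ w : ℂ) := continuous_id.inner continuous_const
  have h2 : Continuous fun ψ : L2 d => (inner ℂ ψ w' : ℂ) := continuous_id.inner continuous_const
  exact congrFun (schwartz_dense.equalizer h1 h2 (funext h)) ψ

lemma duhamelPairing_eq (μ : ℝ) (u : ℝ → L2 d) (t s : ℝ) (φ : 𝓢(Space d, ℂ)) :
    duhamelPairing μ u t s φ
      = nlPairing μ (freeProp s (freeProp (-t) (φ.toLp 2 volume))) (u s) := by
  rw [freeProp_freeProp]; rfl

lemma hasDuhamelIntegral_freeProp_duh (hd : 1 ≤ d) {μ : ℝ} (hμ : |μ| = 1) {a b : ℝ} {u : ℝ → L2 d}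
    (hu : ContinuousOn u (uIoc a b)) (h : stNorm (uIoc a b) u ≠ ⊤) (t : ℝ) :
    HasDuhamelIntegral μ u t a b (freeProp t (duh μ u a b)) := by
  intro φ
  refine ⟨?_, ?_, ?_⟩
  · filter_upwards [stNorm_ae_ne_top hd measurableSet_uIoc' hu h,
      ae_normQ_freeProp_ne_top hd (uIoc a b) (freeProp (-t) (φ.toLp 2 volume))] with s h1 h2
    rw [freeProp_freeProp, ← sub_eq_add_neg] at h2
    exact integrable_nlPairing hd hμ h2 h1
  · simp only [duhamelPairing_eq]
    exact intervalIntegrable_nlPairing hd hμ hu h _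
  · simp only [duhamelPairing_eq]
    rw [← isDuhamel_duh hd hμ hu h, inner_freeProp_left, neg_neg]

lemma HasDuhamelIntegral.eq_freeProp_duh (hd : 1 ≤ d) {μ : ℝ} (hμ : |μ| = 1) {a b : ℝ}
    {u : ℝ → L2 d} (hu : ContinuousOn u (uIoc a b)) (h : stNorm (uIoc a b) u ≠ ⊤) {t : ℝ} {w : L2 d}
    (hw : HasDuhamelIntegral μ u t a b w) : w = freeProp t (duh μ u a b) :=
  eq_of_inner_schwartz fun φ => by
    rw [(hw φ).2.2, (hasDuhamelIntegral_freeProp_duh hd hμ hu h t φ).2.2]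

/-- `u` solves the equation on `I` in the interaction picture, `e^{-itΔ} u(t)` being equal to `f`
at the time `T`. -/
structure Solves (μ : ℝ) (I : Set ℝ) (u : ℝ → L2 d) (T : ℝ) (f : L2 d) : Prop where
  ordConnected : I.OrdConnected
  mem : T ∈ I
  continuousOn : ContinuousOn u I
  stNorm_ne_top : ∀ a ∈ I, ∀ b ∈ I, stNorm (uIcc a b) u ≠ ⊤
  eq : ∀ t ∈ I, freeProp (-t) (u t) = f - Complex.I • duh μ u T t

lemma stNorm_uIoc_ne_top (hd : 1 ≤ d) {a b : ℝ} {u : ℝ → L2 d} (h : stNorm (uIcc a b) u ≠ ⊤) :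
    stNorm (uIoc a b) u ≠ ⊤ := ne_top_of_le_ne_top h (stNorm_mono hd uIoc_subset_uIcc u)

lemma uIoc_subset_of_mem {I : Set ℝ} (hI : I.OrdConnected) {a b : ℝ} (ha : a ∈ I) (hb : b ∈ I) :
    uIoc a b ⊆ I := uIoc_subset_uIcc.trans (hI.uIcc_subset ha hb)

lemma IsSolution.stNorm_ne_top (hd : 1 ≤ d) {μ : ℝ} {I : Set ℝ} {u : ℝ → L2 d}
    (hu : IsSolution μ I u) {a b : ℝ} (ha : a ∈ I) (hb : b ∈ I) : stNorm (uIcc a b) u ≠ ⊤ := by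
  have h : ∀ a ∈ I, ∀ b ∈ I, stNorm (Icc a b) u ≠ ⊤ := by
    intro a ha b hb
    have := hu.scattering_lt_top a ha b hb
    rw [stNorm]
    simp only [normQ_rpow hd]
    exact ENNReal.rpow_ne_top_of_nonneg (by have := qE_pos hd; positivity) this.ne
  rcases le_total a b with hab | hab
  · rw [uIcc_of_le hab]; exact h a ha b hb
  · rw [uIcc_of_ge hab]; exact h b hb a ha

lemma IsSolution.solves (hd : 1 ≤ d) {μ : ℝ} (hμ : |μ| = 1) {I : Set ℝ} {u : ℝ → L2 d}
    (hu : IsSolution μ I u) {T : ℝ} (hT : T ∈ I) : Solves μ I u T (freeProp (-T) (u T)) where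
  ordConnected := hu.ordConnected
  mem := hT
  continuousOn := hu.continuousOn
  stNorm_ne_top := fun _ ha _ hb => hu.stNorm_ne_top hd ha hb
  eq := fun t ht => by
    obtain ⟨w, hw, hut⟩ := hu.duhamel T hT t ht
    have := hw.eq_freeProp_duh hd hμ
      (hu.continuousOn.mono (uIoc_subset_of_mem hu.ordConnected hT ht))
      (stNorm_uIoc_ne_top hd (hu.stNorm_ne_top hd hT ht))
    rw [hut, freeProp_sub, freeProp_smul, this, freeProp_freeProp, freeProp_freeProp,
      neg_add_cancel, freeProp_zero]
    congr 2; ring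

lemma Solves.eq' {μ : ℝ} {I : Set ℝ} {u : ℝ → L2 d} {T : ℝ} {f : L2 d} (hu : Solves μ I u T f)
    {t : ℝ} (ht : t ∈ I) : u t = freeProp t (f - Complex.I • duh μ u T t) := by
  rw [← hu.eq t ht, freeProp_freeProp]; simp

lemma Solves.isSolution (hd : 1 ≤ d) {μ : ℝ} (hμ : |μ| = 1) {I : Set ℝ} {u : ℝ → L2 d}
    {T : ℝ} {f : L2 d} (hu : Solves μ I u T f) : IsSolution μ I u where
  nonempty := ⟨T, hu.mem⟩
  ordConnected := hu.ordConnected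
  continuousOn := hu.continuousOn
  scattering_lt_top := fun a ha b hb => by
    have h := ENNReal.rpow_ne_top_of_nonneg (qE_pos hd).le (hu.stNorm_ne_top a ha b hb)
    rw [stNorm_rpow hd] at h
    simp only [normQ_rpow hd] at h
    exact lt_of_le_of_lt (lintegral_mono_set Icc_subset_uIcc) h.lt_top
  duhamel := fun t₀ h₀ t₁ h₁ => by
    refine ⟨freeProp t₁ (duh μ u t₀ t₁), hasDuhamelIntegral_freeProp_duh hd hμ
      (hu.continuousOn.mono (uIoc_subset_of_mem hu.ordConnected h₀ h₁))
      (stNorm_uIoc_ne_top hd (hu.stNorm_ne_top t₀ h₀ t₁ h₁)) t₁, ?_⟩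
    have hadd := duh_add hd hμ hu.ordConnected hu.continuousOn hu.stNorm_ne_top hu.mem h₀ h₁
    rw [hu.eq' h₁, hu.eq' h₀, freeProp_freeProp, ← hadd, ← freeProp_smul, sub_add_cancel,
      ← freeProp_sub, smul_add, sub_sub]

lemma duh_zero (hd : 1 ≤ d) {μ : ℝ} (hμ : |μ| = 1) (a b : ℝ) :
    duh μ (fun _ => (0 : L2 d)) a b = 0 :=
  (isDuhamel_duh hd hμ continuousOn_const (by rw [stNorm_zero hd]; simp)).unique fun φ => by
    simp [nlPairing_zero_right]

lemma lintegral_diffBound_ne_top (hd : 1 ≤ d) {J : Set ℝ} (hJ : J.OrdConnected) {u : ℝ → L2 d}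
    (hu : ContinuousOn u J) (hs : stNorm J u ≠ ⊤) : ∫⁻ t in J, diffBound (u t) 0 ^ pE d ≠ ⊤ := by
  have hp0 := (holder_pE_qE hd).pos
  have := ENNReal.rpow_ne_top_of_nonneg hp0.le (stDiff_zero_ne_top hd hJ.measurableSet hu hs)
  rwa [stDiff, ← ENNReal.rpow_mul, one_div, inv_mul_cancel₀ hp0.ne', ENNReal.rpow_one] at this

lemma edist_duh_le (hd : 1 ≤ d) {μ : ℝ} (hμ : |μ| = 1) {J : Set ℝ} (hJ : J.OrdConnected)
    {u : ℝ → L2 d} (hu : ContinuousOn u J) (hs : stNorm J u ≠ ⊤) {T t t' : ℝ} (hT : T ∈ J)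
    (ht : t ∈ J) (ht' : t' ∈ J) {A : Set ℝ} (hA : uIoc t t' ⊆ A) :
    edist (duh μ u T t') (duh μ u T t) ≤ strConst d *
      (∫⁻ s in A, diffBound (u s) 0 ^ pE d ∂(volume.restrict J)) ^ (1 / pE d) := by
  have hp0 := (holder_pE_qE hd).pos
  have hs' : ∀ a ∈ J, ∀ b ∈ J, stNorm (uIcc a b) u ≠ ⊤ := fun a ha b hb =>
    ne_top_of_le_ne_top hs (stNorm_mono hd (hJ.uIcc_subset ha hb) u)
  have hadd := duh_add hd hμ hJ hu hs' hT ht ht'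
  rw [edist_eq_enorm_sub, ← hadd, add_sub_cancel_left]
  have hsub := uIoc_subset_of_mem hJ ht ht'
  have h3 := enorm_duh_sub_le hd hμ (hu.mono hsub) (continuousOn_const (c := (0 : L2 d)))
    (stNorm_uIoc_ne_top hd (hs' t ht t' ht')) (by rw [stNorm_zero hd]; simp)
  rw [duh_zero hd hμ, sub_zero] at h3
  refine h3.trans (mul_le_mul_right (ENNReal.rpow_le_rpow ?_ (by positivity)) _)
  rw [← inter_eq_left.2 hsub, ← Measure.restrict_restrict measurableSet_uIoc']
  exact lintegral_mono_set hA

/-- The Duhamel integral depends continuously on its end point. -/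
lemma continuousOn_duh (hd : 1 ≤ d) {μ : ℝ} (hμ : |μ| = 1) {J : Set ℝ} (hJ : J.OrdConnected)
    {u : ℝ → L2 d} (hu : ContinuousOn u J) (hs : stNorm J u ≠ ⊤) {T : ℝ} (hT : T ∈ J) :
    ContinuousOn (fun t => duh μ u T t) J := by
  have hp0 := (holder_pE_qE hd).pos
  have hfin := lintegral_diffBound_ne_top hd hJ hu hs
  intro t ht
  have hmeas : Tendsto (fun t' => (volume.restrict J) (uIoc t t')) (𝓝[J] t) (𝓝 0) := by
    have h1 : Tendsto (fun t' => ENNReal.ofReal |t' - t|) (𝓝[J] t) (𝓝 0) := by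
      have : Continuous fun t' => ENNReal.ofReal |t' - t| :=
        ENNReal.continuous_ofReal.comp (by fun_prop)
      have := (this.tendsto t).mono_left (nhdsWithin_le_nhds (s := J))
      simpa using this
    refine tendsto_of_tendsto_of_tendsto_of_le_of_le tendsto_const_nhds h1 (fun _ => zero_le)
      fun t' => ?_
    refine (Measure.restrict_apply_le _ _).trans (le_of_eq ?_)
    simp
  have h0 := tendsto_setLIntegral_zero hfin hmeas
  have h1 : Tendsto (fun t' => strConst d * (∫⁻ s in uIoc t t', diffBound (u s) 0 ^ pE d
      ∂(volume.restrict J)) ^ (1 / pE d)) (𝓝[J] t) (𝓝 0) := by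
    have h2 := (ENNReal.continuous_rpow_const (y := 1 / pE d)).tendsto 0 |>.comp h0
    rw [ENNReal.zero_rpow_of_pos (by positivity)] at h2
    have := ENNReal.Tendsto.const_mul h2 (Or.inr (strConst_ne_top hd))
    simpa using this
  change Tendsto _ _ _
  rw [tendsto_iff_edist_tendsto_0]
  refine tendsto_of_tendsto_of_tendsto_of_le_of_le' tendsto_const_nhds h1
    (Eventually.of_forall fun _ => zero_le) ?_
  filter_upwards [self_mem_nhdsWithin] with t' ht'
  exact edist_duh_le hd hμ hJ hu hs hT ht ht' subset_rfl

/-! ### Local existence -/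

/-- The space-time norm is lower semicontinuous with respect to pointwise convergence. -/
lemma stNorm_le_of_tendsto (hd : 1 ≤ d) {J : Set ℝ} (hJ : MeasurableSet J) {v : ℕ → ℝ → L2 d}
    {u : ℝ → L2 d} (hv : ∀ n, ContinuousOn (v n) J)
    (hlim : ∀ t ∈ J, Tendsto (fun n => v n t) atTop (𝓝 (u t))) {M : ENNReal}
    (hM : ∀ n, stNorm J (v n) ≤ M) : stNorm J u ≤ M := by
  have hq := qE_pos hd
  have h1 : ∫⁻ t in J, normQ (u t) ^ qE d ≤ M ^ qE d := by
    calc _ ≤ ∫⁻ t in J, liminf (fun n => normQ (v n t) ^ qE d) atTop := by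
          refine setLIntegral_mono' hJ fun t ht => ?_
          simp only [normQ_rpow hd]
          exact ((lowerSemicontinuous_lintegral_rpow hd).le_liminf (u t)).trans
            (liminf_le_liminf_of_le (hlim t ht))
      _ ≤ liminf (fun n => ∫⁻ t in J, normQ (v n t) ^ qE d) atTop :=
          lintegral_liminf_le' fun n => (aemeasurable_normQ hd hJ (hv n)).pow_const _
      _ ≤ M ^ qE d := by
          refine liminf_le_of_le (by isBoundedDefault) fun b hb => ?_
          obtain ⟨n, hn⟩ := hb.exists
          refine hn.trans ?_
          rw [← stNorm_rpow hd]
          exact ENNReal.rpow_le_rpow (hM n) hq.le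
  have h2 := ENNReal.rpow_le_rpow h1 (z := 1 / qE d) (by positivity)
  rwa [← ENNReal.rpow_mul, mul_one_div_cancel hq.ne', ENNReal.rpow_one] at h2

/-- `η` is so small that the Duhamel operator contracts the ball of radius `2η`. -/
def Small (d : ℕ) (η : ENNReal) : Prop :=
  inhConst d * (nlConst d * (2 * (2 * η) ^ (4 / d : ℝ))) ≤ 1 / 2

lemma exists_small (hd : 1 ≤ d) : ∃ η : ENNReal, η ≠ 0 ∧ η ≠ ⊤ ∧ Small d η := by
  have hd0 := cast_pos_of_one_le hd
  have h : Tendsto (fun η : ENNReal => inhConst d * (nlConst d * (2 * (2 * η) ^ (4 / d : ℝ))))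
      (𝓝[>] 0) (𝓝 0) := by
    have h1 : Tendsto (fun η : ENNReal => 2 * η) (𝓝[>] 0) (𝓝 0) := by
      have := ENNReal.Tendsto.const_mul (a := 2) (tendsto_id (α := ENNReal) (x := 𝓝 0))
        (Or.inr (by norm_num))
      simp only [mul_zero] at this
      exact this.mono_left nhdsWithin_le_nhds
    have h2 := ((ENNReal.continuous_rpow_const (y := (4 / d : ℝ))).tendsto 0).comp h1
    rw [ENNReal.zero_rpow_of_pos (by positivity)] at h2
    have h3 := ENNReal.Tendsto.const_mul (a := 2) h2 (Or.inr (by norm_num))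
    have h4 := ENNReal.Tendsto.const_mul (a := nlConst d) h3 (Or.inr ENNReal.ofReal_ne_top)
    have h5 := ENNReal.Tendsto.const_mul (a := inhConst d) h4 (Or.inr (inhConst_ne_top hd))
    simpa using h5
  have h1 := h.eventually (gt_mem_nhds (show (0 : ENNReal) < 1 / 2 by simp))
  have h2 : ∀ᶠ η : ENNReal in 𝓝[>] 0, η < ⊤ :=
    (eventually_lt_nhds (show (0 : ENNReal) < ⊤ by simp)).filter_mono nhdsWithin_le_nhds
  obtain ⟨η, h3, h4, h5⟩ := (h1.and (h2.and self_mem_nhdsWithin)).exists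
  exact ⟨η, (ne_of_gt h5), h4.ne, h3.le⟩

lemma two_mul_ne_top {η : ENNReal} (h : η ≠ ⊤) : 2 * η ≠ ⊤ := ENNReal.mul_ne_top (by norm_num) h

/-- The difference of the nonlinearities of two elements of the ball of radius `2η`. -/
lemma Small.stDiff_le (hd : 1 ≤ d) {η : ENNReal} {J : Set ℝ}
    (hJ : MeasurableSet J) {u v : ℝ → L2 d} (hu : ContinuousOn u J) (hv : ContinuousOn v J)
    (hus : stNorm J u ≤ 2 * η) (hvs : stNorm J v ≤ 2 * η) :
    stDiff J u v ≤ (nlConst d * (2 * (2 * η) ^ (4 / d : ℝ))) * stNorm J (fun t => u t - v t) := by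
  refine (NLS.stDiff_le hd hJ hu hv).trans ?_
  have ha := four_div_nonneg d
  refine mul_le_mul_left (mul_le_mul_right ?_ _) _
  rw [two_mul]
  gcongr

lemma Small.inh_le {η : ENNReal} (hη : Small d η) {X Y : ENNReal}
    (h : X ≤ (nlConst d * (2 * (2 * η) ^ (4 / d : ℝ))) * Y) : inhConst d * X ≤ 1 / 2 * Y := by
  refine (mul_le_mul_right h _).trans ?_
  rw [← mul_assoc]
  exact mul_le_mul_left hη _

/-- The Duhamel operator contracts the space-time norm on the ball of radius `2η`. -/
lemma picard_stNorm_le (hd : 1 ≤ d) {μ : ℝ} (hμ : |μ| = 1) {η : ENNReal} (hη : Small d η)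
    (hηt : η ≠ ⊤) {J : Set ℝ} (hJ : J.OrdConnected) {T : ℝ} (hT : T ∈ J) {u v : ℝ → L2 d}
    (hu : ContinuousOn u J) (hv : ContinuousOn v J)
    (hus : stNorm J u ≤ 2 * η) (hvs : stNorm J v ≤ 2 * η) :
    stNorm J (fun t => freeProp t (duh μ u T t - duh μ v T t))
      ≤ 1 / 2 * stNorm J (fun t => u t - v t) :=
  (stNorm_duh_sub_le hd hμ hJ hu hv (ne_top_of_le_ne_top (two_mul_ne_top hηt) hus)
    (ne_top_of_le_ne_top (two_mul_ne_top hηt) hvs) hT).trans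
    (hη.inh_le (Small.stDiff_le hd hJ.measurableSet hu hv hus hvs))

/-- One step of the Picard iteration; for `ε ≤ η` it keeps the ball of radius `2η`. -/
lemma picard_ball (hd : 1 ≤ d) {μ : ℝ} (hμ : |μ| = 1) {η : ENNReal} (hη : Small d η)
    (hηt : η ≠ ⊤) {J : Set ℝ} (hJ : J.OrdConnected) {T : ℝ} (hT : T ∈ J) {f : L2 d}
    {ε : ENNReal} (hf : stNorm J (fun t => freeProp t f) ≤ ε) {u : ℝ → L2 d}
    (hu : ContinuousOn u J) (hus : stNorm J u ≤ 2 * η) :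
    ContinuousOn (fun t => freeProp t (f - Complex.I • duh μ u T t)) J ∧
      stNorm J (fun t => freeProp t (f - Complex.I • duh μ u T t)) ≤ ε + 1 / 2 * stNorm J u := by
  have hD := continuousOn_duh hd hμ hJ hu (ne_top_of_le_ne_top (two_mul_ne_top hηt) hus) hT
  have hcf : ∀ {g : ℝ → L2 d}, ContinuousOn g J → ContinuousOn (fun t => freeProp t (g t)) J := by
    intro g hg
    have h : ContinuousOn (fun t => (t, g t)) J := continuousOn_id.prodMk hg
    have := Continuous.comp_continuousOn (continuous_freeProp_uncurry (d := d)) h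
    exact this
  refine ⟨hcf (continuousOn_const.sub (hD.const_smul Complex.I)), ?_⟩
  have h1 := picard_stNorm_le hd hμ hη hηt hJ hT hu (continuousOn_const (c := (0 : L2 d))) hus
    (by rw [stNorm_zero hd]; exact zero_le)
  simp only [duh_zero hd hμ, sub_zero] at h1
  have h2 : (fun t => freeProp t (f - Complex.I • duh μ u T t))
      = fun t => freeProp t f + (-Complex.I) • freeProp t (duh μ u T t) := by
    funext t
    rw [freeProp_sub, freeProp_smul, neg_smul, sub_eq_add_neg]
  rw [h2]
  refine (stNorm_add_le hd hJ.measurableSet (continuous_freeProp f).continuousOn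
    ((hcf hD).const_smul (-Complex.I))).trans (add_le_add hf ?_)
  change stNorm J (fun t => (-Complex.I) • freeProp t (duh μ u T t)) ≤ _
  rw [stNorm_smul hd (by simp)]
  exact h1

/-- The Picard iterates, started from the free evolution of `f`. -/
def picard (μ : ℝ) (T : ℝ) (f : L2 d) : ℕ → ℝ → L2 d
  | 0 => fun t => freeProp t f
  | n + 1 => fun t => freeProp t (f - Complex.I • duh μ (picard μ T f n) T t)

section Picard

variable {μ : ℝ} {η : ENNReal} {J : Set ℝ} {T : ℝ} {f : L2 d}

lemma picard_mem (hd : 1 ≤ d) (hμ : |μ| = 1) (hη : Small d η) (hηt : η ≠ ⊤) (hJ : J.OrdConnected)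
    (hT : T ∈ J) (hf : stNorm J (fun t => freeProp t f) ≤ η) (n : ℕ) :
    ContinuousOn (picard μ T f n) J ∧ stNorm J (picard μ T f n) ≤ 2 * η := by
  induction n with
  | zero =>
    exact ⟨(continuous_freeProp f).continuousOn, hf.trans (by rw [two_mul]; exact le_self_add)⟩
  | succ n ih =>
    obtain ⟨h1, h2⟩ := picard_ball hd hμ hη hηt hJ hT hf ih.1 ih.2
    refine ⟨h1, h2.trans ?_⟩
    rw [two_mul]
    refine add_le_add_right ((mul_le_mul_right ih.2 _).trans (le_of_eq ?_)) _
    rw [← mul_assoc, one_div, ENNReal.inv_mul_cancel (by norm_num) (by norm_num), one_mul]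

lemma picard_diff (hd : 1 ≤ d) (hμ : |μ| = 1) (hη : Small d η) (hηt : η ≠ ⊤) (hJ : J.OrdConnected)
    (hT : T ∈ J) (hf : stNorm J (fun t => freeProp t f) ≤ η) (n : ℕ) :
    stNorm J (fun t => picard μ T f (n + 1) t - picard μ T f n t) ≤ (1 / 2) ^ n * (4 * η) := by
  have hmem := picard_mem hd hμ hη hηt hJ hT hf
  have hJm := hJ.measurableSet
  induction n with
  | zero =>
    have h : stNorm J (fun t => picard μ T f 1 t + (-1 : ℂ) • picard μ T f 0 t)
        ≤ stNorm J (picard μ T f 1) + stNorm J (fun t => (-1 : ℂ) • picard μ T f 0 t) :=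
      stNorm_add_le hd hJm (hmem 1).1 ((hmem 0).1.const_smul (-1 : ℂ))
    rw [stNorm_smul hd (by simp)] at h
    simp only [neg_smul, one_smul, ← sub_eq_add_neg] at h
    refine h.trans ((add_le_add (hmem 1).2 (hmem 0).2).trans (le_of_eq ?_))
    ring
  | succ n ih =>
    have e : (fun t => picard μ T f (n + 1 + 1) t - picard μ T f (n + 1) t)
        = fun t => (-Complex.I) • freeProp t
          (duh μ (picard μ T f (n + 1)) T t - duh μ (picard μ T f n) T t) := by
      funext t
      have h1 : picard μ T f (n + 1 + 1) t
          = freeProp t (f - Complex.I • duh μ (picard μ T f (n + 1)) T t) := rfl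
      have h2 : picard μ T f (n + 1) t
          = freeProp t (f - Complex.I • duh μ (picard μ T f n) T t) := rfl
      rw [h1, h2, ← freeProp_sub, ← freeProp_smul, smul_sub]
      congr 1
      simp only [neg_smul]
      abel
    rw [e, stNorm_smul hd (by simp)]
    refine (picard_stNorm_le hd hμ hη hηt hJ hT (hmem (n + 1)).1 (hmem n).1 (hmem (n + 1)).2
      (hmem n).2).trans ((mul_le_mul_right ih _).trans (le_of_eq ?_))
    rw [pow_succ]; ring

lemma picard_diff_add (hd : 1 ≤ d) (hμ : |μ| = 1) (hη : Small d η) (hηt : η ≠ ⊤)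
    (hJ : J.OrdConnected) (hT : T ∈ J) (hf : stNorm J (fun t => freeProp t f) ≤ η) (n m : ℕ) :
    stNorm J (fun t => picard μ T f (n + m) t - picard μ T f n t) ≤ (1 / 2) ^ n * (8 * η) := by
  have hmem := picard_mem hd hμ hη hηt hJ hT hf
  have hJm := hJ.measurableSet
  have h1 : stNorm J (fun t => picard μ T f (n + m) t - picard μ T f n t)
      ≤ ∑ i ∈ Finset.range m, (1 / 2 : ENNReal) ^ n * (1 / 2) ^ i * (4 * η) := by
    induction m with
    | zero => simp [stNorm_zero hd]
    | succ m ih =>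
      rw [Finset.sum_range_succ]
      have h := stNorm_add_le hd hJm ((hmem (n + m)).1.sub (hmem n).1)
        ((hmem (n + m + 1)).1.sub (hmem (n + m)).1)
      have e : (fun t => picard μ T f (n + (m + 1)) t - picard μ T f n t)
          = fun t => (picard μ T f (n + m) - picard μ T f n) t
            + (picard μ T f (n + m + 1) - picard μ T f (n + m)) t := by
        funext t; simp only [Pi.sub_apply, ← add_assoc]; abel
      rw [e]
      refine h.trans (add_le_add ih ?_)
      refine (picard_diff hd hμ hη hηt hJ hT hf (n + m)).trans (le_of_eq ?_)
      rw [pow_add]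
  refine h1.trans ?_
  have h2 : ∑ i ∈ Finset.range m, (1 / 2 : ENNReal) ^ n * (1 / 2) ^ i * (4 * η)
      = (1 / 2 : ENNReal) ^ n * (4 * η) * ∑ i ∈ Finset.range m, (1 / 2 : ENNReal) ^ i := by
    rw [Finset.mul_sum]
    exact Finset.sum_congr rfl fun i _ => by ring
  have h3 : ∑ i ∈ Finset.range m, (1 / 2 : ENNReal) ^ i ≤ 2 := by
    refine (ENNReal.sum_le_tsum _).trans (le_of_eq ?_)
    rw [ENNReal.tsum_geometric]; simp
  rw [h2]
  refine (mul_le_mul_right h3 _).trans (le_of_eq ?_)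
  ring

end Picard

/-- Local existence, as long as the free evolution of the data is small in space-time. -/
lemma exists_solves_of_small (hd : 1 ≤ d) {μ : ℝ} (hμ : |μ| = 1) {η : ENNReal} (hη : Small d η)
    (hηt : η ≠ ⊤) {J : Set ℝ} (hJ : J.OrdConnected) {T : ℝ} (hT : T ∈ J) {f : L2 d}
    (hf : stNorm J (fun t => freeProp t f) ≤ η) : ∃ v, Solves μ J v T f := by
  have hmem := picard_mem hd hμ hη hηt hJ hT hf
  have hJm := hJ.measurableSet
  set v := picard μ T f with hv
  have h2t := two_mul_ne_top hηt
  have hne : ∀ {w : ℝ → L2 d}, stNorm J w ≤ 2 * η → ∀ t ∈ J, stNorm (uIoc T t) w ≠ ⊤ :=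
    fun {w} hw t ht => ne_top_of_le_ne_top (ne_top_of_le_ne_top h2t hw)
      (stNorm_mono hd (uIoc_subset_of_mem hJ hT ht) w)
  set K : ENNReal := nlConst d * (2 * (2 * η) ^ (4 / d : ℝ)) with hK
  have hKt : K ≠ ⊤ := ENNReal.mul_ne_top ENNReal.ofReal_ne_top (ENNReal.mul_ne_top (by norm_num)
    (ENNReal.rpow_ne_top_of_nonneg (four_div_nonneg d) h2t))
  -- difference of Duhamel integrals in `L²`, uniformly in time
  have hL2 : ∀ {w z : ℝ → L2 d}, ContinuousOn w J → ContinuousOn z J → stNorm J w ≤ 2 * η →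
      stNorm J z ≤ 2 * η → ∀ t ∈ J, ‖duh μ w T t - duh μ z T t‖ₑ ≤
        strConst d * (K * stNorm J (fun t => w t - z t)) := by
    intro w z hw hz hws hzs t ht
    have hsub := uIoc_subset_of_mem hJ hT ht
    refine (enorm_duh_sub_le hd hμ (hw.mono hsub) (hz.mono hsub) (hne hws t ht)
      (hne hzs t ht)).trans (mul_le_mul_right ?_ _)
    refine le_trans ?_ (Small.stDiff_le hd hJm hw hz hws hzs)
    exact ENNReal.rpow_le_rpow (lintegral_mono_set hsub)
      (by have := (holder_pE_qE hd).pos; positivity)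
  set C : ENNReal := strConst d * (K * (8 * η)) with hC
  have hCt : C ≠ ⊤ := ENNReal.mul_ne_top (strConst_ne_top hd) (ENNReal.mul_ne_top hKt
    (ENNReal.mul_ne_top (by norm_num) hηt))
  have hstep : ∀ n, ∀ t ∈ J, edist (v (n + 1) t) (v (n + 1 + 1) t) ≤ C / 2 ^ n := by
    intro n t ht
    rw [edist_comm, edist_eq_enorm_sub]
    have e : v (n + 1 + 1) t - v (n + 1) t
        = freeProp t ((-Complex.I) • (duh μ (v (n + 1)) T t - duh μ (v n) T t)) := by
      have h1 : v (n + 1 + 1) t = freeProp t (f - Complex.I • duh μ (v (n + 1)) T t) := rfl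
      have h2 : v (n + 1) t = freeProp t (f - Complex.I • duh μ (v n) T t) := rfl
      rw [h1, h2, ← freeProp_sub, smul_sub]
      congr 1
      simp only [neg_smul]
      abel
    rw [e, ← ofReal_norm, norm_freeProp, norm_smul, norm_neg, Complex.norm_I, one_mul, ofReal_norm]
    refine (hL2 (hmem (n + 1)).1 (hmem n).1 (hmem (n + 1)).2 (hmem n).2 t ht).trans ?_
    have h3 := picard_diff_add hd hμ hη hηt hJ hT hf n 1
    refine (mul_le_mul_right (mul_le_mul_right h3 _) _).trans (le_of_eq ?_)
    rw [hC, one_div, ← ENNReal.inv_pow, div_eq_mul_inv]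
    ring
  have hlimex : ∀ t, ∃ l, t ∈ J → Tendsto (fun n => v (n + 1) t) atTop (𝓝 l) := by
    intro t
    by_cases ht : t ∈ J
    · obtain ⟨l, hl⟩ := cauchySeq_tendsto_of_complete
        (cauchySeq_of_edist_le_geometric_two C hCt fun n => hstep n t ht)
      exact ⟨l, fun _ => hl⟩
    · exact ⟨0, fun h => absurd h ht⟩
  choose u hu using hlimex
  have hunif : TendstoUniformlyOn (fun n => v (n + 1)) u atTop J := by
    rw [EMetric.tendstoUniformlyOn_iff]
    intro ε hε
    have h1 : Tendsto (fun n : ℕ => 2 * C / 2 ^ n) atTop (𝓝 0) := by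
      have h2 := ENNReal.Tendsto.const_mul (a := 2 * C)
        (ENNReal.tendsto_pow_atTop_nhds_zero_of_lt_one (r := 2⁻¹) (by simp))
        (Or.inr (two_mul_ne_top hCt))
      simpa [ENNReal.div_eq_inv_mul, ENNReal.inv_pow, mul_comm] using h2
    filter_upwards [h1.eventually (gt_mem_nhds hε)] with n hn t ht
    rw [edist_comm]
    exact (edist_le_of_edist_le_geometric_two_of_tendsto C (fun n => hstep n t ht)
      (hu t ht) n).trans_lt hn
  have huc : ContinuousOn u J := hunif.continuousOn
    (Frequently.of_forall fun n => (hmem (n + 1)).1)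
  have hus : stNorm J u ≤ 2 * η := stNorm_le_of_tendsto hd hJm (fun n => (hmem (n + 1)).1)
    (fun t ht => hu t ht) fun n => (hmem (n + 1)).2
  have hdiff : ∀ n, stNorm J (fun t => u t - v n t) ≤ (1 / 2) ^ n * (8 * η) := by
    intro n
    refine stNorm_le_of_tendsto hd hJm (v := fun m t => v (n + m + 1) t - v n t)
      (fun m => (hmem (n + m + 1)).1.sub (hmem n).1) (fun t ht => ?_) fun m => ?_
    · have h1 : Tendsto (fun m => v (n + m + 1) t) atTop (𝓝 (u t)) :=
        (hu t ht).comp (tendsto_atTop_mono (fun m => Nat.le_add_left m n) tendsto_id)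
      exact h1.sub_const _
    · exact picard_diff_add hd hμ hη hηt hJ hT hf n (m + 1)
  refine ⟨u, hJ, hT, huc, fun a ha b hb => ne_top_of_le_ne_top (ne_top_of_le_ne_top h2t hus)
    (stNorm_mono hd (hJ.uIcc_subset ha hb) u), fun t ht => ?_⟩
  have hduh : Tendsto (fun n => duh μ (v n) T t) atTop (𝓝 (duh μ u T t)) := by
    rw [tendsto_iff_edist_tendsto_0]
    have h1 : Tendsto (fun n : ℕ => C * (1 / 2) ^ n) atTop (𝓝 0) := by
      have h2 := ENNReal.Tendsto.const_mul (a := C)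
        (ENNReal.tendsto_pow_atTop_nhds_zero_of_lt_one (r := 1 / 2) (by simp)) (Or.inr hCt)
      simpa using h2
    refine tendsto_of_tendsto_of_tendsto_of_le_of_le tendsto_const_nhds h1 (fun _ => zero_le)
      fun n => ?_
    rw [edist_comm, edist_eq_enorm_sub]
    refine (hL2 huc (hmem n).1 hus (hmem n).2 t ht).trans ?_
    refine (mul_le_mul_right (mul_le_mul_right (hdiff n) _) _).trans (le_of_eq ?_)
    rw [hC]; ring
  have h3 : Tendsto (fun n => freeProp (-t) (v (n + 1) t)) atTop
      (𝓝 (f - Complex.I • duh μ u T t)) := by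
    have e : (fun n => freeProp (-t) (v (n + 1) t)) = fun n => f - Complex.I • duh μ (v n) T t := by
      funext n
      change freeProp (-t) (freeProp t _) = _
      rw [freeProp_freeProp, neg_add_cancel, freeProp_zero]
    rw [e]
    exact tendsto_const_nhds.sub (hduh.const_smul Complex.I)
  have h4 : Tendsto (fun n => freeProp (-t) (v (n + 1) t)) atTop (𝓝 (freeProp (-t) (u t))) :=
    ((freePropL (-t)).continuous.tendsto _).comp (hu t ht)
  exact tendsto_nhds_unique h4 h3

/-- The space-time norm of the free evolution is small on small time intervals. -/
lemma exists_delta_stNorm_freeProp_le (hd : 1 ≤ d) {η : ENNReal} (hη : η ≠ 0) (T : ℝ) (f : L2 d) :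
    ∃ δ > 0, stNorm (Icc (T - δ) (T + δ)) (fun t => freeProp t f) ≤ η := by
  have hq := qE_pos hd
  have hfin : ∫⁻ t, normQ (freeProp t f) ^ qE d ≠ ⊤ := by
    have h := ne_top_of_le_ne_top (ENNReal.mul_ne_top (strConst_ne_top hd) enorm_ne_top)
      (stNorm_freeProp_le hd univ f)
    have := ENNReal.rpow_ne_top_of_nonneg hq.le h
    rwa [stNorm_rpow hd, Measure.restrict_univ] at this
  have hηq : η ^ qE d ≠ 0 := by
    simp [ENNReal.rpow_eq_zero_iff, hη, not_lt.2 hq.le]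
  obtain ⟨r, hr0, hr⟩ := exists_pos_setLIntegral_lt_of_measure_lt hfin hηq
  obtain ⟨δ, hδ0, hδ⟩ : ∃ δ : ℝ, 0 < δ ∧ ENNReal.ofReal (2 * δ) < r := by
    have h : Tendsto (fun δ : ℝ => ENNReal.ofReal (2 * δ)) (𝓝[>] 0) (𝓝 0) := by
      have : Continuous fun δ : ℝ => ENNReal.ofReal (2 * δ) :=
        ENNReal.continuous_ofReal.comp (by fun_prop)
      simpa using (this.tendsto 0).mono_left (nhdsWithin_le_nhds (s := Ioi 0))
    obtain ⟨δ, h1, h2⟩ := ((h.eventually (gt_mem_nhds hr0)).and self_mem_nhdsWithin).exists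
    exact ⟨δ, h2, h1⟩
  refine ⟨δ, hδ0, ?_⟩
  have h1 := hr (Icc (T - δ) (T + δ)) (by
    rw [Real.volume_Icc]; convert hδ using 2; ring)
  have h2 := ENNReal.rpow_le_rpow h1.le (z := 1 / qE d) (by positivity)
  rwa [← ENNReal.rpow_mul, mul_one_div_cancel hq.ne', ENNReal.rpow_one] at h2

/-- Local existence for arbitrary data, on both sides of the initial time. -/
lemma exists_solves (hd : 1 ≤ d) {μ : ℝ} (hμ : |μ| = 1) (T : ℝ) (f : L2 d) :
    ∃ δ > 0, ∃ v, Solves μ (Icc (T - δ) (T + δ)) v T f := by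
  obtain ⟨η, h0, ht, hη⟩ := exists_small hd
  obtain ⟨δ, hδ, h⟩ := exists_delta_stNorm_freeProp_le hd h0 T f
  exact ⟨δ, hδ, exists_solves_of_small hd hμ hη ht ordConnected_Icc
    ⟨by linarith, by linarith⟩ h⟩

/-! ### Continuation of solutions -/

lemma stNorm_union_ne_top (hd : 1 ≤ d) {J K : Set ℝ} {u : ℝ → L2 d} (hJ : stNorm J u ≠ ⊤)
    (hK : stNorm K u ≠ ⊤) : stNorm (J ∪ K) u ≠ ⊤ := by
  have hq := qE_pos hd
  have h1 := ENNReal.rpow_ne_top_of_nonneg hq.le hJ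
  have h2 := ENNReal.rpow_ne_top_of_nonneg hq.le hK
  rw [stNorm_rpow hd] at h1 h2
  exact ENNReal.rpow_ne_top_of_nonneg (by positivity)
    (ne_top_of_le_ne_top (ENNReal.add_ne_top.2 ⟨h1, h2⟩) (lintegral_union_le _ _ _))

lemma stNorm_singleton (hd : 1 ≤ d) (T : ℝ) (u : ℝ → L2 d) : stNorm {T} u = 0 := by
  have hq := qE_pos hd
  simp [stNorm, hq]

lemma Solves.mono {μ : ℝ} {I K : Set ℝ} {u : ℝ → L2 d} {T : ℝ} {f : L2 d} (hu : Solves μ I u T f)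
    (hK : K.OrdConnected) (hKI : K ⊆ I) (hT : T ∈ K) : Solves μ K u T f :=
  ⟨hK, hT, hu.continuousOn.mono hKI, fun a ha b hb => hu.stNorm_ne_top a (hKI ha) b (hKI hb),
    fun t ht => hu.eq t (hKI ht)⟩

lemma Solves.apply_self {μ : ℝ} {I : Set ℝ} {u : ℝ → L2 d} {T : ℝ} {f : L2 d}
    (hu : Solves μ I u T f) : u T = freeProp T f := by
  rw [hu.eq' hu.mem, duh_self, smul_zero, sub_zero]

/-- Two solutions with the same data at `T`, on two intervals that meet only at `T`, fit together
to a solution. -/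
lemma Solves.exists_union (hd : 1 ≤ d) {μ : ℝ} {I K A B : Set ℝ} {u v : ℝ → L2 d} {T : ℝ}
    {f : L2 d} (hu : Solves μ I u T f) (hv : Solves μ K v T f) (hIA : I ⊆ A) (hKB : K ⊆ B)
    (hA : IsClosed A) (hB : IsClosed B) (hAB : ∀ t ∈ A, t ∈ B → t = T) :
    ∃ w, EqOn w u I ∧ Solves μ (I ∪ K) w T f := by
  classical
  set w : ℝ → L2 d := fun t => if t ∈ I then u t else v t with hw
  have hwu : EqOn w u I := fun t ht => if_pos ht
  have hwv : EqOn w v K := by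
    intro t ht
    by_cases htI : t ∈ I
    · obtain rfl := hAB t (hIA htI) (hKB ht)
      rw [hwu htI, hu.apply_self, hv.apply_self]
    · exact if_neg htI
  have hwI : ∀ t ∈ I, stNorm (uIcc T t) w ≠ ⊤ := fun t ht => by
    rw [stNorm_congr measurableSet_uIcc (hwu.mono (hu.ordConnected.uIcc_subset hu.mem ht))]
    exact hu.stNorm_ne_top _ hu.mem _ ht
  have hwK : ∀ t ∈ K, stNorm (uIcc T t) w ≠ ⊤ := fun t ht => by
    rw [stNorm_congr measurableSet_uIcc (hwv.mono (hv.ordConnected.uIcc_subset hv.mem ht))]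
    exact hv.stNorm_ne_top _ hv.mem _ ht
  have hwIK : ∀ t ∈ I ∪ K, stNorm (uIcc T t) w ≠ ⊤ := fun t ht => ht.elim (hwI t) (hwK t)
  refine ⟨w, hwu, ⟨?_, Or.inl hu.mem, ?_, ?_, ?_⟩⟩
  · exact (hu.ordConnected.isPreconnected.union T hu.mem hv.mem
      hv.ordConnected.isPreconnected).ordConnected
  · intro x hx
    rw [continuousWithinAt_union]
    constructor
    · by_cases hxI : x ∈ I
      · exact (hu.continuousOn x hxI).congr hwu (hwu hxI)
      · refine continuousWithinAt_of_notMem_closure fun hcl => hxI ?_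
        have hxK : x ∈ K := hx.resolve_left hxI
        rw [hAB x (closure_minimal hIA hA hcl) (hKB hxK)]
        exact hu.mem
    · by_cases hxK : x ∈ K
      · exact (hv.continuousOn x hxK).congr hwv (hwv hxK)
      · refine continuousWithinAt_of_notMem_closure fun hcl => hxK ?_
        have hxI : x ∈ I := hx.resolve_right hxK
        rw [hAB x (hIA hxI) (closure_minimal hKB hB hcl)]
        exact hv.mem
  · intro a ha b hb
    refine ne_top_of_le_ne_top (stNorm_union_ne_top hd (hwIK a ha) (hwIK b hb))
      (stNorm_mono hd ?_ w)
    rw [uIcc_comm T a]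
    exact uIcc_subset_uIcc_union_uIcc
  · rintro t (ht | ht)
    · rw [hwu ht, hu.eq t ht,
        duh_congr (hwu.mono (uIoc_subset_of_mem hu.ordConnected hu.mem ht))]
    · rw [hwv ht, hv.eq t ht,
        duh_congr (hwv.mono (uIoc_subset_of_mem hv.ordConnected hv.mem ht))]

/-- A solution with finite space-time norm near a boundary point `T` of its interval converges at
`T`, and extends to `T`. -/
lemma IsSolution.exists_solves_insert (hd : 1 ≤ d) {μ : ℝ} (hμ : |μ| = 1) {I : Set ℝ}
    {u : ℝ → L2 d} (hu : IsSolution μ I u) {T : ℝ} (hT : T ∈ closure I) {ρ : ℝ} (hρ : 0 < ρ)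
    (hs : stNorm (I ∩ Icc (T - ρ) (T + ρ)) u ≠ ⊤) :
    ∃ u' f, EqOn u' u I ∧ Solves μ (insert T I) u' T f := by
  by_cases hTI : T ∈ I
  · rw [insert_eq_of_mem hTI]
    exact ⟨u, _, fun _ _ => rfl, hu.solves hd hμ hTI⟩
  have hp0 := (holder_pE_qE hd).pos
  set J := I ∩ Icc (T - ρ) (T + ρ) with hJdef
  have hball : Icc (T - ρ) (T + ρ) ∈ 𝓝 T := Icc_mem_nhds (by linarith) (by linarith)
  have hJ : J.OrdConnected := hu.ordConnected.inter ordConnected_Icc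
  have hJI : J ⊆ I := inter_subset_left
  have huJ := hu.continuousOn.mono hJI
  have hnhds : 𝓝[J] T = 𝓝[I] T := nhdsWithin_inter_of_mem' (mem_nhdsWithin_of_mem_nhds hball)
  have hne : (𝓝[J] T).NeBot := by rw [hnhds]; exact mem_closure_iff_nhdsWithin_neBot.1 hT
  have hTJ : T ∈ closure J := mem_closure_iff_nhdsWithin_neBot.2 hne
  obtain ⟨c, hc⟩ : J.Nonempty := closure_nonempty_iff.1 ⟨T, hTJ⟩
  -- the Duhamel integral from `c` is Cauchy at `T`
  obtain ⟨D, hD⟩ : ∃ D, Tendsto (fun t => duh μ u c t) (𝓝[J] T) (𝓝 D) := by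
    refine CompleteSpace.complete (EMetric.cauchy_iff.2 ⟨(hne.map _).ne, fun ε hε => ?_⟩)
    have hfin := lintegral_diffBound_ne_top hd hJ huJ hs
    have hmeas : Tendsto (fun δ : ℝ => (volume.restrict J) (Icc (T - δ) (T + δ))) (𝓝[>] 0)
        (𝓝 0) := by
      have h1 : Tendsto (fun δ : ℝ => ENNReal.ofReal (T + δ - (T - δ))) (𝓝[>] 0) (𝓝 0) := by
        have : Continuous fun δ : ℝ => ENNReal.ofReal (T + δ - (T - δ)) :=
          ENNReal.continuous_ofReal.comp (by fun_prop)
        simpa using (this.tendsto 0).mono_left (nhdsWithin_le_nhds (s := Ioi 0))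
      refine tendsto_of_tendsto_of_tendsto_of_le_of_le tendsto_const_nhds h1 (fun _ => zero_le)
        fun δ => ?_
      exact (Measure.restrict_apply_le _ _).trans (le_of_eq Real.volume_Icc)
    have h1 : Tendsto (fun δ : ℝ => strConst d * (∫⁻ s in Icc (T - δ) (T + δ),
        diffBound (u s) 0 ^ pE d ∂(volume.restrict J)) ^ (1 / pE d)) (𝓝[>] 0) (𝓝 0) := by
      have h2 := (ENNReal.continuous_rpow_const (y := 1 / pE d)).tendsto 0 |>.comp
        (tendsto_setLIntegral_zero hfin hmeas)
      rw [ENNReal.zero_rpow_of_pos (by positivity)] at h2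
      have := ENNReal.Tendsto.const_mul h2 (Or.inr (strConst_ne_top hd))
      simpa using this
    obtain ⟨δ, h2, h3⟩ := ((h1.eventually (gt_mem_nhds hε)).and self_mem_nhdsWithin).exists
    have h3 : 0 < δ := h3
    refine ⟨_, image_mem_map (inter_mem self_mem_nhdsWithin (mem_nhdsWithin_of_mem_nhds
      (Icc_mem_nhds (show T - δ < T by linarith) (show T < T + δ by linarith)))), ?_⟩
    rintro _ ⟨t, ht, rfl⟩ _ ⟨t', ht', rfl⟩
    exact (edist_duh_le hd hμ hJ huJ hs hc ht'.1 ht.1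
      (uIoc_subset_uIcc.trans (ordConnected_Icc.uIcc_subset ht'.2 ht.2))).trans_lt h2
  have hsol := hu.solves hd hμ (hJI hc)
  set f := freeProp (-c) (u c) - Complex.I • D with hf
  set u' := Function.update u T (freeProp T f) with hu'
  have hEq : EqOn u' u I := fun t ht => Function.update_of_ne (ne_of_mem_of_not_mem ht hTI) _ _
  have hEqJ : EqOn u' u J := hEq.mono hJI
  have hu'T : u' T = freeProp T f := Function.update_self _ _ _
  have hlim : Tendsto u (𝓝[I] T) (𝓝 (freeProp T f)) := by
    have h1 : Tendsto (fun t => (t, freeProp (-c) (u c) - Complex.I • duh μ u c t)) (𝓝[I] T)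
        (𝓝 (T, f)) := by
      rw [hnhds] at hD
      exact (tendsto_id.mono_left nhdsWithin_le_nhds).prodMk_nhds
        (tendsto_const_nhds.sub (hD.const_smul Complex.I))
    have h2 := ((continuous_freeProp_uncurry (d := d)).tendsto (T, f)).comp h1
    refine h2.congr' ?_
    filter_upwards [self_mem_nhdsWithin] with t ht
    exact (hsol.eq' ht).symm
  have hcont : ContinuousOn u' (insert T I) := by
    rw [hu', continuousOn_update_iff]
    have : insert T I \ {T} = I := by
      rw [insert_sdiff_of_mem _ (mem_singleton T), sdiff_singleton_eq_self hTI]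
    rw [this]
    exact ⟨hu.continuousOn, fun _ => hlim⟩
  have hoI : (insert T I).OrdConnected := (hu.ordConnected.isPreconnected.subset_closure
    (subset_insert _ _) (insert_subset hT subset_closure)).ordConnected
  have hoJ : (insert T J).OrdConnected := (hJ.isPreconnected.subset_closure
    (subset_insert _ _) (insert_subset hTJ subset_closure)).ordConnected
  have hsJ : stNorm (insert T J) u' ≠ ⊤ := by
    rw [insert_eq]
    refine stNorm_union_ne_top hd (by rw [stNorm_singleton hd]; simp) ?_
    rwa [stNorm_congr hJ.measurableSet hEqJ]
  have hsc : ∀ t ∈ insert T I, stNorm (uIcc c t) u' ≠ ⊤ := by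
    rintro t (rfl | ht)
    · exact ne_top_of_le_ne_top hsJ (stNorm_mono hd
        (hoJ.uIcc_subset (mem_insert_of_mem _ hc) (mem_insert _ _)) u')
    · rw [stNorm_congr measurableSet_uIcc (hEq.mono (hu.ordConnected.uIcc_subset (hJI hc) ht))]
      exact hu.stNorm_ne_top hd (hJI hc) ht
  have hsI : ∀ a ∈ insert T I, ∀ b ∈ insert T I, stNorm (uIcc a b) u' ≠ ⊤ := by
    intro a ha b hb
    refine ne_top_of_le_ne_top (stNorm_union_ne_top hd (hsc a ha) (hsc b hb))
      (stNorm_mono hd ?_ u')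
    rw [uIcc_comm c a]
    exact uIcc_subset_uIcc_union_uIcc
  -- the Duhamel integral up to `T` is the limit of the Duhamel integrals
  have hDT : duh μ u' c T = D := by
    have h1 : Tendsto (fun t => duh μ u' c t) (𝓝[J] T) (𝓝 (duh μ u' c T)) :=
      (continuousOn_duh hd hμ hoJ (hcont.mono (insert_subset_insert hJI)) hsJ
        (mem_insert_of_mem _ hc) T (mem_insert _ _)).mono_left
          (nhdsWithin_mono _ (subset_insert _ _))
    refine tendsto_nhds_unique (h1.congr' ?_) hD
    filter_upwards [self_mem_nhdsWithin] with t ht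
    exact duh_congr (hEqJ.mono (uIoc_subset_of_mem hJ hc ht))
  refine ⟨u', f, hEq, ⟨hoI, mem_insert _ _, hcont, hsI, ?_⟩⟩
  rintro t (rfl | ht)
  · rw [hu'T, freeProp_freeProp, neg_add_cancel, freeProp_zero, duh_self, smul_zero, sub_zero]
  · have hadd := duh_add hd hμ hoI hcont hsI (mem_insert_of_mem _ (hJI hc)) (mem_insert _ _)
      (mem_insert_of_mem T ht)
    rw [hDT, duh_congr (hEq.mono (uIoc_subset_of_mem hu.ordConnected (hJI hc) ht))] at hadd
    rw [hEq ht, hsol.eq t ht, ← hadd, hf, smul_add, sub_sub]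

/-- `T` is an end point of `I`, which may or may not belong to `I`. -/
structure IsEndpoint (I : Set ℝ) (T : ℝ) : Prop where
  mem_closure : T ∈ closure I
  subset : I ⊆ Iic T ∨ I ⊆ Ici T

/-- A maximal solution does not extend to an end point of its interval. -/
lemma IsMaximalSolution.not_solves_insert (hd : 1 ≤ d) {μ : ℝ} (hμ : |μ| = 1) {I : Set ℝ}
    {u : ℝ → L2 d} (hu : IsMaximalSolution μ I u) {T : ℝ} (hT : IsEndpoint I T) {u' : ℝ → L2 d}
    (hu' : EqOn u' u I) (f : L2 d) : ¬ Solves μ (insert T I) u' T f := by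
  intro hs
  obtain ⟨δ, hδ, v, hv⟩ := exists_solves hd hμ T f
  have key : ∀ {A B K : Set ℝ}, I ⊆ A → T ∈ A → K ⊆ B → IsClosed A → IsClosed B →
      (∀ t ∈ A, t ∈ B → t = T) → K.OrdConnected → T ∈ K → K ⊆ Icc (T - δ) (T + δ) →
      ∀ b ∈ K, b ∉ I → False := by
    intro A B K hIA hTA hKB hA hB hAB hK hTK hKδ b hbK hbI
    obtain ⟨w, hw, hwS⟩ := hs.exists_union hd (hv.mono hK hKδ hTK) (insert_subset hTA hIA) hKB
      hA hB hAB
    refine hu.2 (insert T I ∪ K) w ⟨fun t ht => Or.inl (mem_insert_of_mem _ ht),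
      fun h => hbI (h (Or.inr hbK))⟩ (hwS.isSolution hd hμ) fun t ht => ?_
    rw [hw (mem_insert_of_mem _ ht), hu' ht]
  rcases hT.subset with h | h
  · exact key h self_mem_Iic (show Icc T (T + δ) ⊆ Ici T from Icc_subset_Ici_self)
      isClosed_Iic isClosed_Ici
      (fun t h1 h2 => le_antisymm h1 h2) ordConnected_Icc ⟨le_rfl, by linarith⟩
      (Icc_subset_Icc_left (by linarith)) (T + δ) ⟨by linarith, le_rfl⟩
      fun hb => by have := h hb; simp only [mem_Iic] at this; linarith
  · exact key h self_mem_Ici (show Icc (T - δ) T ⊆ Iic T from Icc_subset_Iic_self)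
      isClosed_Ici isClosed_Iic
      (fun t h1 h2 => le_antisymm h2 h1) ordConnected_Icc ⟨by linarith, le_rfl⟩
      (Icc_subset_Icc_right (by linarith)) (T - δ) ⟨le_rfl, by linarith⟩
      fun hb => by have := h hb; simp only [mem_Ici] at this; linarith

/-- The space-time norm of a maximal solution blows up at a finite end point. -/
lemma IsMaximalSolution.stNorm_eq_top (hd : 1 ≤ d) {μ : ℝ} (hμ : |μ| = 1) {I : Set ℝ}
    {u : ℝ → L2 d} (hu : IsMaximalSolution μ I u) {T : ℝ} (hT : IsEndpoint I T) {ρ : ℝ}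
    (hρ : 0 < ρ) : stNorm (I ∩ Icc (T - ρ) (T + ρ)) u = ⊤ := by
  by_contra h
  obtain ⟨u', f, h1, h2⟩ := hu.1.exists_solves_insert hd hμ hT.mem_closure hρ h
  exact hu.not_solves_insert hd hμ hT h1 f h2

lemma IsMaximalSolution.endpoint_notMem (hd : 1 ≤ d) {μ : ℝ} (hμ : |μ| = 1) {I : Set ℝ}
    {u : ℝ → L2 d} (hu : IsMaximalSolution μ I u) {T : ℝ} (hT : IsEndpoint I T) : T ∉ I := by
  intro h
  refine hu.not_solves_insert hd hμ hT (fun _ _ => rfl) (freeProp (-T) (u T)) ?_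
  rw [insert_eq_of_mem h]
  exact hu.1.solves hd hμ h

/-! ### Non-concentration away from the blowup time -/

lemma stNorm_uIcc (a b : ℝ) (u : ℝ → L2 d) : stNorm (uIcc a b) u = stNorm (uIoc a b) u := by
  rw [stNorm, stNorm, uIcc, uIoc, Measure.restrict_congr_set Ioc_ae_eq_Icc]

lemma continuousOn_toReal_lintegral_uIoc {g : ℝ → ENNReal} {a b : ℝ}
    (hg : AEMeasurable g (volume.restrict (uIcc a b))) (h : ∫⁻ t in uIcc a b, g t ≠ ⊤) :
    ContinuousOn (fun t => (∫⁻ s in uIoc a t, g s).toReal) (uIcc a b) := by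
  have h1 : IntegrableOn (fun s => (g s).toReal) (uIcc a b) volume :=
    integrable_toReal_of_lintegral_ne_top hg h
  refine (intervalIntegral.continuousOn_primitive_interval h1).abs.congr fun t ht => ?_
  have hsub : uIoc a t ⊆ uIcc a b := uIoc_subset_uIcc.trans (uIcc_subset_uIcc_left ht)
  have hgt := hg.mono_measure (Measure.restrict_mono hsub le_rfl)
  dsimp only
  rw [intervalIntegral.abs_intervalIntegral_eq, integral_toReal hgt, abs_of_nonneg (by positivity)]
  exact ae_lt_top' hgt (ne_top_of_le_ne_top h (lintegral_mono_set hsub))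

/-- A solution whose free evolution is small stays small, on as large an interval. -/
lemma Solves.stNorm_le (hd : 1 ≤ d) {μ : ℝ} (hμ : |μ| = 1) {I : Set ℝ} {u : ℝ → L2 d}
    {T : ℝ} {f : L2 d} (hu : Solves μ I u T f) {η : ENNReal} (hη : Small d η) (hη0 : η ≠ 0)
    (hηt : η ≠ ⊤) {t : ℝ} (ht : t ∈ I)
    (hf : stNorm (uIcc T t) (fun s => freeProp s f) ≤ η / 2) : stNorm (uIcc T t) u ≤ 2 * η := by
  by_contra! hlt
  have hq := qE_pos hd
  have hsub := hu.ordConnected.uIcc_subset hu.mem ht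
  have hfin := hu.stNorm_ne_top _ hu.mem _ ht
  have hfin' := ENNReal.rpow_ne_top_of_nonneg hq.le hfin
  have hcont := continuousOn_toReal_lintegral_uIoc (g := fun s => normQ (u s) ^ qE d)
    ((aemeasurable_normQ hd measurableSet_uIcc (hu.continuousOn.mono hsub)).pow_const _)
    (by rwa [stNorm_rpow hd] at hfin')
  simp only [← stNorm_rpow hd, ← stNorm_uIcc] at hcont
  -- at a time where the norm equals `2η`, the equation bounds it by `η / 2 + η`
  have hηq : (2 * η) ^ qE d ≠ ⊤ := ENNReal.rpow_ne_top_of_nonneg hq.le (two_mul_ne_top hηt)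
  obtain ⟨s, hs, hse⟩ := intermediate_value_uIcc hcont
    (show ((2 * η) ^ qE d).toReal ∈ _ by
      rw [uIcc_self, stNorm_singleton hd, ENNReal.zero_rpow_of_pos hq, ENNReal.toReal_zero]
      exact ⟨(min_le_left _ _).trans (by positivity), le_max_of_le_right
        (ENNReal.toReal_mono hfin' (ENNReal.rpow_le_rpow hlt.le hq.le))⟩)
  have hsI := hsub hs
  have hsub' := uIcc_subset_uIcc_left hs
  have hs2 : stNorm (uIcc T s) u = 2 * η := by
    have h := (ENNReal.toReal_eq_toReal_iff' (ENNReal.rpow_ne_top_of_nonneg hq.le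
      (hu.stNorm_ne_top _ hu.mem _ hsI)) hηq).1 hse
    have h2 := congrArg (fun x : ENNReal => x ^ (1 / qE d)) h
    simpa only [← ENNReal.rpow_mul, mul_one_div_cancel hq.ne', ENNReal.rpow_one] using h2
  have h := (picard_ball hd hμ hη hηt ordConnected_uIcc left_mem_uIcc
    ((stNorm_mono hd hsub' _).trans hf) (hu.continuousOn.mono (hsub'.trans hsub)) hs2.le).2
  rw [← stNorm_congr measurableSet_uIcc (u := u) (fun x hx => hu.eq' (hsub (hsub' hx))), hs2,
    ← mul_assoc, one_div, ENNReal.inv_mul_cancel (by norm_num) (by norm_num), one_mul, two_mul,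
    ENNReal.add_le_add_iff_right hηt] at h
  exact absurd h (not_le.2 (ENNReal.half_lt_self hη0 hηt))

lemma lintegral_Ioo_le_of_Icc_left {g : ℝ → ENNReal} {a b : ℝ} (hab : a < b)
    (hg : AEMeasurable g (volume.restrict (Ioo a b))) {M : ENNReal}
    (h : ∀ t ∈ Ioo a b, ∫⁻ s in Icc a t, g s ≤ M) : ∫⁻ s in Ioo a b, g s ≤ M := by
  have hc : AECover (volume.restrict (Ioo a b)) (𝓝[<] b) fun t => Icc a t :=
    aecover_Ioo_of_Icc tendsto_const_nhds (tendsto_id.mono_left nhdsWithin_le_nhds)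
  refine le_of_tendsto (hc.lintegral_tendsto_of_countably_generated hg) ?_
  filter_upwards [Ioo_mem_nhdsLT hab] with t ht
  exact (lintegral_mono' (Measure.restrict_mono le_rfl Measure.restrict_le_self) le_rfl).trans
    (h t ht)

lemma lintegral_Ioo_le_of_Icc_right {g : ℝ → ENNReal} {a b : ℝ} (hab : a < b)
    (hg : AEMeasurable g (volume.restrict (Ioo a b))) {M : ENNReal}
    (h : ∀ t ∈ Ioo a b, ∫⁻ s in Icc t b, g s ≤ M) : ∫⁻ s in Ioo a b, g s ≤ M := by
  have hc : AECover (volume.restrict (Ioo a b)) (𝓝[>] a) fun t => Icc t b :=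
    aecover_Ioo_of_Icc (tendsto_id.mono_left nhdsWithin_le_nhds) tendsto_const_nhds
  refine le_of_tendsto (hc.lintegral_tendsto_of_countably_generated hg) ?_
  filter_upwards [Ioo_mem_nhdsGT hab] with t ht
  exact (lintegral_mono' (Measure.restrict_mono le_rfl Measure.restrict_le_self) le_rfl).trans
    (h t ht)

/-- From any time on, the free evolution of a maximal solution is not small in space-time up to a
finite end point. -/
lemma IsMaximalSolution.lt_stNorm_freeProp (hd : 1 ≤ d) {μ : ℝ} (hμ : |μ| = 1) {I : Set ℝ}
    {u : ℝ → L2 d} (hu : IsMaximalSolution μ I u) {T : ℝ} (hT : IsEndpoint I T) {η : ENNReal}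
    (hη : Small d η) (hη0 : η ≠ 0) (hηt : η ≠ ⊤) {t₀ : ℝ} (ht₀ : t₀ ∈ I) :
    η / 2 < stNorm (uIcc t₀ T) (fun s => freeProp s (freeProp (-t₀) (u t₀))) := by
  by_contra! hle
  have hq := qE_pos hd
  have hTI := hu.endpoint_notMem hd hμ hT
  have hsol := hu.1.solves hd hμ ht₀
  have hbound : ∀ t ∈ I, t ∈ uIcc t₀ T → ∫⁻ s in uIcc t₀ t, normQ (u s) ^ qE d
      ≤ (2 * η) ^ qE d := fun t ht htT => by
    rw [← stNorm_rpow hd]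
    exact ENNReal.rpow_le_rpow (hsol.stNorm_le hd hμ hη hη0 hηt ht
      ((stNorm_mono hd (uIcc_subset_uIcc_left htT) _).trans hle)) hq.le
  have hfinish : ∀ {a b ρ : ℝ}, Ioo a b ⊆ I → 0 < ρ →
      ∫⁻ s in Ioo a b, normQ (u s) ^ qE d ≤ (2 * η) ^ qE d →
      I ∩ Icc (T - ρ) (T + ρ) ⊆ {t₀} ∪ Ioo a b → False := by
    intro a b ρ hab hρ h1 h2
    refine ne_top_of_le_ne_top ?_ (stNorm_mono hd h2 u) (hu.stNorm_eq_top hd hμ hT hρ)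
    refine stNorm_union_ne_top hd (by rw [stNorm_singleton hd]; simp) ?_
    exact ENNReal.rpow_ne_top_of_nonneg (by positivity) (ne_top_of_le_ne_top
      (ENNReal.rpow_ne_top_of_nonneg hq.le (two_mul_ne_top hηt)) h1)
  have hmeas : ∀ {a b : ℝ}, Ioo a b ⊆ I →
      AEMeasurable (fun s => normQ (u s) ^ qE d) (volume.restrict (Ioo a b)) := fun h =>
    (aemeasurable_normQ hd measurableSet_Ioo (hu.1.continuousOn.mono h)).pow_const _
  rcases hT.subset with h | h
  · have hlt : t₀ < T := lt_of_le_of_ne (h ht₀) (ne_of_mem_of_not_mem ht₀ hTI)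
    have hIoo : Ioo t₀ T ⊆ I := fun t ht => by
      obtain ⟨t', h1, h2⟩ := mem_closure_iff.1 hT.mem_closure (Ioi t) isOpen_Ioi ht.2
      exact hu.1.ordConnected.out ht₀ h2 ⟨ht.1.le, le_of_lt h1⟩
    refine hfinish hIoo (sub_pos.2 hlt) (lintegral_Ioo_le_of_Icc_left hlt (hmeas hIoo)
      fun t ht => ?_) fun t ht => ?_
    · have := hbound t (hIoo ht) (by rw [uIcc_of_le hlt.le]; exact Ioo_subset_Icc_self ht)
      rwa [uIcc_of_le ht.1.le] at this
    · have h1 : t₀ ≤ t := by have := ht.2.1; linarith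
      rcases h1.eq_or_lt with rfl | h1
      · exact Or.inl rfl
      · exact Or.inr ⟨h1, lt_of_le_of_ne (h ht.1) (ne_of_mem_of_not_mem ht.1 hTI)⟩
  · have hlt : T < t₀ := lt_of_le_of_ne (h ht₀) (ne_of_mem_of_not_mem ht₀ hTI).symm
    have hIoo : Ioo T t₀ ⊆ I := fun t ht => by
      obtain ⟨t', h1, h2⟩ := mem_closure_iff.1 hT.mem_closure (Iio t) isOpen_Iio ht.1
      exact hu.1.ordConnected.out h2 ht₀ ⟨le_of_lt h1, ht.2.le⟩
    refine hfinish hIoo (sub_pos.2 hlt) (lintegral_Ioo_le_of_Icc_right hlt (hmeas hIoo)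
      fun t ht => ?_) fun t ht => ?_
    · have := hbound t (hIoo ht) (by rw [uIcc_of_ge hlt.le]; exact Ioo_subset_Icc_self ht)
      rwa [uIcc_of_ge ht.2.le] at this
    · have h1 : t ≤ t₀ := by have := ht.2.2; linarith
      rcases h1.eq_or_lt with rfl | h1
      · exact Or.inl rfl
      · exact Or.inr ⟨lt_of_le_of_ne (h ht.1) (ne_of_mem_of_not_mem ht.1 hTI).symm, h1⟩

/-! ### The symmetry group -/

lemma sym_ae (θ : ℝ) (ξ₀ x₀ : Space d) {r : ℝ} (hr : 0 < r) (f : L2 d) :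
    sym θ ξ₀ x₀ r hr f =ᵐ[volume] symFun θ ξ₀ x₀ r f := MemLp.coeFn_toLp _

lemma norm_symFun (θ : ℝ) (ξ₀ x₀ : Space d) {r : ℝ} (hr : 0 < r) (f : Space d → ℂ) (x : Space d) :
    ‖symFun θ ξ₀ x₀ r f x‖ = r ^ (-(d / 2) : ℝ) * ‖f (r⁻¹ • (x - x₀))‖ := by
  simp only [symFun, norm_mul, Complex.norm_exp_ofReal_mul_I, mul_one, Complex.norm_real]
  rw [Real.norm_of_nonneg (by positivity)]

lemma integral_affine {E : Type*} [NormedAddCommGroup E] [NormedSpace ℝ E] (x₀ : Space d) {r : ℝ}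
    (hr : 0 < r) (g : Space d → E) :
    ∫ x, g (r⁻¹ • (x - x₀)) = r ^ (d : ℝ) • ∫ x, g x := by
  rw [integral_sub_right_eq_self (fun x => g (r⁻¹ • x)) x₀,
    Measure.integral_comp_inv_smul_of_nonneg volume g hr.le, finrank_euclideanSpace_fin,
    Real.rpow_natCast]

lemma norm_sq_eq_integral (f : L2 d) : ‖f‖ ^ 2 = ∫ x, ‖f x‖ ^ 2 := by
  have h : (inner ℂ f f : ℂ) = ((∫ x, ‖f x‖ ^ 2 : ℝ) : ℂ) := by
    rw [L2.inner_def, ← integral_complex_ofReal]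
    refine integral_congr_ae (Eventually.of_forall fun x => ?_)
    dsimp only
    rw [inner_self_eq_norm_sq_to_K]
    norm_cast
  rw [inner_self_eq_norm_sq_to_K] at h
  exact Complex.ofReal_injective (by simpa using h)

lemma norm_sym (θ : ℝ) (ξ₀ x₀ : Space d) {r : ℝ} (hr : 0 < r) (f : L2 d) :
    ‖sym θ ξ₀ x₀ r hr f‖ = ‖f‖ := by
  have h : ‖sym θ ξ₀ x₀ r hr f‖ ^ 2 = ‖f‖ ^ 2 := by
    rw [norm_sq_eq_integral, norm_sq_eq_integral f]
    have e : ∫ x, ‖sym θ ξ₀ x₀ r hr f x‖ ^ 2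
        = ∫ x, (r ^ (-(d / 2) : ℝ)) ^ 2 * ‖f (r⁻¹ • (x - x₀))‖ ^ 2 := by
      refine integral_congr_ae ?_
      filter_upwards [sym_ae θ ξ₀ x₀ hr f] with x hx
      rw [hx, norm_symFun _ _ _ hr, mul_pow]
    rw [e, integral_const_mul, integral_affine x₀ hr fun x => ‖f x‖ ^ 2, smul_eq_mul, ← mul_assoc,
      ← Real.rpow_natCast (r ^ _), ← Real.rpow_mul hr.le, ← Real.rpow_add hr]
    norm_num
  exact (sq_eq_sq₀ (norm_nonneg _) (norm_nonneg _)).1 h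

lemma sym_sub (θ : ℝ) (ξ₀ x₀ : Space d) {r : ℝ} (hr : 0 < r) (f g : L2 d) :
    sym θ ξ₀ x₀ r hr (f - g) = sym θ ξ₀ x₀ r hr f - sym θ ξ₀ x₀ r hr g := by
  refine Lp.ext ?_
  have h := (quasiMeasurePreserving_affine x₀ hr).ae_eq (Lp.coeFn_sub f g)
  filter_upwards [sym_ae θ ξ₀ x₀ hr (f - g), sym_ae θ ξ₀ x₀ hr f, sym_ae θ ξ₀ x₀ hr g, h,
    Lp.coeFn_sub (sym θ ξ₀ x₀ r hr f) (sym θ ξ₀ x₀ r hr g)] with x h1 h2 h3 h4 h5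
  simp only [Function.comp] at h4
  rw [h1, h5, Pi.sub_apply, h2, h3, symFun, symFun, symFun, h4, Pi.sub_apply, mul_sub]

lemma integrable_symFun (θ : ℝ) (ξ₀ x₀ : Space d) {r : ℝ} (hr : 0 < r) {f : Space d → ℂ}
    (hf : Integrable f volume) : Integrable (symFun θ ξ₀ x₀ r f) volume := by
  have h1 : Integrable (fun x => f (r⁻¹ • (x - x₀))) volume :=
    (hf.comp_smul (inv_ne_zero hr.ne')).comp_sub_right x₀
  refine (h1.norm.const_mul (r ^ (-(d / 2) : ℝ))).mono' ?_
    (Eventually.of_forall fun x => (norm_symFun θ ξ₀ x₀ hr f x).le)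
  exact (by fun_prop : Continuous fun x : Space d =>
      ((r ^ (-(d / 2) : ℝ) : ℝ) : ℂ) * Complex.exp (θ * Complex.I)
        * Complex.exp ((inner ℝ x ξ₀ : ℝ) * Complex.I)).aestronglyMeasurable.mul
          h1.aestronglyMeasurable

lemma integral_norm_symFun (θ : ℝ) (ξ₀ x₀ : Space d) {r : ℝ} (hr : 0 < r) (f : Space d → ℂ) :
    ∫ x, ‖symFun θ ξ₀ x₀ r f x‖ = r ^ (d / 2 : ℝ) * ∫ x, ‖f x‖ := by
  simp only [norm_symFun θ ξ₀ x₀ hr f]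
  rw [integral_const_mul, integral_affine x₀ hr fun x => ‖f x‖, smul_eq_mul, ← mul_assoc,
    ← Real.rpow_add hr]
  congr 2; ring

/-- The Fourier transform intertwines a symmetry with a symmetry of inverse scale. -/
lemma norm_fourier_symFun (θ : ℝ) (ξ₀ x₀ : Space d) {r : ℝ} (hr : 0 < r) (f : Space d → ℂ)
    (ξ : Space d) : ‖𝓕 (symFun θ ξ₀ x₀ r f) ξ‖
      = r ^ (d / 2 : ℝ) * ‖𝓕 f (r • (ξ - (2 * Real.pi)⁻¹ • ξ₀))‖ := by
  set c : ℂ := ((r ^ (-(d / 2) : ℝ) : ℝ) : ℂ) * Complex.exp (θ * Complex.I)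
    * Complex.exp ((inner ℝ x₀ ξ₀ - 2 * Real.pi * inner ℝ x₀ ξ : ℝ) * Complex.I) with hc
  set g : Space d → ℂ := fun y => c * (Complex.exp
    ((-2 * Real.pi * inner ℝ y (r • (ξ - (2 * Real.pi)⁻¹ • ξ₀)) : ℝ) * Complex.I) • f y) with hg
  have hnc : ‖c‖ = r ^ (-(d / 2) : ℝ) := by
    simp only [hc, norm_mul, Complex.norm_exp_ofReal_mul_I, mul_one, Complex.norm_real]
    rw [Real.norm_of_nonneg (by positivity)]
  have e : 𝓕 (symFun θ ξ₀ x₀ r f) ξ = ∫ x, g (r⁻¹ • (x - x₀)) := by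
    rw [Real.fourier_eq']
    refine integral_congr_ae (Eventually.of_forall fun x => ?_)
    have hexp : Complex.exp ((-2 * Real.pi * inner ℝ x ξ : ℝ) * Complex.I)
        * Complex.exp ((inner ℝ x ξ₀ : ℝ) * Complex.I)
        = Complex.exp ((inner ℝ x₀ ξ₀ - 2 * Real.pi * inner ℝ x₀ ξ : ℝ) * Complex.I)
          * Complex.exp ((-2 * Real.pi * inner ℝ (r⁻¹ • (x - x₀))
            (r • (ξ - (2 * Real.pi)⁻¹ • ξ₀)) : ℝ) * Complex.I) := by
      simp only [← Complex.exp_add, ← add_mul, ← Complex.ofReal_add]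
      congr 3
      simp only [inner_smul_left, inner_smul_right, inner_sub_left, inner_sub_right, conj_trivial]
      field_simp
      ring
    simp only [hg, hc, symFun, smul_eq_mul]
    linear_combination ((r ^ (-(d / 2) : ℝ) : ℝ) : ℂ) * Complex.exp (θ * Complex.I)
      * f (r⁻¹ • (x - x₀)) * hexp
  rw [e, integral_affine x₀ hr g, hg, integral_const_mul, ← Real.fourier_eq', norm_smul, norm_mul,
    hnc, Real.norm_of_nonneg (by positivity), ← mul_assoc, ← Real.rpow_add hr]
  congr 2; ring

/-- The free evolution of a symmetry of scale `r` of a function with integrable Fourier transform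
is bounded by a multiple of `r^{-d/2}`. -/
lemma ae_norm_freeProp_sym_le (t θ : ℝ) (ξ₀ x₀ : Space d) {r : ℝ} (hr : 0 < r) {f : L2 d}
    (hf : Integrable f volume) (hf' : Integrable (𝓕 (f : Space d → ℂ)) volume) :
    ∀ᵐ x, ‖freeProp t (sym θ ξ₀ x₀ r hr f) x‖
      ≤ r ^ (-(d / 2) : ℝ) * ∫ ξ, ‖𝓕 (f : Space d → ℂ) ξ‖ := by
  set g := sym θ ξ₀ x₀ r hr f with hg
  have hgae := sym_ae θ ξ₀ x₀ hr f
  have hgi : Integrable g volume := (integrable_symFun θ ξ₀ x₀ hr hf).congr hgae.symm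
  have hF : 𝓕 (g : Space d → ℂ) = 𝓕 (symFun θ ξ₀ x₀ r f) := by
    funext ξ
    rw [Real.fourier_eq', Real.fourier_eq']
    refine integral_congr_ae ?_
    filter_upwards [hgae] with x hx
    rw [hx]
  have hGae := fourier_ae_eq g hgi
  have hn : ∀ ξ, ‖𝓕 (g : Space d → ℂ) ξ‖
      = r ^ (d / 2 : ℝ) * ‖𝓕 (f : Space d → ℂ) (r • (ξ - (2 * Real.pi)⁻¹ • ξ₀))‖ := fun ξ => by
    rw [hF, norm_fourier_symFun θ ξ₀ x₀ hr]
  have hcont : Continuous (𝓕 (g : Space d → ℂ)) :=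
    VectorFourier.fourierIntegral_continuous Real.continuous_fourierChar continuous_inner hgi
  have hGi : Integrable (𝓕 (g : Space d → ℂ)) volume := by
    have h1 : Integrable (fun ξ => 𝓕 (f : Space d → ℂ) (r • (ξ - (2 * Real.pi)⁻¹ • ξ₀))) volume :=
      (hf'.comp_smul hr.ne').comp_sub_right _
    exact (h1.norm.const_mul (r ^ (d / 2 : ℝ))).mono' hcont.aestronglyMeasurable
      (Eventually.of_forall fun ξ => (hn ξ).le)
  have h := ae_norm_freeProp_le t g (hGi.congr hGae.symm)
  have e : ∫ ξ, ‖(𝓕 g : L2 d) ξ‖ = r ^ (-(d / 2) : ℝ) * ∫ ξ, ‖𝓕 (f : Space d → ℂ) ξ‖ := by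
    have e1 : ∫ ξ, ‖(𝓕 g : L2 d) ξ‖ = ∫ ξ, ‖𝓕 (g : Space d → ℂ) ξ‖ :=
      integral_congr_ae (by filter_upwards [hGae] with x hx; rw [hx])
    have h2 := integral_affine ((2 * Real.pi)⁻¹ • ξ₀) (inv_pos.2 hr)
      fun ξ => ‖𝓕 (f : Space d → ℂ) ξ‖
    simp only [inv_inv, smul_eq_mul] at h2
    rw [e1]
    simp only [hn]
    rw [integral_const_mul, h2, ← mul_assoc, Real.inv_rpow hr.le, ← Real.rpow_neg hr.le,
      ← Real.rpow_add hr]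
    congr 2; ring
  rwa [e] at h

/-- The space-time norm of the free evolution on short intervals, for bounded evolutions. -/
lemma stNorm_rpow_freeProp_le (hd : 1 ≤ d) {J : Set ℝ} {v : L2 d} {a B : ℝ}
    (h : ∀ t, ∀ᵐ x, ‖freeProp t v x‖ ≤ B) :
    stNorm J (fun s => freeProp s (freeProp a v)) ^ qE d
      ≤ ENNReal.ofReal B ^ (qE d - 2) * ENNReal.ofReal (‖v‖ ^ 2) * volume J := by
  have hq := two_lt_qE hd
  rw [stNorm_rpow hd, ← setLIntegral_const]
  refine lintegral_mono fun s => ?_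
  rw [normQ_rpow hd, freeProp_freeProp, ← norm_freeProp (s + a) v, ← lintegral_enorm_sq_L2,
    ← lintegral_const_mul' _ _ (ENNReal.rpow_ne_top_of_nonneg (by linarith) ENNReal.ofReal_ne_top)]
  refine lintegral_mono_ae ?_
  filter_upwards [h (s + a)] with x hx
  have e : qE d = (qE d - 2) + 2 := by ring
  nth_rw 1 [e]
  rw [ENNReal.rpow_add_of_nonneg _ _ (by linarith) (by norm_num)]
  refine mul_le_mul_left (ENNReal.rpow_le_rpow ?_ (by linarith)) _
  rw [← ofReal_norm]
  exact ENNReal.ofReal_le_ofReal hx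

/-- Near a finite end point of its interval, a maximal solution stays away from the symmetries of
scale bounded below of any fixed nice function: its free evolution would otherwise be small in
space-time, and the solution would continue. -/
lemma IsMaximalSolution.le_norm_sub_sym (hd : 1 ≤ d) {μ : ℝ} (hμ : |μ| = 1) {I : Set ℝ}
    {u : ℝ → L2 d} (hu : IsMaximalSolution μ I u) {T : ℝ} (hT : IsEndpoint I T) :
    ∃ ε > 0, ∀ f : L2 d, Integrable f volume → Integrable (𝓕 (f : Space d → ℂ)) volume →
      ∀ c > 0, ∃ δ > 0, ∀ t ∈ I, |t - T| < δ → ∀ (θ : ℝ) (ξ₀ x₀ : Space d) (r : ℝ) (hr : 0 < r),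
        c ≤ r → ε ≤ ‖u t - sym θ ξ₀ x₀ r hr f‖ := by
  have hq := two_lt_qE hd
  have hq0 := qE_pos hd
  obtain ⟨η, hη0, hηt, hη⟩ := exists_small hd
  have hη4 : η / 2 / 2 ≠ 0 := by simp [ENNReal.div_eq_zero_iff, hη0]
  obtain ⟨ε, hε0, hε⟩ : ∃ ε : ℝ, 0 < ε ∧ strConst d * ENNReal.ofReal ε < η / 2 / 2 := by
    have h : Tendsto (fun ε : ℝ => strConst d * ENNReal.ofReal ε) (𝓝[>] 0) (𝓝 0) := by
      have h1 := (ENNReal.continuous_ofReal.tendsto 0).mono_left (nhdsWithin_le_nhds (s := Ioi 0))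
      have := ENNReal.Tendsto.const_mul h1 (Or.inr (strConst_ne_top hd))
      simpa using this
    obtain ⟨ε, h1, h2⟩ :=
      ((h.eventually (gt_mem_nhds hη4.bot_lt)).and self_mem_nhdsWithin).exists
    exact ⟨ε, h2, h1⟩
  refine ⟨ε, hε0, fun f hf hf' c hc => ?_⟩
  set M := ∫ ξ, ‖𝓕 (f : Space d → ℂ) ξ‖ with hM
  have hM0 : 0 ≤ M := integral_nonneg fun _ => norm_nonneg _
  set K := ENNReal.ofReal (c ^ (-(d / 2) : ℝ) * M) ^ (qE d - 2) * ENNReal.ofReal (‖f‖ ^ 2) with hK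
  have hKt : K ≠ ⊤ := ENNReal.mul_ne_top
    (ENNReal.rpow_ne_top_of_nonneg (by linarith) ENNReal.ofReal_ne_top) ENNReal.ofReal_ne_top
  have hηq : (η / 2 / 2) ^ qE d ≠ 0 := by
    simp [ENNReal.rpow_eq_zero_iff, hη4, not_lt.2 hq0.le]
  obtain ⟨δ, hδ0, hδ⟩ : ∃ δ : ℝ, 0 < δ ∧ K * ENNReal.ofReal δ < (η / 2 / 2) ^ qE d := by
    have h : Tendsto (fun δ : ℝ => K * ENNReal.ofReal δ) (𝓝[>] 0) (𝓝 0) := by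
      have h1 := (ENNReal.continuous_ofReal.tendsto 0).mono_left (nhdsWithin_le_nhds (s := Ioi 0))
      have := ENNReal.Tendsto.const_mul h1 (Or.inr hKt)
      simpa using this
    obtain ⟨δ, h1, h2⟩ :=
      ((h.eventually (gt_mem_nhds hηq.bot_lt)).and self_mem_nhdsWithin).exists
    exact ⟨δ, h2, h1⟩
  refine ⟨δ, hδ0, fun t ht htT θ ξ₀ x₀ r hr hcr => ?_⟩
  by_contra! hlt
  set g := sym θ ξ₀ x₀ r hr f with hg
  have hsplit : (fun s => freeProp s (freeProp (-t) (u t)))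
      = fun s => freeProp s (freeProp (-t) (u t - g)) + freeProp s (freeProp (-t) g) := by
    funext s
    rw [← freeProp_add, ← freeProp_add, sub_add_cancel]
  have h1 : stNorm (uIcc t T) (fun s => freeProp s (freeProp (-t) (u t - g))) ≤ η / 2 / 2 := by
    refine (stNorm_freeProp_le hd _ _).trans (le_trans (mul_le_mul_right ?_ _) hε.le)
    rw [← ofReal_norm, norm_freeProp]
    exact ENNReal.ofReal_le_ofReal hlt.le
  have h2 : stNorm (uIcc t T) (fun s => freeProp s (freeProp (-t) g)) ≤ η / 2 / 2 := by
    have h3 := stNorm_rpow_freeProp_le hd (J := uIcc t T) (a := -t)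
      fun s => ae_norm_freeProp_sym_le s θ ξ₀ x₀ hr hf hf'
    rw [norm_sym] at h3
    refine (ENNReal.rpow_le_rpow_iff hq0).1 (h3.trans (le_trans ?_ hδ.le))
    refine mul_le_mul' (mul_le_mul_left (ENNReal.rpow_le_rpow (ENNReal.ofReal_le_ofReal
      (mul_le_mul_of_nonneg_right ?_ hM0)) (by linarith)) _) ?_
    · exact Real.rpow_le_rpow_of_nonpos hc hcr (by simp; positivity)
    · rw [uIcc, Real.volume_Icc, max_sub_min_eq_abs, abs_sub_comm T t]
      exact ENNReal.ofReal_le_ofReal htT.le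
  have h3 := hu.lt_stNorm_freeProp hd hμ hT hη hη0 hηt ht
  rw [hsplit] at h3
  refine absurd h3 (not_lt.2 ((stNorm_add_le hd measurableSet_uIcc
    (continuous_freeProp _).continuousOn (continuous_freeProp _).continuousOn).trans
      ((add_le_add h1 h2).trans (ENNReal.add_halves _).le)))

/-! ### Weak convergence in the interaction picture -/

lemma continuous_sym (θ : ℝ) (ξ₀ x₀ : Space d) {r : ℝ} (hr : 0 < r) :
    Continuous (sym θ ξ₀ x₀ r hr) := by
  refine (Isometry.of_dist_eq fun f g => ?_).continuous
  rw [dist_eq_norm, dist_eq_norm, ← sym_sub, norm_sym]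

/-- The projection to the orbit space is open, as `G` acts by homeomorphisms. -/
lemma isOpen_image_orbit {V : Set (L2 d)} (hV : IsOpen V) :
    IsOpen ((fun f => (Quotient.mk (orbitSetoid d) f : OrbitSpace d)) '' V) := by
  have h : (fun f => (Quotient.mk (orbitSetoid d) f : OrbitSpace d)) ⁻¹'
      ((fun f => (Quotient.mk (orbitSetoid d) f : OrbitSpace d)) '' V)
      = ⋃ (θ : ℝ) (ξ₀ : Space d) (x₀ : Space d) (r : ℝ) (hr : 0 < r),
        sym θ ξ₀ x₀ r hr ⁻¹' V := by
    ext f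
    simp only [mem_preimage, mem_image, mem_iUnion]
    constructor
    · rintro ⟨g, hg, hgf⟩
      obtain ⟨θ, ξ₀, x₀, r, hr, rfl⟩ := Quotient.exact hgf.symm
      exact ⟨θ, ξ₀, x₀, r, hr, hg⟩
    · rintro ⟨θ, ξ₀, x₀, r, hr, h⟩
      exact ⟨_, h,
        (Quotient.sound ⟨θ, ξ₀, x₀, r, hr, rfl⟩ : Quotient.mk (orbitSetoid d) f = _).symm⟩
  have h2 : IsOpen ((fun f => (Quotient.mk (orbitSetoid d) f : OrbitSpace d)) ⁻¹'
      ((fun f => (Quotient.mk (orbitSetoid d) f : OrbitSpace d)) '' V)) := by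
    rw [h]
    exact isOpen_iUnion fun θ => isOpen_iUnion fun ξ₀ => isOpen_iUnion fun x₀ =>
      isOpen_iUnion fun r => isOpen_iUnion fun hr => hV.preimage (continuous_sym θ ξ₀ x₀ hr)
  exact isQuotientMap_quot_mk.isOpen_preimage.1 h2

/-- An almost periodic solution is, up to symmetries and small errors, one of finitely many
Schwartz functions. -/
lemma AlmostPeriodicModG.exists_finset {I : Set ℝ} {u : ℝ → L2 d} (h : AlmostPeriodicModG I u)
    {ε : ℝ} (hε : 0 < ε) : ∃ S : Finset 𝓢(Space d, ℂ), ∀ t ∈ I, ∃ f ∈ S,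
      ∃ (θ : ℝ) (ξ₀ x₀ : Space d) (r : ℝ) (hr : 0 < r),
        ‖u t - sym θ ξ₀ x₀ r hr (f.toLp 2 volume)‖ < ε := by
  obtain ⟨S, hS⟩ := IsCompact.elim_finite_subcover h
    (fun f : 𝓢(Space d, ℂ) => (fun f => (Quotient.mk (orbitSetoid d) f : OrbitSpace d)) ''
      Metric.ball (f.toLp 2 volume : L2 d) ε) (fun f => isOpen_image_orbit Metric.isOpen_ball)
    (fun q _ => by
      obtain ⟨v, rfl⟩ := Quotient.exists_rep q
      obtain ⟨f, hf⟩ := schwartz_dense.exists_dist_lt v hε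
      exact mem_iUnion.2 ⟨f, v, hf, rfl⟩)
  refine ⟨S, fun t ht => ?_⟩
  obtain ⟨f, hf, v, hv, hvt⟩ := mem_iUnion₂.1 (hS (subset_closure (mem_image_of_mem _ ht)))
  obtain ⟨θ, ξ₀, x₀, r, hr, hsym⟩ := Quotient.exact hvt
  refine ⟨f, hf, θ, ξ₀, x₀, r, hr, ?_⟩
  rw [← hsym, ← sym_sub, norm_sym, ← dist_eq_norm]
  exact hv

lemma norm_inner_le_of_ae {f g : L2 d} {B : ℝ} (hf : ∀ᵐ x, ‖f x‖ ≤ B) (hg : Integrable g volume) :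
    ‖(inner ℂ f g : ℂ)‖ ≤ B * ∫ x, ‖g x‖ := by
  rw [L2.inner_def, ← integral_const_mul]
  refine norm_integral_le_of_norm_le (hg.norm.const_mul B) ?_
  filter_upwards [hf] with x hx
  exact (norm_inner_le_norm _ _).trans (mul_le_mul_of_nonneg_right hx (norm_nonneg _))

lemma integrable_toLp (f : 𝓢(Space d, ℂ)) : Integrable (f.toLp 2 volume : L2 d) volume :=
  f.integrable.congr (SchwartzMap.coeFn_toLp f 2 volume).symm

lemma integrable_fourier_toLp (f : 𝓢(Space d, ℂ)) :
    Integrable (𝓕 ((f.toLp 2 volume : L2 d) : Space d → ℂ)) volume := by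
  have h : 𝓕 ((f.toLp 2 volume : L2 d) : Space d → ℂ) = 𝓕 (f : Space d → ℂ) := by
    funext ξ
    rw [Real.fourier_eq', Real.fourier_eq']
    refine integral_congr_ae ?_
    filter_upwards [SchwartzMap.coeFn_toLp f 2 volume] with x hx
    rw [hx]
  rw [h, ← SchwartzMap.fourier_coe]
  exact (𝓕 f).integrable

/-- To prove weak convergence to zero along an almost periodic solution, it is enough to test with
Schwartz functions, against the symmetries of a Schwartz function that are close to the solution. -/
lemma AlmostPeriodicModG.weakTendsto_zero {I : Set ℝ} {u : ℝ → L2 d} (hap : AlmostPeriodicModG I u)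
    {l : Filter ℝ} (hl : l ≤ 𝓟 I) {ε₀ : ℝ} (hε₀ : 0 < ε₀)
    (H : ∀ f φ : 𝓢(Space d, ℂ), ∀ ε > 0, ∀ᶠ t in l, ∀ (θ : ℝ) (ξ₀ x₀ : Space d) (r : ℝ)
      (hr : 0 < r), ‖u t - sym θ ξ₀ x₀ r hr (f.toLp 2 volume)‖ < ε₀ →
        ‖(inner ℂ (freeProp t (φ.toLp 2 volume)) (sym θ ξ₀ x₀ r hr (f.toLp 2 volume)) : ℂ)‖ ≤ ε) :
    WeakTendsto (fun t => freeProp (-t) (u t)) l 0 := by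
  intro ψ
  rw [inner_zero_right]
  -- the solution is bounded
  obtain ⟨M, hM0, hM⟩ : ∃ M > 0, ∀ t ∈ I, ‖u t‖ ≤ M := by
    obtain ⟨S, hS⟩ := hap.exists_finset one_pos
    refine ⟨∑ f ∈ S, ‖(f.toLp 2 volume : L2 d)‖ + 1, by positivity, fun t ht => ?_⟩
    obtain ⟨f, hf, θ, ξ₀, x₀, r, hr, h⟩ := hS t ht
    have h1 := Finset.single_le_sum (f := fun f : 𝓢(Space d, ℂ) => ‖(f.toLp 2 volume : L2 d)‖)
      (fun _ _ => norm_nonneg _) hf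
    have h2 := norm_le_norm_add_norm_sub' (u t) (sym θ ξ₀ x₀ r hr (f.toLp 2 volume))
    rw [norm_sym] at h2
    linarith
  rw [Metric.tendsto_nhds]
  intro ε hε
  obtain ⟨φ, hφ⟩ := schwartz_dense.exists_dist_lt ψ (show 0 < ε / 4 / M by positivity)
  set φ' : L2 d := φ.toLp 2 volume
  rw [dist_eq_norm, lt_div_iff₀ hM0] at hφ
  obtain ⟨S, hS⟩ := hap.exists_finset (ε := min ε₀ (ε / 4 / (‖φ'‖ + 1)))
    (lt_min hε₀ (by positivity))
  have hall : ∀ᶠ t in l, ∀ f ∈ S, ∀ (θ : ℝ) (ξ₀ x₀ : Space d) (r : ℝ)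
      (hr : 0 < r), ‖u t - sym θ ξ₀ x₀ r hr (f.toLp 2 volume)‖ < ε₀ →
        ‖(inner ℂ (freeProp t φ') (sym θ ξ₀ x₀ r hr (f.toLp 2 volume)) : ℂ)‖ ≤ ε / 4 :=
    (Finset.eventually_all S).2 fun f _ => H f φ (ε / 4) (by positivity)
  filter_upwards [hall, le_principal_iff.1 hl] with t ht htI
  obtain ⟨f, hf, θ, ξ₀, x₀, r, hr, h⟩ := hS t htI
  have h1 := ht f hf θ ξ₀ x₀ r hr (h.trans_le (min_le_left _ _))
  have h2 := h.le.trans (min_le_right _ _)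
  rw [le_div_iff₀ (by positivity)] at h2
  set g := sym θ ξ₀ x₀ r hr (f.toLp 2 volume)
  have e : (inner ℂ ψ (freeProp (-t) (u t)) : ℂ) = inner ℂ (ψ - φ') (freeProp (-t) (u t))
      + (inner ℂ (freeProp t φ') (u t - g) + inner ℂ (freeProp t φ') g) := by
    rw [← inner_add_right, sub_add_cancel, inner_freeProp_left, ← inner_add_left, sub_add_cancel]
  have h3 : ‖(inner ℂ (ψ - φ') (freeProp (-t) (u t)) : ℂ)‖ ≤ ε / 4 := by
    refine (norm_inner_le_norm _ _).trans ?_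
    rw [norm_freeProp]
    exact (mul_le_mul_of_nonneg_left (hM t htI) (norm_nonneg _)).trans hφ.le
  have h4 : ‖(inner ℂ (freeProp t φ') (u t - g) : ℂ)‖ ≤ ε / 4 := by
    refine (norm_inner_le_norm _ _).trans ?_
    rw [norm_freeProp, mul_comm]
    exact (mul_le_mul_of_nonneg_left (by linarith) (norm_nonneg _)).trans h2
  rw [dist_zero_right, e]
  have h5 := norm_add_le (inner ℂ (ψ - φ') (freeProp (-t) (u t)) : ℂ)
    (inner ℂ (freeProp t φ') (u t - g) + inner ℂ (freeProp t φ') g)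
  have h6 := norm_add_le (inner ℂ (freeProp t φ') (u t - g) : ℂ) (inner ℂ (freeProp t φ') g)
  linarith

/-- At an infinite end point, the pairing of `e^{itΔ} φ` with a symmetry of `f` of scale `r` is
bounded by multiples of `r^{-d/2}` and of `(r/|t|)^{d/2}`, hence by one of `|t|^{-d/4}`. -/
lemma AlmostPeriodicModG.weakTendsto_of_infinite (hd : 1 ≤ d) {I : Set ℝ} {u : ℝ → L2 d}
    (hap : AlmostPeriodicModG I u) {l : Filter ℝ} (hl : l ≤ 𝓟 I)
    (hinf : Tendsto (fun t : ℝ => |t|) l atTop) :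
    WeakTendsto (fun t => freeProp (-t) (u t)) l 0 := by
  refine hap.weakTendsto_zero hl one_pos fun f φ ε hε => ?_
  have hd0 := cast_pos_of_one_le hd
  set f' : L2 d := f.toLp 2 volume
  set φ' : L2 d := φ.toLp 2 volume
  have hfi : Integrable f' volume := integrable_toLp f
  have hφi : Integrable φ' volume := integrable_toLp φ
  set K := (∫ x, ‖𝓕 (f' : Space d → ℂ) x‖) * (∫ x, ‖φ' x‖) * ((∫ x, ‖φ' x‖) * ∫ x, ‖f' x‖)
  have hlim : Tendsto (fun t : ℝ => (4 * Real.pi * |t|) ^ (-(d / 2) : ℝ) * K) l (𝓝 0) := by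
    have h1 : Tendsto (fun t : ℝ => 4 * Real.pi * |t|) l atTop :=
      hinf.const_mul_atTop (by positivity)
    have h2 := (tendsto_rpow_neg_atTop (show (0 : ℝ) < d / 2 by positivity)).comp h1
    simpa using h2.mul_const K
  filter_upwards [hlim.eventually (gt_mem_nhds (show 0 < ε ^ 2 by positivity)),
    hinf.eventually_gt_atTop 0] with t ht ht0 θ ξ₀ x₀ r hr _
  have ht0 : t ≠ 0 := abs_pos.1 ht0
  set g := sym θ ξ₀ x₀ r hr f' with hg
  have hgi : Integrable g volume := (integrable_symFun θ ξ₀ x₀ hr hfi).congr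
    (sym_ae θ ξ₀ x₀ hr f').symm
  have hg1 : ∫ x, ‖g x‖ = r ^ (d / 2 : ℝ) * ∫ x, ‖f' x‖ := by
    rw [← integral_norm_symFun θ ξ₀ x₀ hr]
    refine integral_congr_ae ?_
    filter_upwards [sym_ae θ ξ₀ x₀ hr f'] with x hx
    rw [hx]
  have h1 : ‖(inner ℂ (freeProp t φ') g : ℂ)‖
      ≤ (4 * Real.pi * |t|) ^ (-(d / 2) : ℝ) * (∫ x, ‖φ' x‖) * (r ^ (d / 2 : ℝ) * ∫ x, ‖f' x‖) := by
    rw [← hg1]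
    exact norm_inner_le_of_ae (dispersive ht0 φ' hφi) hgi
  have h2 : ‖(inner ℂ (freeProp t φ') g : ℂ)‖
      ≤ r ^ (-(d / 2) : ℝ) * (∫ x, ‖𝓕 (f' : Space d → ℂ) x‖) * ∫ x, ‖φ' x‖ := by
    rw [inner_freeProp_left, ← norm_inner_symm]
    exact norm_inner_le_of_ae (ae_norm_freeProp_sym_le (-t) θ ξ₀ x₀ hr hfi
      (integrable_fourier_toLp f)) hφi
  have h3 := mul_le_mul h2 h1 (norm_nonneg _) ((norm_nonneg _).trans h2)
  have e : r ^ (-(d / 2) : ℝ) * (∫ x, ‖𝓕 (f' : Space d → ℂ) x‖) * (∫ x, ‖φ' x‖)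
      * ((4 * Real.pi * |t|) ^ (-(d / 2) : ℝ) * (∫ x, ‖φ' x‖) * (r ^ (d / 2 : ℝ) * ∫ x, ‖f' x‖))
      = (4 * Real.pi * |t|) ^ (-(d / 2) : ℝ) * K := by
    have : r ^ (-(d / 2) : ℝ) * r ^ (d / 2 : ℝ) = 1 := by
      rw [← Real.rpow_add hr]; simp
    linear_combination (4 * Real.pi * |t|) ^ (-(d / 2) : ℝ) * K * this
  rw [e] at h3
  exact abs_le_of_sq_le_sq' (by nlinarith) hε.le |>.2

/-- At a finite end point, the scales of the symmetries that approximate a maximal solution tend to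
zero, and the pairing of `e^{itΔ} φ` with a symmetry of `f` of scale `r` is bounded by a multiple
of `r^{d/2}`. -/
lemma AlmostPeriodicModG.weakTendsto_of_endpoint (hd : 1 ≤ d) {μ : ℝ} (hμ : |μ| = 1) {I : Set ℝ}
    {u : ℝ → L2 d} (hap : AlmostPeriodicModG I u) (hu : IsMaximalSolution μ I u) {T : ℝ}
    (hT : IsEndpoint I T) : WeakTendsto (fun t => freeProp (-t) (u t)) (𝓝[I] T) 0 := by
  have hd0 := cast_pos_of_one_le hd
  obtain ⟨ε₀, hε₀, hext⟩ := hu.le_norm_sub_sym hd hμ hT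
  refine hap.weakTendsto_zero inf_le_right hε₀ fun f φ ε hε => ?_
  set f' : L2 d := f.toLp 2 volume
  set φ' : L2 d := φ.toLp 2 volume
  have hfi : Integrable f' volume := integrable_toLp f
  have hφF : Integrable (𝓕 φ' : L2 d) volume :=
    (integrable_fourier_toLp φ).congr (fourier_ae_eq φ' (integrable_toLp φ)).symm
  set K := (∫ x, ‖(𝓕 φ' : L2 d) x‖) * ∫ x, ‖f' x‖
  have hK0 : 0 ≤ K := by positivity
  obtain ⟨c, hc0, hc⟩ : ∃ c > 0, c ^ (d / 2 : ℝ) * K < ε := by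
    have h : Tendsto (fun c : ℝ => c ^ (d / 2 : ℝ) * K) (𝓝[>] 0) (𝓝 0) := by
      have h1 : Continuous fun c : ℝ => c ^ (d / 2 : ℝ) * K :=
        (continuous_id.rpow_const fun _ => Or.inr (by positivity)).mul_const K
      have h2 := (h1.tendsto 0).mono_left (nhdsWithin_le_nhds (s := Ioi 0))
      rwa [Real.zero_rpow (by positivity), zero_mul] at h2
    obtain ⟨c, h1, h2⟩ := ((h.eventually (gt_mem_nhds hε)).and self_mem_nhdsWithin).exists
    exact ⟨c, h2, h1⟩
  obtain ⟨δ, hδ0, hδ⟩ := hext f' hfi (integrable_fourier_toLp f) c hc0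
  filter_upwards [self_mem_nhdsWithin,
    mem_nhdsWithin_of_mem_nhds (Metric.ball_mem_nhds T hδ0)] with t htI htT θ ξ₀ x₀ r hr hclose
  have hrc : r < c := by
    by_contra! hcr
    exact absurd hclose (not_lt.2 (hδ t htI htT θ ξ₀ x₀ r hr hcr))
  set g := sym θ ξ₀ x₀ r hr f' with hg
  have hgi : Integrable g volume := (integrable_symFun θ ξ₀ x₀ hr hfi).congr
    (sym_ae θ ξ₀ x₀ hr f').symm
  have hg1 : ∫ x, ‖g x‖ = r ^ (d / 2 : ℝ) * ∫ x, ‖f' x‖ := by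
    rw [← integral_norm_symFun θ ξ₀ x₀ hr]
    refine integral_congr_ae ?_
    filter_upwards [sym_ae θ ξ₀ x₀ hr f'] with x hx
    rw [hx]
  refine (norm_inner_le_of_ae (ae_norm_freeProp_le t φ' hφF) hgi).trans ?_
  rw [hg1, mul_left_comm]
  refine le_trans (mul_le_mul_of_nonneg_right ?_ hK0) hc.le
  exact Real.rpow_le_rpow hr.le hrc.le (by positivity)

lemma weakTendsto_atSup (hd : 1 ≤ d) {μ : ℝ} (hμ : |μ| = 1) {I : Set ℝ}
    {u : ℝ → L2 d} (hap : AlmostPeriodicModG I u) (hu : IsMaximalSolution μ I u) :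
    WeakTendsto (fun t => freeProp (-t) (u t)) (atSup I) 0 := by
  have hne : (((↑) : ℝ → EReal) '' I).Nonempty := hu.1.nonempty.image _
  have hcl := sSup_mem_closure hne
  have hle : ∀ t ∈ I, (t : EReal) ≤ sSup (((↑) : ℝ → EReal) '' I) := fun t ht =>
    le_sSup (mem_image_of_mem _ ht)
  unfold atSup
  generalize sSup (((↑) : ℝ → EReal) '' I) = s at *
  induction s with
  | bot =>
    obtain ⟨t, ht⟩ := hu.1.nonempty
    exact absurd (hle t ht) (not_le.2 (EReal.bot_lt_coe t))
  | coe T =>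
    rw [← EReal.isEmbedding_coe.nhds_eq_comap]
    refine hap.weakTendsto_of_endpoint hd hμ hu ⟨?_, Or.inl fun t ht => ?_⟩
    · rw [EReal.isEmbedding_coe.closure_eq_preimage_closure_image]
      exact hcl
    · exact EReal.coe_le_coe_iff.1 (hle t ht)
  | top =>
    refine hap.weakTendsto_of_infinite hd inf_le_right ?_
    refine tendsto_abs_atTop_atTop.comp (Tendsto.mono_left ?_ inf_le_left)
    rw [← EReal.tendsto_coe_nhds_top_iff]
    exact tendsto_comap

lemma weakTendsto_atInf (hd : 1 ≤ d) {μ : ℝ} (hμ : |μ| = 1) {I : Set ℝ}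
    {u : ℝ → L2 d} (hap : AlmostPeriodicModG I u) (hu : IsMaximalSolution μ I u) :
    WeakTendsto (fun t => freeProp (-t) (u t)) (atInf I) 0 := by
  have hne : (((↑) : ℝ → EReal) '' I).Nonempty := hu.1.nonempty.image _
  have hcl := sInf_mem_closure hne
  have hle : ∀ t ∈ I, sInf (((↑) : ℝ → EReal) '' I) ≤ (t : EReal) := fun t ht =>
    sInf_le (mem_image_of_mem _ ht)
  unfold atInf
  generalize sInf (((↑) : ℝ → EReal) '' I) = s at *
  induction s with
  | bot =>
    refine hap.weakTendsto_of_infinite hd inf_le_right ?_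
    refine tendsto_abs_atBot_atTop.comp (Tendsto.mono_left ?_ inf_le_left)
    rw [← EReal.tendsto_coe_nhds_bot_iff]
    exact tendsto_comap
  | coe T =>
    rw [← EReal.isEmbedding_coe.nhds_eq_comap]
    refine hap.weakTendsto_of_endpoint hd hμ hu ⟨?_, Or.inr fun t ht => ?_⟩
    · rw [EReal.isEmbedding_coe.closure_eq_preimage_closure_image]
      exact hcl
    · exact EReal.coe_le_coe_iff.1 (hle t ht)
  | top =>
    obtain ⟨t, ht⟩ := hu.1.nonempty
    exact absurd (hle t ht) (not_le.2 (EReal.coe_lt_top t))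

/-! ### The Duhamel formulas -/

/-- The Duhamel integrals from `t` converge weakly to `-i u(t)`: by the Duhamel formula they differ
from it by `i e^{itΔ}` applied to `e^{-ibΔ} u(b)`. -/
lemma WeakTendsto.freeProp_duh (hd : 1 ≤ d) {μ : ℝ} (hμ : |μ| = 1) {I : Set ℝ} {u : ℝ → L2 d}
    (hu : IsSolution μ I u) {l : Filter ℝ} (hl : l ≤ 𝓟 I)
    (h : WeakTendsto (fun t => freeProp (-t) (u t)) l 0) {t : ℝ} (ht : t ∈ I) :
    WeakTendsto (fun b => freeProp t (duh μ u t b)) l (-(Complex.I • u t)) := by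
  intro f
  have h1 := ((h (freeProp (-t) f)).const_mul Complex.I).const_add (inner ℂ f (-(Complex.I • u t)))
  rw [inner_zero_right, mul_zero, add_zero] at h1
  refine h1.congr' ?_
  filter_upwards [le_principal_iff.1 hl] with b hb
  rw [(hu.solves hd hμ ht).eq b hb, inner_freeProp_left, neg_neg, ← inner_smul_right,
    ← inner_add_right]
  congr 1
  rw [freeProp_sub, freeProp_smul, freeProp_freeProp, add_neg_cancel, freeProp_zero, smul_sub,
    smul_smul, Complex.I_mul_I]
  simp

lemma IsSolution.duh_symm (hd : 1 ≤ d) {μ : ℝ} (hμ : |μ| = 1) {I : Set ℝ} {u : ℝ → L2 d}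
    (hu : IsSolution μ I u) {a b : ℝ} (ha : a ∈ I) (hb : b ∈ I) : duh μ u a b = -duh μ u b a := by
  have h := duh_add hd hμ hu.ordConnected hu.continuousOn
    (fun _ ha _ hb => hu.stNorm_ne_top hd ha hb) ha hb ha
  rw [duh_self] at h
  exact eq_neg_of_add_eq_zero_left h

lemma IsSolution.hasDuhamelIntegral (hd : 1 ≤ d) {μ : ℝ} (hμ : |μ| = 1) {I : Set ℝ} {u : ℝ → L2 d}
    (hu : IsSolution μ I u) {a b : ℝ} (ha : a ∈ I) (hb : b ∈ I) (t : ℝ) :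
    HasDuhamelIntegral μ u t a b (freeProp t (duh μ u a b)) :=
  hasDuhamelIntegral_freeProp_duh hd hμ
    (hu.continuousOn.mono (uIoc_subset_of_mem hu.ordConnected ha hb))
    (stNorm_uIoc_ne_top hd (hu.stNorm_ne_top hd ha hb)) t

lemma hasAdvancedIntegral (hd : 1 ≤ d) {μ : ℝ} (hμ : |μ| = 1) {I : Set ℝ} {u : ℝ → L2 d}
    (hap : AlmostPeriodicModG I u) (hu : IsMaximalSolution μ I u) {t : ℝ} (ht : t ∈ I) :
    HasAdvancedIntegral μ I u t (-(Complex.I • u t)) :=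
  ⟨_, fun _ hb => hu.1.hasDuhamelIntegral hd hμ ht hb t,
    (weakTendsto_atSup hd hμ hap hu).freeProp_duh hd hμ hu.1 inf_le_right ht⟩

lemma hasRetardedIntegral (hd : 1 ≤ d) {μ : ℝ} (hμ : |μ| = 1) {I : Set ℝ} {u : ℝ → L2 d}
    (hap : AlmostPeriodicModG I u) (hu : IsMaximalSolution μ I u) {t : ℝ} (ht : t ∈ I) :
    HasRetardedIntegral μ I u t (Complex.I • u t) := by
  refine ⟨_, fun a ha => hu.1.hasDuhamelIntegral hd hμ ha ht t, fun f => ?_⟩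
  have h := ((weakTendsto_atInf hd hμ hap hu).freeProp_duh hd hμ hu.1 inf_le_right ht f).neg
  rw [← inner_neg_right, neg_neg] at h
  refine h.congr' ?_
  filter_upwards [le_principal_iff.1 (inf_le_right : atInf I ≤ 𝓟 I)] with a ha
  rw [← inner_neg_right, hu.1.duh_symm hd hμ ht ha, ← neg_one_smul ℂ (duh μ u a t), freeProp_smul]
  simp

end NLS

end

theorem mainTheorem6 (d : ℕ) (hd : 1 ≤ d) (μ : ℝ) (hμ : μ = 1 ∨ μ = -1)
    (I : Set ℝ) (u : ℝ → NLS.L2 d) (hu : NLS.IsMaximalSolution μ I u)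
    (hap : NLS.AlmostPeriodicModG I u) :
    NLS.WeakTendsto (fun t => NLS.freeProp (-t) (u t)) (NLS.atSup I) 0 ∧
    NLS.WeakTendsto (fun t => NLS.freeProp (-t) (u t)) (NLS.atInf I) 0 ∧
    (∀ t ∈ I, ∃ A : NLS.L2 d, NLS.HasAdvancedIntegral μ I u t A ∧ u t = Complex.I • A) ∧
    (∀ t ∈ I, ∃ B : NLS.L2 d, NLS.HasRetardedIntegral μ I u t B ∧ u t = -(Complex.I • B)) ∧
    (∀ P : NLS.L2 d →ₗ[ℂ] NLS.L2 d, ∀ t ∈ I, ∃ A B : NLS.L2 d,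
      NLS.HasAdvancedIntegral μ I u t A ∧ NLS.HasRetardedIntegral μ I u t B ∧
      u t = Complex.I • P A - Complex.I • (B - P B)) := by
  have hμ' : |μ| = 1 := by rcases hμ with rfl | rfl <;> simp
  refine ⟨NLS.weakTendsto_atSup hd hμ' hap hu, NLS.weakTendsto_atInf hd hμ' hap hu,
    fun t ht => ⟨_, NLS.hasAdvancedIntegral hd hμ' hap hu ht, ?_⟩,
    fun t ht => ⟨_, NLS.hasRetardedIntegral hd hμ' hap hu ht, ?_⟩,
    fun P t ht => ⟨_, _, NLS.hasAdvancedIntegral hd hμ' hap hu ht,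
      NLS.hasRetardedIntegral hd hμ' hap hu ht, ?_⟩⟩
  · rw [smul_neg, smul_smul, Complex.I_mul_I, neg_one_smul, neg_neg]
  · rw [smul_smul, Complex.I_mul_I, neg_one_smul, neg_neg]
  · rw [map_neg, map_smul, smul_sub, smul_neg, smul_smul, smul_smul, Complex.I_mul_I]
    simp
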